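/- **Setting.** Let $S$ be a finite-dimensional semisimple complex algebra and $M$ a finite-dimensional $S$-bimodule, with a dualizing structure: $\mathbb C$-linear involutions $*$ of $S$ and of $M$ with $(ab)^*=b^*a^*$ and $(amb)^*=b^*m^*a^*$. Put $D(S)=\{g\in S: g^*g=gg^*=1\}$ and $D(M)=\{m\in M: m^*=m\}$. The associated generalized supermixed quiver $\tilde Q$ is the triple $(H,R,D(M))$, where $H$ is the intersection of $D(S)$ with the span of the primitive central idempotents of $S$ (the centre of $S$), $R$ is the centralizer of $H$ in $D(S)$, and $R$ acts on $D(M)$ by $m\mapsto rmr^{-1}$. Let $M=\bigoplus_{j\in J}P_j$ be a decomposition into minimal nonzero $*$-stable sub-bimodules. A *supermixed quiver* is a finite quiver $Q$ with an involution $\sigma$ on vertices and on arrows, such that $\sigma t(\alpha)=h(\sigma\alpha)$, $\sigma h(\alpha)=t(\sigma\alpha)$, and $\sigma\alpha=\alpha$ whenever $t(\alpha)=\sigma h(\alpha)$, and with signs $\epsilon_i,\epsilon_\alpha\in\{\pm1\}$ such that $\epsilon_i\epsilon_{\sigma(i)}=1$ and $\epsilon_\alpha\epsilon_{\sigma(\alpha)}=\epsilon_{t(\alpha)}\epsilon_{h(\alpha)}$.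 A *form* on a family $(V_i)$ of vector spaces indexed by the vertices is a non-degenerate bilinear form $C$ on $\bigoplus V_i$ which vanishes on $V_i\times V_j$ for $j\ne\sigma(i)$ and satisfies $C(v,w)=\epsilon_iC(w,v)$ for $v\in V_i$, $w\in V_{\sigma(i)}$. A representation $\phi$ of $Q$ on $(V_i)$ is *supermixed* if $\phi_{\sigma(\alpha)}=\epsilon_\alpha\phi_\alpha^*$ for all $\alpha$, that is, $C(\phi_\alpha v,w)=\epsilon_\alpha C(v,\phi_{\sigma(\alpha)}w)$. The supermixed quiver $Q$ with dimension vector $n$ *corresponds* to $\tilde Q$ if there are a form $C$ on $V=(\mathbb C^{n_i})_i$ and an isomorphism $(S,M)\cong(\bigoplus_i\mathrm{End}(\mathbb C^{n_i}),\mathrm{Rep}(Q,n))$ of algebras and bimodules which takes $*$ on $S$ to the adjoint with respect to $C$, takes $*$ on $M$ to the involution $\phi\mapsto\phi'$ with $\phi'_{\sigma(\alpha)}=\epsilon_\alpha\phi_\alpha^*$, and takes the $P_j$ to the summands of $\mathrm{Rep}(Q,n)$ belonging to the $\sigma$-orbits of arrows (the orbit of $\alpha$ gets a label $j(\alpha)\in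 J$). It restricts to an isomorphism of $D(M)$ with the space of supermixed representations on $V$. Let $X$ be a complex manifold (for instance compact Kähler), and let $\mathbb M_j$ ($j\in J$) be holomorphic vector bundles on $X$, with typical fibres $M_j$ and frame bundles $F_j$. Let $D(M)\cap P_j=\bigoplus_kZ_{jk}$ be finite decompositions into $R$-stable subspaces (for instance irreducible ones), and let each $Z_{jk}$ be twisted by $\mathbb M_j$. * A *twisted $\tilde Q$-bundle* is a pair $(E,s)$ of a holomorphic principal $R$-bundle $E$ on $X$ and a holomorphic section $s$ of the bundle associated with $E\times_X\prod_jF_j$ and the representation $\bigoplus_{j,k}Z_{jk}\otimes M_j$ of $R\times\prod_j\mathrm{GL}(M_j)$. * A *supermixed twisted bundle representation* of $Q$ (of dimension vector $n$) consists of holomorphic vector bundles $\mathbb V_i$ of rank $n_i$, a holomorphic bilinear form $g$ on $\bigoplus\mathbb V_i$ which is a form (as above) on each fibre, and holomorphic morphisms $\phi_\alpha:\mathbb V_{t(\alpha)}\otimes\mathbb T_\alpha\to\mathbb V_{h(\alpha)}$ with $g(\phi_\alpha(v\otimes m),w)=\epsilon_\alpha\,g(v,\phi_{\sigma(\alpha)}(w\otimes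 m))$, where the twisting bundle is $\mathbb T_\alpha=\mathbb T_{\sigma(\alpha)}=\mathbb M_{j(\alpha)}^*$ (so that $\mathrm{Hom}(\mathbb V_{t(\alpha)}\otimes\mathbb T_\alpha,\mathbb V_{h(\alpha)})=\mathrm{Hom}(\mathbb V_{t(\alpha)},\mathbb V_{h(\alpha)})\otimes\mathbb M_{j(\alpha)}$). Isomorphisms cover the identity of $X$; those of the $(\mathbb V,g)$ are isometric and respect the vertices. **Theorem.** For every such $(S,M)$ and $(P_j)$ there is a corresponding supermixed quiver. For every corresponding $(Q,n)$, with a fixed isomorphism as above, there is an equivariant bijection between twisted $\tilde Q$-bundles and supermixed twisted bundle representations of $Q$. Precisely: 1. Every holomorphic principal $R$-bundle $E$ has an associated bundle with form $(\mathbb V,g)=E\times_RV$, and every $(\mathbb V,g)$ arises in this way from some $E$. 2. For every identification $(\mathbb V,g)\cong E\times_RV$, the isomorphism of $D(M)$ with the supermixed representations on $V$ induces a bijection from the sections $s$ as above to the families $\phi$ for which $(\mathbb V,g,\phi)$ is a supermixed twisted bundle representation. 3. For $(\mathbb V,g)\cong E\times_RV$ and $(\mathbb V',g')\cong E'\times_RV$,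 every isomorphism $E\to E'$ induces one $(\mathbb V,g)\to(\mathbb V',g')$; this is a bijection between the two sets of isomorphisms (for $E=E'$, between the gauge groups), with respect to which the bijections of (2) are equivariant. 4. Consequently $(E,s)\mapsto(\mathbb V,g,\phi)$ induces a bijection between isomorphism classes of twisted $\tilde Q$-bundles and isomorphism classes of supermixed twisted bundle representations of $Q$ of dimension vector $n$. -/

import Mathlib

open scoped ContDiff Manifold TensorProduct Topology

universe u v w

namespace Supermixed

/-! ### Dualmods, the dualizing group and the dualizing module -/

section Dualmod

variable (S : Type*) [Ring S] [Algebra ℂ S] [StarRing S]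
variable (M : Type*) [AddCommGroup M] [Module ℂ M] [Module S M] [Module Sᵐᵒᵖ M] [StarAddMonoid M]

/-- A dualizing structure on an algebra `S` and an `S`-bimodule `M`: the operations `star` on `S`
(an anti-automorphism of the ring, of order two) and on `M` (additive, of order two) are
`ℂ`-linear, and `(a m b)^* = b^* m^* a^*`.  The right action of `b` is the action of
`MulOpposite.op b`. -/
structure IsDualmod : Prop where
  star_smul_alg : ∀ (c : ℂ) (a : S), star (c • a) = c • star a
  star_smul_mod : ∀ (c : ℂ) (m : M), star (c • m) = c • star m
  star_bimod : ∀ (a b : S) (m : M),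
    star (a • (MulOpposite.op b • m)) = star b • (MulOpposite.op (star a) • star m)

/-- The dualizing group `D(S)` is `unitary S = {g | g^* g = g g^* = 1}`.  This is the subgroup
`H` of `D(S)`, the intersection of `D(S)` with the span of the primitive central idempotents of
`S`, that is (for semisimple `S`) with the centre of `S`. -/
def torus : Subgroup (unitary S) where
  carrier := {g | (g : S) ∈ Subalgebra.center ℂ S}
  one_mem' := (Subalgebra.center ℂ S).one_mem
  mul_mem' := fun ha hb => (Subalgebra.center ℂ S).mul_mem ha hb
  inv_mem' := fun {a} ha => by
    change ((a⁻¹ : unitary S) : S) ∈ Subalgebra.center ℂ S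
    rw [Subalgebra.mem_center_iff]
    intro b
    have h := (Subalgebra.mem_center_iff (R := ℂ).1 ha) b
    have h1 : ((a⁻¹ : unitary S) : S) * (a : S) = 1 := by
      rw [← Submonoid.coe_mul, inv_mul_cancel, Submonoid.coe_one]
    have h2 : (a : S) * ((a⁻¹ : unitary S) : S) = 1 := by
      rw [← Submonoid.coe_mul, mul_inv_cancel, Submonoid.coe_one]
    calc b * ((a⁻¹ : unitary S) : S)
        = ((a⁻¹ : unitary S) : S) * (a : S) * b * ((a⁻¹ : unitary S) : S) := by rw [h1, one_mul]
      _ = ((a⁻¹ : unitary S) : S) * (b * (a : S)) * ((a⁻¹ : unitary S) : S) := by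
          rw [h]; simp only [mul_assoc]
      _ = ((a⁻¹ : unitary S) : S) * b * ((a : S) * ((a⁻¹ : unitary S) : S)) := by
          simp only [mul_assoc]
      _ = ((a⁻¹ : unitary S) : S) * b := by rw [h2, mul_one]

/-- The structure group `R` of the generalized supermixed quiver: the centralizer of `H` in
`D(S)`. -/
abbrev StrGroup : Type _ := Subgroup.centralizer (torus S : Set (unitary S))

/-- An element of the structure group, as an element of the algebra. -/
def StrGroup.coord (r : StrGroup S) : S := ((r : unitary S) : S)

variable {S M}

/-- The dualizing module `D(M) = {m | m^* = m}`, the representation space. -/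
def selfDual (h : IsDualmod S M) : Submodule ℂ M where
  carrier := {m | star m = m}
  add_mem' := fun {a b} ha hb => by
    change star (a + b) = a + b
    rw [star_add]; exact congrArg₂ _ ha hb
  zero_mem' := star_zero M
  smul_mem' := fun c m hm => by
    change star (c • m) = c • m
    rw [h.star_smul_mod]; exact congrArg _ hm

/-- The action `m ↦ r m r^{-1}` (`= r m r^*`) of the structure group on the bimodule. -/
def conjAct [SMulCommClass S ℂ M] [SMulCommClass Sᵐᵒᵖ ℂ M] (r : StrGroup S) : M →ₗ[ℂ] M where
  toFun m := r.coord • (MulOpposite.op (r⁻¹).coord • m)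
  map_add' m m' := by simp only [smul_add]
  map_smul' c m := by simp only [RingHom.id_apply, smul_comm _ c]

/-- Sub-bimodules that are stable under the involution. -/
structure IsStarSubbimodule (N : Submodule ℂ M) : Prop where
  left : ∀ (a : S), ∀ m ∈ N, a • m ∈ N
  right : ∀ (b : S), ∀ m ∈ N, MulOpposite.op b • m ∈ N
  star_mem : ∀ m ∈ N, star m ∈ N

variable (S) in
/-- `M` is the internal direct sum of the `P j`, each of them a minimal nonzero sub-bimodule
stable under the involution. -/
structure IsDualDecomposition {J : Type*} (P : J → Submodule ℂ M) : Prop where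
  sub : ∀ j, IsStarSubbimodule (S := S) (P j)
  ne_bot : ∀ j, P j ≠ ⊥
  minimal : ∀ j (N : Submodule ℂ M), IsStarSubbimodule (S := S) N → N ≤ P j → N = ⊥ ∨ N = P j
  indep : iSupIndep P
  top : ⨆ j, P j = ⊤

/-- The representation space `D(M)` is the internal direct sum of the subspaces `Z j k`, which are
stable under the structure group, and `Z j k` lies in `P j`. -/
structure IsRepDecomposition [SMulCommClass S ℂ M] [SMulCommClass Sᵐᵒᵖ ℂ M] (h : IsDualmod S M)
    {J : Type*} (P : J → Submodule ℂ M) {K : J → Type*} (Z : ∀ j, K j → Submodule ℂ M) : Prop where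
  stable : ∀ j k (r : StrGroup S), ∀ m ∈ Z j k, conjAct r m ∈ Z j k
  le : ∀ j k, Z j k ≤ P j
  indep : iSupIndep (fun p : Sigma K => Z p.1 p.2)
  top : ⨆ p : Sigma K, Z p.1 p.2 = selfDual h

/-- The action of the structure group on a summand `Z j k`. -/
def IsRepDecomposition.act [SMulCommClass S ℂ M] [SMulCommClass Sᵐᵒᵖ ℂ M] {h : IsDualmod S M}
    {J : Type*} {P : J → Submodule ℂ M} {K : J → Type*} {Z : ∀ j, K j → Submodule ℂ M}
    (hZ : IsRepDecomposition h P Z) (j : J) (k : K j) (r : StrGroup S) : Z j k →ₗ[ℂ] Z j k :=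
  (conjAct r).restrict (hZ.stable j k r)

end Dualmod

/-! ### Supermixed quivers -/

/-- A supermixed quiver: a finite quiver with vertices `V`, arrows `A`, tails `t` and heads `h`,
an involution `σ`, and signs.  The adjoint with respect to forms `C` as in `IsForm` satisfies
`φ^{**} = ε_{t(α)} ε_{h(α)} φ` for a map `φ` along `α`, so that the conditions
`φ_{σ(α)} = ε_α φ_α^*` for `α` and for `σ(α)` agree precisely when `sign_arrow` holds. -/
structure Quiv where
  V : Type
  A : Type
  [finV : Finite V]
  [finA : Finite A]
  t : A → V
  h : A → V
  σV : V → V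
  σA : A → A
  σV_σV : ∀ i, σV (σV i) = i
  σA_σA : ∀ a, σA (σA a) = a
  σ_t : ∀ a, σV (t a) = h (σA a)
  σ_h : ∀ a, σV (h a) = t (σA a)
  fixed : ∀ a, t a = σV (h a) → σA a = a
  εV : V → ℤˣ
  εA : A → ℤˣ
  sign_vertex : ∀ i, εV i * εV (σV i) = 1
  sign_arrow : ∀ a, εA a * εA (σA a) = εV (t a) * εV (h a)

/-- Non-degenerate bilinear forms on the total space `⨁ i, U i`, which vanish on `U i × U j` for
`j ≠ σ i`, and are `ε i`-symmetric on `U i × U (σ i)`. -/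
structure IsForm (Q : Quiv) {U : Q.V → Type*} [∀ i, AddCommGroup (U i)] [∀ i, Module ℂ (U i)]
    (C : ∀ i j, U i →ₗ[ℂ] U j →ₗ[ℂ] ℂ) : Prop where
  off : ∀ i j, j ≠ Q.σV i → C i j = 0
  symm : ∀ i j (v : U i) (w : U j), C i j v w = ((Q.εV i : ℤ) : ℂ) * C j i w v
  nondeg : ∀ i (v : U i), (∀ w, C i (Q.σV i) v w = 0) → v = 0

/-- The dualmod `(S, M)`, with the decomposition `P` of `M`, corresponds to the supermixed quiver
`Q` with dimension vector `n`: there are a form `C` on the total space `⨁ i, ℂ^{n i}` and an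
isomorphism of `(S, M)` with `(⨁ i, End (ℂ^{n i}), Rep (Q, n))` which takes the involution of `S`
to the adjoint with respect to `C`, and the involution of `M` to the involution of `Rep (Q, n)`
given by `φ ↦ (ε_α φ_α^*)` in the component `σ(α)`.  In particular `D(M)` is taken to the space of
supermixed representations, those with `φ_{σ(α)} = ε_α φ_α^*`.  The summands `P j` are taken to
the summands of `Rep (Q, n)` given by the orbits of `σ` on arrows. -/
structure Corresponds {S : Type*} [Ring S] [Algebra ℂ S] [StarRing S]
    {M : Type*} [AddCommGroup M] [Module ℂ M] [Module S M] [Module Sᵐᵒᵖ M] [StarAddMonoid M]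
    {J : Type*} (P : J → Submodule ℂ M) (Q : Quiv) (n : Q.V → ℕ) where
  C : ∀ i j, (Fin (n i) → ℂ) →ₗ[ℂ] (Fin (n j) → ℂ) →ₗ[ℂ] ℂ
  isForm : IsForm Q C
  eS : S ≃ₐ[ℂ] (∀ i, Module.End ℂ (Fin (n i) → ℂ))
  eM : M ≃ₗ[ℂ] (∀ a, (Fin (n (Q.t a)) → ℂ) →ₗ[ℂ] (Fin (n (Q.h a)) → ℂ))
  left : ∀ (s : S) (m : M) (a : Q.A), eM (s • m) a = eS s (Q.h a) ∘ₗ eM m a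
  right : ∀ (s : S) (m : M) (a : Q.A), eM (MulOpposite.op s • m) a = eM m a ∘ₗ eS s (Q.t a)
  star_alg : ∀ (s : S) (i j : Q.V) v w, C i j (eS s i v) w = C i j v (eS (star s) j w)
  star_mod : ∀ (m : M) (a : Q.A) (v : Fin (n (Q.t a)) → ℂ) (w : Fin (n (Q.t (Q.σA a))) → ℂ),
    C (Q.h a) (Q.t (Q.σA a)) (eM m a v) w =
      ((Q.εA a : ℤ) : ℂ) * C (Q.t a) (Q.h (Q.σA a)) v (eM (star m) (Q.σA a) w)
  lab : Q.A → J
  lab_eq_iff : ∀ a b, lab a = lab b ↔ b = a ∨ b = Q.σA a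
  lab_surj : Function.Surjective lab
  mem_iff : ∀ (m : M) (j : J), m ∈ P j ↔ ∀ a, lab a ≠ j → eM m a = 0

/-- The arrows in the orbit with label `j`. -/
abbrev Over {Q : Quiv} {J : Type*} (lab : Q.A → J) (j : J) : Type := {a : Q.A // lab a = j}

/-- The involution on the arrows in the orbit with label `j`. -/
def Corresponds.flip {S : Type*} [Ring S] [Algebra ℂ S] [StarRing S]
    {M : Type*} [AddCommGroup M] [Module ℂ M] [Module S M] [Module Sᵐᵒᵖ M] [StarAddMonoid M]
    {J : Type*} {P : J → Submodule ℂ M} {Q : Quiv} {n : Q.V → ℕ} (c : Corresponds (S := S) P Q n)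
    {j : J} (a : Over c.lab j) : Over c.lab j :=
  ⟨Q.σA a.1, ((c.lab_eq_iff a.1 (Q.σA a.1)).2 (Or.inr rfl)).symm.trans a.2⟩

/-! ### Holomorphic functions, vector bundles, principal bundles -/

section Bundles

variable (B : Type*) [NormedAddCommGroup B] [NormedSpace ℂ B]
variable {X : Type*} [TopologicalSpace X] [ChartedSpace B X]

/-- `f` is holomorphic near `x`; the target is a finite-dimensional vector space, and no norm on
it has to be chosen. -/
def HolFunAt {W : Type*} [AddCommGroup W] [Module ℂ W] (f : X → W) (x : X) : Prop :=
  ∀ l : W →ₗ[ℂ] ℂ, ContMDiffAt 𝓘(ℂ, B) 𝓘(ℂ, ℂ) ω (fun y => l (f y)) x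

variable (X)

/-- Holomorphic vector bundles on `X` with typical fibre `F`. -/
structure HolVB (F : Type*) [NormedAddCommGroup F] [NormedSpace ℂ F] where
  fib : X → Type w
  [acg : ∀ x, AddCommGroup (fib x)]
  [mod : ∀ x, Module ℂ (fib x)]
  [topFib : ∀ x, TopologicalSpace (fib x)]
  [topTot : TopologicalSpace (Bundle.TotalSpace F fib)]
  [fb : FiberBundle F fib]
  [vb : VectorBundle ℂ F fib]
  [hol : ContMDiffVectorBundle ω F fib 𝓘(ℂ, B)]

attribute [instance] HolVB.acg HolVB.mod HolVB.topFib HolVB.topTot HolVB.fb HolVB.vb HolVB.hol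

variable {B X}

/-- A set-theoretic section of a vector bundle is holomorphic near `x`. -/
def HolVB.HolAt {F : Type*} [NormedAddCommGroup F] [NormedSpace ℂ F] (N : HolVB.{w} B X F)
    (f : ∀ x, N.fib x) (x : X) : Prop :=
  ContMDiffAt 𝓘(ℂ, B) (𝓘(ℂ, B).prod 𝓘(ℂ, F)) ω (fun y => Bundle.TotalSpace.mk' F y (f y)) x

/-- The dual vector bundle. -/
noncomputable def HolVB.dual {F : Type*} [NormedAddCommGroup F] [NormedSpace ℂ F]
    (N : HolVB.{w} B X F) : HolVB.{w} B X (F →L[ℂ] ℂ) where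
  fib x := N.fib x →L[ℂ] Bundle.Trivial X ℂ x

/-- A family of frames `F ≃ N x` is a holomorphic frame near `x`. -/
def HolVB.HolFrameAt {F : Type*} [NormedAddCommGroup F] [NormedSpace ℂ F] (N : HolVB.{w} B X F)
    (q : ∀ x, F ≃ₗ[ℂ] N.fib x) (x : X) : Prop :=
  ∀ v : F, N.HolAt (fun y => q y v) x

variable (B X)

/-- Holomorphic principal bundles on `X` with structure group `R`.  A principal bundle is given by
its fibres, on which `R` acts simply transitively from the right, and by its sheaf of local
holomorphic sections: `HolAt s x` says that the set-theoretic section `s` is holomorphic near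
`x`.  Local holomorphic sections exist, and `s g` is again one if and only if `g` is a
holomorphic map to `R`.  The group `R` is a closed complex subgroup of the units of an algebra
`S`, and `coord` is the inclusion of `R` in `S`. -/
structure PrincipalBundle {R : Type*} [Group R] {S : Type*} [AddCommGroup S] [Module ℂ S]
    (coord : R → S) where
  fib : X → Type w
  act : ∀ {x}, fib x → R → fib x
  act_one : ∀ {x} (p : fib x), act p 1 = p
  act_mul : ∀ {x} (p : fib x) (r r' : R), act p (r * r') = act (act p r) r'
  simply_transitive : ∀ {x} (p p' : fib x), ∃! r, act p r = p'
  HolAt : (∀ x, fib x) → X → Prop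
  exists_holAt : ∀ x, ∃ s, HolAt s x
  eventually_holAt : ∀ s x, HolAt s x → ∀ᶠ y in 𝓝 x, HolAt s y
  holAt_act_iff : ∀ s x, HolAt s x → ∀ g : X → R,
    HolAt (fun y => act (s y) (g y)) x ↔ HolFunAt B (fun y => coord (g y)) x

variable {B X}

/-- Isomorphisms of principal bundles over the identity of `X`; for `E = E'`, these are the gauge
transformations. -/
@[ext]
structure PrincipalIso {R : Type*} [Group R] {S : Type*} [AddCommGroup S] [Module ℂ S]
    {coord : R → S} (E E' : PrincipalBundle.{w} B X coord) where
  toFun : ∀ x, E.fib x → E'.fib x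
  equivariant : ∀ x p r, toFun x (E.act p r) = E'.act (toFun x p) r
  hol : ∀ s x, E.HolAt s x → E'.HolAt (fun y => toFun y (s y)) x

/-! ### Twisted bundles of the generalized quiver -/

section Generalized

variable {S : Type*} [Ring S] [Algebra ℂ S] [StarRing S]
variable {M : Type*} [AddCommGroup M] [Module ℂ M] [Module S M] [Module Sᵐᵒᵖ M] [StarAddMonoid M]
variable [SMulCommClass S ℂ M] [SMulCommClass Sᵐᵒᵖ ℂ M]
variable {hD : IsDualmod S M} {J : Type*} {P : J → Submodule ℂ M} {K : J → Type*}
  {Z : ∀ j, K j → Submodule ℂ M}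
variable {F : J → Type*} [∀ j, NormedAddCommGroup (F j)] [∀ j, NormedSpace ℂ (F j)]

/-- Holomorphic sections of the bundle associated with the fibre product of the principal
`R`-bundle `E` and the frame bundle of the twisting bundles `N j`, and with its representation
`⨁ Z j k ⊗ F j` (the summand `Z j k` is twisted by `N j`): equivariant holomorphic maps to the
representation space. -/
@[ext]
structure TwistedSection (hZ : IsRepDecomposition hD P Z)
    (E : PrincipalBundle.{w} B X (StrGroup.coord S)) (N : ∀ j, HolVB.{v} B X (F j)) where
  toFun : ∀ x, E.fib x → (∀ j, F j ≃ₗ[ℂ] (N j).fib x) → ∀ j (k : K j), Z j k ⊗[ℂ] F j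
  equivariant : ∀ x (p : E.fib x) (q : ∀ j, F j ≃ₗ[ℂ] (N j).fib x) (r : StrGroup S)
    (g : ∀ j, F j ≃ₗ[ℂ] F j) (j : J) (k : K j),
    TensorProduct.map (hZ.act j k r) (g j).toLinearMap
      (toFun x (E.act p r) (fun j => (g j).trans (q j)) j k) = toFun x p q j k
  hol : ∀ (s : ∀ x, E.fib x) (q : ∀ x j, F j ≃ₗ[ℂ] (N j).fib x) (x : X), E.HolAt s x →
    (∀ j, (N j).HolFrameAt (fun y => q y j) x) →
    ∀ j (k : K j), HolFunAt B (fun y => toFun y (s y) (q y) j k) x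

/-- The isomorphism `u` of principal bundles takes the section `s` to `s'`. -/
def PrincipalIso.Carries {hZ : IsRepDecomposition hD P Z}
    {E E' : PrincipalBundle.{w} B X (StrGroup.coord S)} {N : ∀ j, HolVB.{v} B X (F j)}
    (u : PrincipalIso E E') (s : TwistedSection hZ E N) (s' : TwistedSection hZ E' N) : Prop :=
  ∀ x (p : E.fib x) q, s'.toFun x (u.toFun x p) q = s.toFun x p q

/-- Isomorphism classes of twisted bundles of the generalized supermixed quiver. -/
def GenClasses (hZ : IsRepDecomposition hD P Z) (N : ∀ j, HolVB.{v} B X (F j)) : Type _ :=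
  Quot (fun a b : (Σ E : PrincipalBundle.{w} B X (StrGroup.coord S), TwistedSection hZ E N) =>
    ∃ u : PrincipalIso a.1 b.1, u.Carries a.2 b.2)

end Generalized

/-! ### Supermixed twisted bundle representations -/

variable (B X) in
/-- The total space of a supermixed bundle representation: holomorphic vector bundles of rank
`n i`, with a holomorphic form on their direct sum. -/
structure FormBundle (Q : Quiv) (n : Q.V → ℕ) where
  bun : ∀ i, HolVB.{w} B X (Fin (n i) → ℂ)
  form : ∀ x i j, (bun i).fib x →ₗ[ℂ] (bun j).fib x →ₗ[ℂ] ℂ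
  isForm : ∀ x, IsForm Q (U := fun i => (bun i).fib x) (form x)
  hol : ∀ i j (f : ∀ x, (bun i).fib x) (f' : ∀ x, (bun j).fib x) (x : X),
    (bun i).HolAt f x → (bun j).HolAt f' x → HolFunAt B (fun y => form y i j (f y) (f' y)) x

/-- Isometric isomorphisms; for `Y = Y'` these are the gauge transformations. -/
@[ext]
structure FormIso {Q : Quiv} {n : Q.V → ℕ} (Y Y' : FormBundle.{w} B X Q n) where
  toFun : ∀ x i, (Y.bun i).fib x ≃ₗ[ℂ] (Y'.bun i).fib x
  isometric : ∀ x i j v v', Y'.form x i j (toFun x i v) (toFun x j v') = Y.form x i j v v'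
  hol : ∀ i f x, (Y.bun i).HolAt f x → (Y'.bun i).HolAt (fun y => toFun y i (f y)) x

section Rep

variable {S : Type*} [Ring S] [Algebra ℂ S] [StarRing S]
variable {M : Type*} [AddCommGroup M] [Module ℂ M] [Module S M] [Module Sᵐᵒᵖ M] [StarAddMonoid M]
variable {J : Type*} {P : J → Submodule ℂ M} {Q : Quiv} {n : Q.V → ℕ}
variable {G : J → Type*} [∀ j, NormedAddCommGroup (G j)] [∀ j, NormedSpace ℂ (G j)]

/-- Supermixed families of holomorphic morphisms `φ_α : Y_{t(α)} ⊗ T_α → Y_{h(α)}`, where the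
twisting bundle `T_α = T_{σ(α)}` is `T j`, for `j` the label of the orbit of `α`. -/
@[ext]
structure SupermixedMorphisms (c : Corresponds (S := S) P Q n) (Y : FormBundle.{w} B X Q n)
    (T : ∀ j, HolVB.{v} B X (G j)) where
  toFun : ∀ x j (a : Over c.lab j),
    (Y.bun (Q.t a.1)).fib x ⊗[ℂ] (T j).fib x →ₗ[ℂ] (Y.bun (Q.h a.1)).fib x
  hol : ∀ j (a : Over c.lab j) f m x, (Y.bun (Q.t a.1)).HolAt f x → (T j).HolAt m x →
    (Y.bun (Q.h a.1)).HolAt (fun y => toFun y j a (f y ⊗ₜ m y)) x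
  supermixed : ∀ x j (a : Over c.lab j) (y : (Y.bun (Q.t a.1)).fib x)
    (y' : (Y.bun (Q.t (Q.σA a.1))).fib x) (m : (T j).fib x),
    Y.form x (Q.h a.1) (Q.t (Q.σA a.1)) (toFun x j a (y ⊗ₜ m)) y' =
      ((Q.εA a.1 : ℤ) : ℂ) *
        Y.form x (Q.t a.1) (Q.h (Q.σA a.1)) y (toFun x j (c.flip a) (y' ⊗ₜ m))

/-- The isometric isomorphism `f` takes the morphisms `φ` to `φ'`. -/
def FormIso.Carries {c : Corresponds (S := S) P Q n} {Y Y' : FormBundle.{w} B X Q n}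
    {T : ∀ j, HolVB.{v} B X (G j)} (f : FormIso Y Y') (φ : SupermixedMorphisms c Y T)
    (φ' : SupermixedMorphisms c Y' T) : Prop :=
  ∀ x j (a : Over c.lab j) y (m : (T j).fib x),
    φ'.toFun x j a (f.toFun x _ y ⊗ₜ m) = f.toFun x _ (φ.toFun x j a (y ⊗ₜ m))

/-- Isomorphism classes of supermixed twisted bundle representations. -/
def RepClasses (c : Corresponds (S := S) P Q n) (T : ∀ j, HolVB.{v} B X (G j)) : Type _ :=
  Quot (fun a b : (Σ Y : FormBundle.{w} B X Q n, SupermixedMorphisms c Y T) =>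
    ∃ f : FormIso a.1 b.1, f.Carries a.2 b.2)

/-- An identification of the bundle `Y`, with its form, with the bundle associated with the
principal bundle `E` and the representation of `R` on the total space `⨁ i, ℂ^{n i}`: each
`p : E.fib x` gives a frame `v ↦ [p, v]`, with `[p r, v] = [p, r v]`. -/
structure Associated (c : Corresponds (S := S) P Q n)
    (E : PrincipalBundle.{w} B X (StrGroup.coord S)) (Y : FormBundle.{w} B X Q n) where
  frame : ∀ x, E.fib x → ∀ i, (Fin (n i) → ℂ) ≃ₗ[ℂ] (Y.bun i).fib x
  equivariant : ∀ x p r i v, frame x (E.act p r) i v = frame x p i (c.eS r.coord i v)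
  isometric : ∀ x p i j v v', Y.form x i j (frame x p i v) (frame x p j v') = c.C i j v v'
  hol : ∀ s x, E.HolAt s x → ∀ i, (Y.bun i).HolFrameAt (fun y => frame y (s y) i) x

/-- The morphisms `φ` are induced by the section `s` through the finite-dimensional isomorphism
`eM` of `D(M)` with the space of supermixed representations:
`φ_α ([p, v] ⊗ ξ) = [p, ⟨s(p), ξ⟩_α v]`, where `ξ` is a vector of the dual of `N j`, with which
the factor `F j` of `Z j k ⊗ F j` is contracted by way of the frame `q`. -/
def Associated.Induces [SMulCommClass S ℂ M] [SMulCommClass Sᵐᵒᵖ ℂ M] {hD : IsDualmod S M}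
    {K : J → Type*} [∀ j, Fintype (K j)] {Z : ∀ j, K j → Submodule ℂ M}
    {hZ : IsRepDecomposition hD P Z} {N : ∀ j, HolVB.{v} B X (G j)}
    {c : Corresponds (S := S) P Q n} {E : PrincipalBundle.{w} B X (StrGroup.coord S)}
    {Y : FormBundle.{w} B X Q n} (θ : Associated c E Y) (s : TwistedSection hZ E N)
    (φ : SupermixedMorphisms c Y (fun j => (N j).dual)) : Prop :=
  ∀ x (p : E.fib x) (q : ∀ j, G j ≃ₗ[ℂ] (N j).fib x) (j : J) (a : Over c.lab j)
    (v : Fin (n (Q.t a.1)) → ℂ) (ξ : (N j).fib x →L[ℂ] ℂ),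
    φ.toFun x j a (θ.frame x p (Q.t a.1) v ⊗ₜ[ℂ] (show (N j).dual.fib x from ξ)) =
      θ.frame x p (Q.h a.1) (c.eM (∑ k : K j,
        ((TensorProduct.rid ℂ (Z j k)
          (TensorProduct.map LinearMap.id (ξ.toLinearMap ∘ₗ (q j).toLinearMap)
            (s.toFun x p q j k)) : Z j k) : M)) a.1 v)

end Rep

end Bundles

end Supermixed

/-! The finite-dimensional half is the structure theory of an algebra with involution. By
Wedderburn, `S` is a product of algebras `End (V i)`. Pairings `V i × V j → ℂ` for which `*` is the
adjoint are nondegenerate as soon as they are nonzero, because the modules are simple; for each `i`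
there is exactly one `j = σ i` which admits one. Adding the transpose, or leaving the pairing as it
is when this sum vanishes, makes it symmetric up to a sign (`exists_invariant_form`). A simple
sub-bimodule of `M` is a copy of `Hom (V a, V b)`, and `*` takes it to a copy of `Hom (V (σ b), V (σ
a))`. Hence a minimal `*`-stable sub-bimodule is either a single copy with `b = σ a`, on which `*`
is the adjoint up to a sign, or a sum of two copies exchanged by `*`. These are the orbits of arrows
of the quiver (`nonempty_orbitBlock`, `exists_corresponds`).

For the bundles, the point is that `H` is central, so that `R = D(S)` is the full isometry group of
the form on `V` (`Corresponds.exists_of_isometric`). A principal `R`-bundle is therefore the same as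
a bundle with form: in one direction one takes `E ×_R V`, in the other the isometric frames. The
analytic content is that holomorphic isometric frames exist locally (`exists_isometric_frames`). In
any holomorphic frame the form is `C (T v, w)` with `T` holomorphic, selfadjoint and invertible, and
one has to write `T = g^* g` with `g` holomorphic. At one point a square root of `T` exists by
algebra; near that point, after normalization to `T = 1`, it comes from the inverse function
theorem, and uniqueness of the root near `1` makes it selfadjoint.

A value of a section is a family of tensors in `Z j k ⊗ F j`. Contraction turns it into a linear map
from the dual of `F j` to `D(M) ∩ P j`, which `eM` identifies with supermixed families on the orbit
`j`. Equivariance of the section says that the resulting morphisms do not depend on the chosen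
frames, and holomorphy can be tested in local frames; this gives `Associated.sectionEquiv`.
Isomorphisms of principal bundles correspond to isometries because both are determined by their
effect on isometric frames, and they respect the previous bijections (`Associated.carries_iff`). The
statement on isomorphism classes is then formal. -/

namespace Supermixed

/-! ### Invariant pairings of the simple modules of a semisimple algebra with involution -/

section Pairings

/-- An element of a product of endomorphism algebras which takes the nonzero vector `v` of the
`i`-th factor to `v'`, and which vanishes on the other factors. -/
theorem exists_endomorphism_apply_eq {m : ℕ} {v : Fin m → ℂ} (hv : v ≠ 0) {W : Type*}
    [AddCommGroup W] [Module ℂ W] (v' : W) : ∃ T : (Fin m → ℂ) →ₗ[ℂ] W, T v = v' := by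
  obtain ⟨k, hk⟩ := Function.ne_iff.1 hv
  refine ⟨((v k)⁻¹ • LinearMap.proj k : (Fin m → ℂ) →ₗ[ℂ] ℂ).smulRight v', ?_⟩
  have hk' : v k ≠ 0 := hk
  simp [hk']

variable {S : Type*} [Ring S] [Algebra ℂ S] [StarRing S]
variable {I : Type*} {n : I → ℕ} (e : S ≃ₐ[ℂ] (∀ i, Module.End ℂ (Fin (n i) → ℂ)))

/-- The bilinear pairings for which the involution of the algebra is the adjoint. -/
def IsInvariantPairing (i j : I) (b : (Fin (n i) → ℂ) →ₗ[ℂ] (Fin (n j) → ℂ) →ₗ[ℂ] ℂ) : Prop :=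
  ∀ (s : S) v w, b (e s i v) w = b v (e (star s) j w)

variable {e}

theorem IsInvariantPairing.flip {i j : I} {b : (Fin (n i) → ℂ) →ₗ[ℂ] (Fin (n j) → ℂ) →ₗ[ℂ] ℂ}
    (hb : IsInvariantPairing e i j b) : IsInvariantPairing e j i b.flip := fun s v w => by
  have := hb (star s) w v
  rw [star_star] at this
  simpa using this.symm

theorem IsInvariantPairing.add {i j : I} {b b' : (Fin (n i) → ℂ) →ₗ[ℂ] (Fin (n j) → ℂ) →ₗ[ℂ] ℂ}
    (hb : IsInvariantPairing e i j b) (hb' : IsInvariantPairing e i j b') :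
    IsInvariantPairing e i j (b + b') := fun s v w => by
  simp [hb s v w, hb' s v w]

theorem isInvariantPairing_zero (i j : I) : IsInvariantPairing e i j 0 := fun s v w => by simp

variable [DecidableEq I]

/-- The left kernel of an invariant pairing is a submodule of a simple module, hence zero unless the
pairing vanishes. -/
theorem IsInvariantPairing.eq_zero_of_left {i j : I}
    {b : (Fin (n i) → ℂ) →ₗ[ℂ] (Fin (n j) → ℂ) →ₗ[ℂ] ℂ} (hb : IsInvariantPairing e i j b)
    (h0 : b ≠ 0) {v : Fin (n i) → ℂ} (hv : ∀ w, b v w = 0) : v = 0 := by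
  by_contra hne
  refine h0 (LinearMap.ext fun v' => LinearMap.ext fun w => ?_)
  obtain ⟨T, hT⟩ := exists_endomorphism_apply_eq hne v'
  have := hb (e.symm (Pi.single i T)) v w
  rw [AlgEquiv.apply_symm_apply, Pi.single_eq_same, hT, hv] at this
  simpa using this

/-- Let `z` be the central idempotent of the `j`-th factor. Nondegeneracy of `b` forces `star z` to
act as the identity on the `i`-th module. Moving it across `b'` gives back `z`, which acts as zero
on the `j'`-th module if `j' ≠ j`. -/
theorem IsInvariantPairing.index_unique {i j j' : I}
    {b : (Fin (n i) → ℂ) →ₗ[ℂ] (Fin (n j) → ℂ) →ₗ[ℂ] ℂ}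
    {b' : (Fin (n i) → ℂ) →ₗ[ℂ] (Fin (n j') → ℂ) →ₗ[ℂ] ℂ} (hb : IsInvariantPairing e i j b)
    (h0 : b ≠ 0) (hb' : IsInvariantPairing e i j' b') (h0' : b' ≠ 0) : j = j' := by
  by_contra hne
  refine h0' (LinearMap.ext fun v => LinearMap.ext fun w => ?_)
  have h1 : e (star (e.symm (Pi.single j 1))) i v = v := by
    rw [← sub_eq_zero]
    refine hb.eq_zero_of_left h0 fun w => ?_
    rw [map_sub, LinearMap.sub_apply, hb, star_star, AlgEquiv.apply_symm_apply,
      Pi.single_eq_same, Module.End.one_apply, sub_self]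
  have h2 := hb' (star (e.symm (Pi.single j 1))) v w
  rw [h1, star_star, AlgEquiv.apply_symm_apply, Pi.single_eq_of_ne (Ne.symm hne)] at h2
  simpa using h2

/-- The module `V i` embeds in `S` as a minimal left ideal (matrices with one nonzero column). The
involution maps this to a right ideal by `r`, with `r (s v) = r v * star s`. Any nonzero matrix
coefficient `v, w ↦ (r v w)_k` on some factor `j` is then an invariant pairing. -/
theorem exists_isInvariantPairing_ne_zero [∀ i, NeZero (n i)]
    (hs : ∀ (c : ℂ) (a : S), star (c • a) = c • star a) (i : I) :
    ∃ (j : I) (b : (Fin (n i) → ℂ) →ₗ[ℂ] (Fin (n j) → ℂ) →ₗ[ℂ] ℂ),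
      IsInvariantPairing e i j b ∧ b ≠ 0 := by
  let ξ : (Fin (n i) → ℂ) →ₗ[ℂ] ℂ := LinearMap.proj 0
  let v₀ : Fin (n i) → ℂ := Pi.single 0 1
  let r : (Fin (n i) → ℂ) → S := fun v => star (e.symm (Pi.single i (ξ.smulRight v)))
  have hradd : ∀ v v', r (v + v') = r v + r v' := fun v v' => by
    have : ξ.smulRight (v + v') = ξ.smulRight v + ξ.smulRight v' := by ext; simp
    simp only [r, this, Pi.single_add, map_add, star_add]
  have hrsmul : ∀ (c : ℂ) v, r (c • v) = c • r v := fun c v => by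
    have : ξ.smulRight (c • v) = c • ξ.smulRight v := by
      ext; simp [mul_left_comm]
    simp only [r, this, Pi.single_smul, map_smul, hs]
  have hr0 : e (r v₀) ≠ 0 := by
    intro h
    have h1 : r v₀ = 0 := by simpa using h
    have h2 : ξ.smulRight v₀ = 0 := by simpa [r] using h1
    have h3 := congrFun (LinearMap.congr_fun h2 v₀) 0
    simp [ξ, v₀] at h3
  obtain ⟨j, hj⟩ := Function.ne_iff.1 hr0
  have : ∃ w k, e (r v₀) j w k ≠ 0 := by
    by_contra! h
    exact hj (LinearMap.ext fun w => funext fun k => h w k)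
  obtain ⟨w₀, k, hk⟩ := this
  refine ⟨j, LinearMap.mk₂ ℂ (fun v w => e (r v) j w k) ?_ ?_ ?_ ?_, ?_, ?_⟩
  · intro v v' w; simp [hradd]
  · intro c v w; simp [hrsmul]
  · intro v w w'; simp
  · intro c v w; simp
  · intro s v w
    have : r (e s i v) = r v * star s := by
      rw [show r v * star s = star (s * e.symm (Pi.single i (ξ.smulRight v))) by
        simp only [r, star_mul]]
      refine congrArg star (e.injective ?_)
      rw [map_mul, AlgEquiv.apply_symm_apply, AlgEquiv.apply_symm_apply]
      funext l
      by_cases hl : l = i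
      · subst hl
        simp only [Pi.mul_apply, Pi.single_eq_same]
        ext; simp
      · simp [Pi.single_eq_of_ne hl]
    simp [this]
  · intro h
    exact hk (by simpa using LinearMap.congr_fun (LinearMap.congr_fun h v₀) w₀)

/-- The form on the simple modules of a semisimple algebra with involution. -/
theorem exists_invariant_form [∀ i, NeZero (n i)]
    (e : S ≃ₐ[ℂ] (∀ i, Module.End ℂ (Fin (n i) → ℂ)))
    (hs : ∀ (c : ℂ) (a : S), star (c • a) = c • star a) :
    ∃ (σ : I → I) (ε : I → ℤˣ) (C : ∀ i j, (Fin (n i) → ℂ) →ₗ[ℂ] (Fin (n j) → ℂ) →ₗ[ℂ] ℂ),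
      (∀ i, σ (σ i) = i) ∧ (∀ i, ε i * ε (σ i) = 1) ∧ (∀ i j, j ≠ σ i → C i j = 0) ∧
      (∀ i j v w, C i j v w = ((ε i : ℤ) : ℂ) * C j i w v) ∧
      (∀ i v, (∀ w, C i (σ i) v w = 0) → v = 0) ∧ ∀ i j, IsInvariantPairing e i j (C i j) := by
  classical
  choose σ b hb hb0 using exists_isInvariantPairing_ne_zero (e := e) hs
  have hσ : ∀ i, σ (σ i) = i := fun i => by
    refine (hb (σ i)).index_unique (hb0 (σ i)) (hb i).flip fun h => hb0 i ?_
    ext v w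
    simpa using LinearMap.congr_fun (LinearMap.congr_fun h _) _
  let D : ∀ i j, (Fin (n i) → ℂ) →ₗ[ℂ] (Fin (n j) → ℂ) →ₗ[ℂ] ℂ := fun i => Pi.single (σ i) (b i)
  have hDσ : ∀ i, D i (σ i) = b i := fun i => Pi.single_eq_same _ _
  have hDoff : ∀ i j, j ≠ σ i → D i j = 0 := fun i j h => Pi.single_eq_of_ne h _
  have hDinv : ∀ i j, IsInvariantPairing e i j (D i j) := fun i j => by
    by_cases h : j = σ i
    · subst h; rw [hDσ]; exact hb i
    · rw [hDoff i j h]; exact isInvariantPairing_zero i j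
  have hflip : ∀ i j, D i j + (D j i).flip = 0 ↔ D j i + (D i j).flip = 0 := fun i j => by
    constructor <;> intro h <;> ext v w <;>
      simpa [add_comm] using LinearMap.congr_fun (LinearMap.congr_fun h _) _
  -- The pairings chosen for `i` and for `σ i` are unrelated. Their symmetrization is the form
  -- wherever it is nonzero, with sign `1`; where it is zero, `D` itself is antisymmetric, with sign
  -- `-1`. The case distinction is constant on orbits of `σ`. Nondegeneracy only requires that the
  -- result is nonzero.
  let p : I → Prop := fun i => D i (σ i) + (D (σ i) i).flip = 0
  have hp : ∀ i, p (σ i) ↔ p i := fun i => by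
    change D (σ i) (σ (σ i)) + (D (σ (σ i)) (σ i)).flip = 0 ↔ _
    rw [hσ]
    exact hflip _ _
  let C : ∀ i j, (Fin (n i) → ℂ) →ₗ[ℂ] (Fin (n j) → ℂ) →ₗ[ℂ] ℂ := fun i j =>
    if p i then D i j else D i j + (D j i).flip
  have hoff : ∀ i j, j ≠ σ i → C i j = 0 := fun i j h => by
    have h' : i ≠ σ j := fun h' => h (by rw [h', hσ])
    simp only [C, hDoff i j h, hDoff j i h']
    split_ifs <;> ext <;> simp
  have hC0 : ∀ i, C i (σ i) ≠ 0 := fun i => by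
    by_cases h : p i
    · simp only [C, if_pos h, hDσ]; exact hb0 i
    · simp only [C, if_neg h]; exact h
  have hCinv : ∀ i j, IsInvariantPairing e i j (C i j) := fun i j => by
    by_cases h : p i
    · simp only [C, if_pos h]; exact hDinv i j
    · simp only [C, if_neg h]; exact (hDinv i j).add (hDinv j i).flip
  refine ⟨σ, fun i => if p i then -1 else 1, C, hσ, ?_, hoff, ?_, ?_, hCinv⟩
  · intro i
    simp only [hp]
    split_ifs <;> simp
  · intro i j v w
    by_cases hj : j = σ i
    · subst hj
      by_cases h : p i
      · simp only [C, hp, if_pos h]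
        have := LinearMap.congr_fun (LinearMap.congr_fun h v) w
        simp only [LinearMap.add_apply, LinearMap.flip_apply, LinearMap.zero_apply] at this
        simp [eq_neg_of_add_eq_zero_left this]
      · simp only [C, hp, if_neg h]
        simp [add_comm]
    · rw [hoff i j hj, hoff j i fun h' => hj (by rw [h', hσ])]
      simp
  · intro i v hv
    exact (hCinv i (σ i)).eq_zero_of_left (hC0 i) hv

end Pairings

/-! ### Adjoints with respect to perfect pairings -/

section Adjoint

variable {U U' W W' : Type*} [AddCommGroup U] [Module ℂ U] [AddCommGroup U'] [Module ℂ U']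
  [AddCommGroup W] [Module ℂ W] [AddCommGroup W'] [Module ℂ W']

/-- A pairing of finite-dimensional spaces without kernels represents all linear functionals. -/
noncomputable def pairingEquiv [FiniteDimensional ℂ U] [FiniteDimensional ℂ W]
    (b : U →ₗ[ℂ] W →ₗ[ℂ] ℂ) (hl : ∀ u, (∀ w, b u w = 0) → u = 0)
    (hr : ∀ w, (∀ u, b u w = 0) → w = 0) : W ≃ₗ[ℂ] Module.Dual ℂ U :=
  LinearEquiv.ofBijective b.flip <| by
    have h1 : Function.Injective b := (injective_iff_map_eq_zero b).2 fun u hu =>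
      hl u fun w => by rw [hu]; rfl
    have h2 : Function.Injective b.flip := (injective_iff_map_eq_zero b.flip).2 fun w hw =>
      hr w fun u => by simpa using LinearMap.congr_fun hw u
    have hU : Module.finrank ℂ U ≤ Module.finrank ℂ W := by
      simpa [Subspace.dual_finrank_eq] using LinearMap.finrank_le_finrank_of_injective h1
    have hW : Module.finrank ℂ W ≤ Module.finrank ℂ U := by
      simpa [Subspace.dual_finrank_eq] using LinearMap.finrank_le_finrank_of_injective h2
    refine ⟨h2, (LinearMap.injective_iff_surjective_of_finrank_eq_finrank ?_).1 h2⟩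
    rw [Subspace.dual_finrank_eq]
    exact le_antisymm hW hU

theorem pairingEquiv_apply [FiniteDimensional ℂ U] [FiniteDimensional ℂ W]
    (b : U →ₗ[ℂ] W →ₗ[ℂ] ℂ) (hl : ∀ u, (∀ w, b u w = 0) → u = 0)
    (hr : ∀ w, (∀ u, b u w = 0) → w = 0) (w : W) (u : U) : pairingEquiv b hl hr w u = b u w := rfl

/-- The adjoint of a linear map with respect to perfect pairings, as a linear operation. -/
theorem exists_adjoint [FiniteDimensional ℂ U] [FiniteDimensional ℂ W]
    (b : U →ₗ[ℂ] U' →ₗ[ℂ] ℂ) (b' : W →ₗ[ℂ] W' →ₗ[ℂ] ℂ) [FiniteDimensional ℂ U']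
    [FiniteDimensional ℂ W'] (hl : ∀ u, (∀ w, b u w = 0) → u = 0)
    (hr : ∀ w, (∀ u, b u w = 0) → w = 0) :
    ∃ A : (U →ₗ[ℂ] W) →ₗ[ℂ] (W' →ₗ[ℂ] U'), ∀ T u w, b u (A T w) = b' (T u) w := by
  refine ⟨LinearMap.mk₂ ℂ (fun T w => (pairingEquiv b hl hr).symm (b'.flip w ∘ₗ T))
    ?_ ?_ ?_ ?_, ?_⟩
  · intro T T' w
    rw [← map_add]; congr 1; ext; simp
  · intro c T w
    rw [← map_smul]; congr 1; ext; simp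
  · intro T w w'
    rw [← map_add]; congr 1; ext; simp
  · intro c T w
    rw [← map_smul]; congr 1; ext; simp
  · intro T u w
    rw [← pairingEquiv_apply b hl hr]
    simp

end Adjoint

/-! ### Simple sub-bimodules -/

section Arrows

variable {S : Type*} [Ring S] [Algebra ℂ S]
variable {M : Type*} [AddCommGroup M] [Module ℂ M] [Module S M] [Module Sᵐᵒᵖ M]
variable {I : Type*} {n : I → ℕ} (e : S ≃ₐ[ℂ] (∀ i, Module.End ℂ (Fin (n i) → ℂ)))

/-- Homomorphisms to `M` from the simple bimodule of linear maps from the `a`-th to the `b`-th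
simple module. -/
structure IsBimoduleMap (a b : I) (f : ((Fin (n a) → ℂ) →ₗ[ℂ] (Fin (n b) → ℂ)) →ₗ[ℂ] M) :
    Prop where
  left : ∀ (s : S) T, f (e s b ∘ₗ T) = s • f T
  right : ∀ (s : S) T, f (T ∘ₗ e s a) = MulOpposite.op s • f T

variable {e}

theorem IsBimoduleMap.add {a b : I} {f g : ((Fin (n a) → ℂ) →ₗ[ℂ] (Fin (n b) → ℂ)) →ₗ[ℂ] M}
    (hf : IsBimoduleMap e a b f) (hg : IsBimoduleMap e a b g) : IsBimoduleMap e a b (f + g) where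
  left s T := by simp [hf.left, hg.left]
  right s T := by simp [hf.right, hg.right]

variable [DecidableEq I]

/-- The bimodule of linear maps is simple: if `T v ≠ 0`, every `T'` is a sum of maps `A ∘ T ∘ A'`
with `A` and `A'` in the two endomorphism algebras, so that `f T = 0` would give `f = 0`. -/
theorem IsBimoduleMap.eq_zero {a b : I} {f : ((Fin (n a) → ℂ) →ₗ[ℂ] (Fin (n b) → ℂ)) →ₗ[ℂ] M}
    (hf : IsBimoduleMap e a b f) (h0 : f ≠ 0) {T : (Fin (n a) → ℂ) →ₗ[ℂ] (Fin (n b) → ℂ)}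
    (hT : f T = 0) : T = 0 := by
  by_contra hne
  have : ∃ v, T v ≠ 0 := by
    by_contra! h
    exact hne (LinearMap.ext h)
  obtain ⟨v, hv⟩ := this
  refine h0 (LinearMap.ext fun T' => ?_)
  have hA : ∀ k, ∃ A : Module.End ℂ (Fin (n b) → ℂ), A (T v) = T' (Pi.single k 1) := fun k =>
    exists_endomorphism_apply_eq hv _
  choose A hA using hA
  have hT' : T' = ∑ k, A k ∘ₗ T ∘ₗ (LinearMap.proj k : (Fin (n a) → ℂ) →ₗ[ℂ] ℂ).smulRight v := by
    refine LinearMap.pi_ext' fun k => LinearMap.ext_ring ?_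
    simp [hA, Pi.single_apply, apply_ite]
  rw [hT', map_sum, LinearMap.zero_apply]
  refine Finset.sum_eq_zero fun k _ => ?_
  have h1 := hf.left (e.symm (Pi.single b (A k)))
    (T ∘ₗ (LinearMap.proj k : (Fin (n a) → ℂ) →ₗ[ℂ] ℂ).smulRight v)
  have h2 := hf.right (e.symm (Pi.single a
    ((LinearMap.proj k : (Fin (n a) → ℂ) →ₗ[ℂ] ℂ).smulRight v))) T
  rw [AlgEquiv.apply_symm_apply, Pi.single_eq_same] at h1 h2
  rw [h1, h2, hT, smul_zero, smul_zero]

/-- The matrix unit with row `p` and column `q` in the `i`-th simple factor. -/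
noncomputable def matrixUnit (e : S ≃ₐ[ℂ] (∀ i, Module.End ℂ (Fin (n i) → ℂ))) (i : I)
    (v : Fin (n i) → ℂ) (q : Fin (n i)) : S :=
  e.symm (Pi.single i ((LinearMap.proj q : (Fin (n i) → ℂ) →ₗ[ℂ] ℂ).smulRight v))

theorem matrixUnit_add (i : I) (v v' : Fin (n i) → ℂ) (q : Fin (n i)) :
    matrixUnit e i (v + v') q = matrixUnit e i v q + matrixUnit e i v' q := by
  have : (LinearMap.proj q : (Fin (n i) → ℂ) →ₗ[ℂ] ℂ).smulRight (v + v') =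
    (LinearMap.proj q : (Fin (n i) → ℂ) →ₗ[ℂ] ℂ).smulRight v +
      (LinearMap.proj q : (Fin (n i) → ℂ) →ₗ[ℂ] ℂ).smulRight v' := by
    ext; simp
  simp only [matrixUnit, this, Pi.single_add, map_add]

theorem matrixUnit_smul (i : I) (c : ℂ) (v : Fin (n i) → ℂ) (q : Fin (n i)) :
    matrixUnit e i (c • v) q = c • matrixUnit e i v q := by
  have : (LinearMap.proj q : (Fin (n i) → ℂ) →ₗ[ℂ] ℂ).smulRight (c • v) =
    c • (LinearMap.proj q : (Fin (n i) → ℂ) →ₗ[ℂ] ℂ).smulRight v := by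
    ext; simp [mul_left_comm]
  simp only [matrixUnit, this, Pi.single_smul, map_smul]

theorem mul_matrixUnit (i : I) (s : S) (v : Fin (n i) → ℂ) (q : Fin (n i)) :
    s * matrixUnit e i v q = matrixUnit e i (e s i v) q := by
  apply e.injective
  funext j
  rw [map_mul, matrixUnit, matrixUnit, AlgEquiv.apply_symm_apply, AlgEquiv.apply_symm_apply,
    Pi.mul_apply]
  by_cases h : j = i
  · subst h
    rw [Pi.single_eq_same, Pi.single_eq_same]
    ext; simp
  · rw [Pi.single_eq_of_ne h, Pi.single_eq_of_ne h, mul_zero]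

theorem matrixUnit_mul (i : I) (s : S) (v : Fin (n i) → ℂ) (p : Fin (n i)) :
    matrixUnit e i v p * s = ∑ q, e s i (Pi.single q 1) p • matrixUnit e i v q := by
  apply e.injective
  funext j
  rw [map_mul, map_sum, Finset.sum_apply]
  simp only [matrixUnit, AlgEquiv.apply_symm_apply, map_smul, Pi.mul_apply, Pi.smul_apply]
  by_cases h : j = i
  · subst h
    simp only [Pi.single_eq_same]
    refine LinearMap.pi_ext' fun k => LinearMap.ext_ring ?_
    simp [Pi.single_apply, ite_smul]
  · simp [Pi.single_eq_of_ne h]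

theorem sum_matrixUnit [Fintype I] :
    ∑ i, ∑ q, matrixUnit e i (Pi.single q 1) q = 1 := by
  apply e.injective
  rw [map_sum, map_one]
  have : ∀ i, e (∑ q, matrixUnit e i (Pi.single q 1) q) = Pi.single i 1 := fun i => by
    rw [map_sum]
    simp only [matrixUnit, AlgEquiv.apply_symm_apply]
    funext j
    rw [Finset.sum_apply]
    by_cases h : j = i
    · subst h
      simp only [Pi.single_eq_same]
      refine LinearMap.pi_ext' fun k => LinearMap.ext_ring ?_
      simp [Pi.single_apply, ite_smul]
    · simp [Pi.single_eq_of_ne h]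
  simp only [this]
  exact Finset.univ_sum_single (1 : ∀ i, Module.End ℂ (Fin (n i) → ℂ))

variable [Fintype I] [SMulCommClass S Sᵐᵒᵖ M] [IsScalarTower ℂ S M] [IsScalarTower ℂ Sᵐᵒᵖ M]
  [SMulCommClass S ℂ M]

/-- A nonzero sub-bimodule contains a simple one. -/
theorem exists_isBimoduleMap_ne_zero (e : S ≃ₐ[ℂ] (∀ i, Module.End ℂ (Fin (n i) → ℂ)))
    (N : Submodule ℂ M) (hl : ∀ (a : S), ∀ m ∈ N, a • m ∈ N)
    (hr : ∀ (b : S), ∀ m ∈ N, MulOpposite.op b • m ∈ N) (h0 : N ≠ ⊥) :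
    ∃ a b, ∃ f : ((Fin (n a) → ℂ) →ₗ[ℂ] (Fin (n b) → ℂ)) →ₗ[ℂ] M,
      IsBimoduleMap e a b f ∧ f ≠ 0 ∧ ∀ T, f T ∈ N := by
  obtain ⟨m, hmN, hm⟩ := N.ne_bot_iff.1 h0
  -- The diagonal matrix units sum to `1`, so that some corner `e_rr m e_ss` of `m` is nonzero.
  have : ∃ b r a s, matrixUnit e b (Pi.single r 1) r •
      (MulOpposite.op (matrixUnit e a (Pi.single s 1) s) • m) ≠ 0 := by
    by_contra! h
    refine hm ?_
    calc m = (∑ i, ∑ q, matrixUnit e i (Pi.single q 1) q) •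
          (MulOpposite.op (∑ i, ∑ q, matrixUnit e i (Pi.single q 1) q) • m) := by
            rw [sum_matrixUnit, MulOpposite.op_one, one_smul, one_smul]
      _ = 0 := by
        simp only [Finset.sum_smul, Finset.smul_sum, Finset.op_sum, h, Finset.sum_const_zero]
  obtain ⟨b, r, a, s, hne⟩ := this
  -- The corner generates a copy of `Hom (V a, V b)`: in terms of columns and rows, `f T = ∑ q, (T
  -- e_q) e_rᵗ m e_s e_qᵗ`.
  let f : ((Fin (n a) → ℂ) →ₗ[ℂ] (Fin (n b) → ℂ)) →ₗ[ℂ] M :=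
    { toFun := fun T => ∑ q, matrixUnit e b (T (Pi.single q 1)) r •
        (MulOpposite.op (matrixUnit e a (Pi.single s 1) q) • m)
      map_add' := fun T T' => by
        simp only [LinearMap.add_apply, matrixUnit_add, add_smul, Finset.sum_add_distrib]
      map_smul' := fun c T => by
        simp only [LinearMap.smul_apply, matrixUnit_smul, smul_assoc, Finset.smul_sum,
          RingHom.id_apply] }
  have hf : ∀ T, f T = ∑ q, matrixUnit e b (T (Pi.single q 1)) r •
        (MulOpposite.op (matrixUnit e a (Pi.single s 1) q) • m) := fun T => rfl
  refine ⟨a, b, f, ⟨?_, ?_⟩, ?_, ?_⟩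
  · intro x T
    simp only [hf, Finset.smul_sum, LinearMap.comp_apply, ← mul_matrixUnit, mul_smul]
  · intro x T
    simp only [hf, Finset.smul_sum, LinearMap.comp_apply]
    have h1 : ∀ p, MulOpposite.op x • matrixUnit e b (T (Pi.single p 1)) r •
        MulOpposite.op (matrixUnit e a (Pi.single s 1) p) • m =
        ∑ q, e x a (Pi.single q 1) p • matrixUnit e b (T (Pi.single p 1)) r •
          MulOpposite.op (matrixUnit e a (Pi.single s 1) q) • m := fun p => by
      rw [← smul_comm _ (MulOpposite.op x), ← mul_smul (MulOpposite.op x), ← MulOpposite.op_mul,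
        matrixUnit_mul, Finset.op_sum, Finset.sum_smul, Finset.smul_sum]
      refine Finset.sum_congr rfl fun q _ => ?_
      rw [MulOpposite.op_smul, smul_assoc, smul_comm (matrixUnit e b _ r) (_ : ℂ)]
    simp only [h1]
    rw [Finset.sum_comm]
    refine Finset.sum_congr rfl fun q _ => ?_
    have h2 : T (e x a (Pi.single q 1)) =
        ∑ p, e x a (Pi.single q 1) p • T (Pi.single p 1) := by
      conv_lhs => rw [← Finset.univ_sum_single (e x a (Pi.single q 1)), map_sum]
      refine Finset.sum_congr rfl fun p _ => ?_
      rw [← map_smul]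
      congr 1
      ext; simp [Pi.single_apply]
    have h3 : ∀ (g : Fin (n a) → Fin (n b) → ℂ), matrixUnit e b (∑ p, g p) r =
        ∑ p, matrixUnit e b (g p) r := fun g =>
      map_sum (AddMonoidHom.mk' (fun v => matrixUnit e b v r) fun v v' =>
        matrixUnit_add b v v' r) g _
    simp only [h2, h3, matrixUnit_smul, Finset.sum_smul, smul_assoc]
  · intro h
    apply hne
    -- For the map `e_s ↦ e_r` only `q = s` contributes, and the value of `f` is the nonzero corner.
    have := hf ((LinearMap.proj s : (Fin (n a) → ℂ) →ₗ[ℂ] ℂ).smulRight (Pi.single r 1))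
    rw [h, LinearMap.zero_apply, Finset.sum_eq_single s] at this
    · simpa using this.symm
    · intro q _ hq
      have h0 : matrixUnit e b 0 r = 0 := by simpa using matrixUnit_smul (e := e) b 0 0 r
      simp [hq.symm, h0]
    · simp
  · intro T
    rw [hf]
    exact N.sum_mem fun q _ => hl _ _ (hr _ _ hmN)

end Arrows

/-! ### Minimal bimodules with involution -/

theorem intUnits_cast_mul_self (x : ℤˣ) : ((x : ℤ) : ℂ) * ((x : ℤ) : ℂ) = 1 := by
  rcases Int.units_eq_one_or x with rfl | rfl <;> simp

theorem eq_of_intUnits_mul_eq_one {x y : ℤˣ} (h : x * y = 1) : y = x := by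
  rw [← one_mul y, ← Int.units_mul_self x, mul_assoc, h, mul_one]

section Blocks

variable {S : Type*} [Ring S] [Algebra ℂ S] [StarRing S]
variable {M : Type*} [AddCommGroup M] [Module ℂ M] [Module S M] [Module Sᵐᵒᵖ M] [StarAddMonoid M]
variable {I : Type*} {n : I → ℕ}

/-- A form on the simple modules of `S` for which the involution of `S` is the adjoint. -/
structure InvariantForm (e : S ≃ₐ[ℂ] (∀ i, Module.End ℂ (Fin (n i) → ℂ))) where
  σ : I → I
  ε : I → ℤˣ
  C : ∀ i j, (Fin (n i) → ℂ) →ₗ[ℂ] (Fin (n j) → ℂ) →ₗ[ℂ] ℂ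
  σ_σ : ∀ i, σ (σ i) = i
  sign : ∀ i, ε i * ε (σ i) = 1
  off : ∀ i j, j ≠ σ i → C i j = 0
  symm : ∀ i j v w, C i j v w = ((ε i : ℤ) : ℂ) * C j i w v
  nondeg : ∀ i v, (∀ w, C i (σ i) v w = 0) → v = 0
  inv : ∀ i j, IsInvariantPairing e i j (C i j)

variable {e : S ≃ₐ[ℂ] (∀ i, Module.End ℂ (Fin (n i) → ℂ))} (Φ : InvariantForm e)

namespace InvariantForm

theorem nondeg_left {a a' : I} (h : a' = Φ.σ a) {v : Fin (n a) → ℂ}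
    (hv : ∀ w, Φ.C a a' v w = 0) : v = 0 := by
  subst h; exact Φ.nondeg a v hv

theorem nondeg_right {a a' : I} (h : a' = Φ.σ a) {w : Fin (n a') → ℂ}
    (hw : ∀ v, Φ.C a a' v w = 0) : w = 0 := by
  refine Φ.nondeg_left (a' := a) (by rw [h, Φ.σ_σ]) fun v => ?_
  rw [Φ.symm, hw, mul_zero]

/-- `T` and `c T'` are adjoint to each other with respect to the form. -/
def IsAdjoint {a b a' b' : I} (c : ℂ) (T : (Fin (n a) → ℂ) →ₗ[ℂ] (Fin (n b) → ℂ))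
    (T' : (Fin (n b') → ℂ) →ₗ[ℂ] (Fin (n a') → ℂ)) : Prop :=
  ∀ v w, Φ.C b b' (T v) w = c * Φ.C a a' v (T' w)

theorem exists_isAdjoint {a b a' b' : I} (ha : a' = Φ.σ a) (c : ℂ) (hc : c ≠ 0)
    (T : (Fin (n a) → ℂ) →ₗ[ℂ] (Fin (n b) → ℂ)) :
    ∃ T' : (Fin (n b') → ℂ) →ₗ[ℂ] (Fin (n a') → ℂ), Φ.IsAdjoint c T T' := by
  obtain ⟨A, hA⟩ := exists_adjoint (Φ.C a a') (Φ.C b b') (fun _ h => Φ.nondeg_left ha h)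
    (fun _ h => Φ.nondeg_right ha h)
  refine ⟨c⁻¹ • A T, fun v w => ?_⟩
  simp [hA, hc]

/-- Exchanging the arguments of the two pairings contributes `ε a` and `ε b`, and solving for the
other side inverts the constant. This is the origin of the sign rule for arrows. The coefficients of
the linear combination only express that signs have square `1`. -/
theorem IsAdjoint.swap {Φ : InvariantForm e} {a b a' b' : I}
    {T : (Fin (n a) → ℂ) →ₗ[ℂ] (Fin (n b) → ℂ)} {T' : (Fin (n b') → ℂ) →ₗ[ℂ] (Fin (n a') → ℂ)}
    (c c' : ℤˣ) (hc : c * c' = Φ.ε a * Φ.ε b) (h : Φ.IsAdjoint ((c : ℤ) : ℂ) T T') :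
    Φ.IsAdjoint ((c' : ℤ) : ℂ) T' T := fun v w => by
  have h1 := h w v
  rw [Φ.symm b, Φ.symm a a'] at h1
  have hc' : ((Φ.ε a : ℤ) : ℂ) = ((c : ℤ) : ℂ) * ((c' : ℤ) : ℂ) * ((Φ.ε b : ℤ) : ℂ) := by
    have : Φ.ε a = c * c' * Φ.ε b := by rw [hc, mul_assoc, Int.units_mul_self, mul_one]
    rw [this]; push_cast; ring
  rw [hc'] at h1
  linear_combination (-(((c' : ℤ) : ℂ) * ((Φ.ε b : ℤ) : ℂ))) * h1 +
    (((c' : ℤ) : ℂ) * Φ.C b' b v (T w) - Φ.C a' a (T' v) w * ((c' : ℤ) : ℂ) * ((c' : ℤ) : ℂ)) *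
      intUnits_cast_mul_self (Φ.ε b) - Φ.C a' a (T' v) w * (intUnits_cast_mul_self c' +
      ((c' : ℤ) : ℂ) * ((c' : ℤ) : ℂ) * ((Φ.ε b : ℤ) : ℂ) * ((Φ.ε b : ℤ) : ℂ) *
        intUnits_cast_mul_self c)

variable {Φ} in
/-- The composite of a bimodule map with the adjoint and with the involution. -/
theorem exists_star_twist (hD : IsDualmod S M) {a b a' b' : I} (hb : b' = Φ.σ b)
    {f : ((Fin (n a) → ℂ) →ₗ[ℂ] (Fin (n b) → ℂ)) →ₗ[ℂ] M} (hf : IsBimoduleMap e a b f) :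
    ∃ g : ((Fin (n b') → ℂ) →ₗ[ℂ] (Fin (n a') → ℂ)) →ₗ[ℂ] M, IsBimoduleMap e b' a' g ∧
      ∀ T T', Φ.IsAdjoint 1 T T' → g T' = star (f T) := by
  -- The flipped pairings give the adjoint in the direction `T' ↦ T`, so that `star ∘ f ∘ A` is
  -- linear in `T'`.
  obtain ⟨A, hA⟩ := exists_adjoint (Φ.C b b').flip (Φ.C a a').flip
    (fun w h => Φ.nondeg_right hb h) (fun v h => Φ.nondeg_left hb h)
  have hAadj : ∀ T', Φ.IsAdjoint 1 (A T') T' := fun T' v w => by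
    rw [one_mul]; exact hA T' w v
  have huniq : ∀ T T', Φ.IsAdjoint 1 T T' → A T' = T := fun T T' h => by
    refine LinearMap.ext fun v => ?_
    rw [← sub_eq_zero]
    refine Φ.nondeg_left hb fun w => ?_
    rw [map_sub, LinearMap.sub_apply, hAadj, h, sub_self]
  let st : M →ₗ[ℂ] M :=
    { toFun := star, map_add' := star_add, map_smul' := hD.star_smul_mod }
  have hst : ∀ m, st m = star m := fun _ => rfl
  refine ⟨st ∘ₗ f ∘ₗ A, ⟨fun s T => ?_, fun s T => ?_⟩, fun T T' h => ?_⟩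
  -- The adjoint and the involution of `M` both exchange left and right multiplication; the two
  -- exchanges cancel.
  · have h1 : A (e s a' ∘ₗ T) = A T ∘ₗ e (star s) a := huniq _ _ fun v w => by
      have h2 := Φ.inv a a' (star s) v (T w)
      rw [star_star] at h2
      rw [LinearMap.comp_apply, hAadj, LinearMap.comp_apply, h2]
    have h3 := hD.star_bimod 1 (star s) (f (A T))
    simp only [one_smul, star_one, star_star, MulOpposite.op_one] at h3
    simp only [LinearMap.comp_apply, h1, hf.right, hst, h3]
  · have h1 : A (T ∘ₗ e s b') = e (star s) b ∘ₗ A T := huniq _ _ fun v w => by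
      have h2 := Φ.inv b b' (star s) (A T v) w
      rw [star_star] at h2
      rw [LinearMap.comp_apply, h2, hAadj, LinearMap.comp_apply]
    have h3 := hD.star_bimod (star s) 1 (f (A T))
    simp only [one_smul, star_one, star_star, MulOpposite.op_one] at h3
    simp only [LinearMap.comp_apply, h1, hf.left, hst, h3]
  · simp only [LinearMap.comp_apply, huniq T T' h, hst]

end InvariantForm

/-- A description of a bimodule with involution `N` as the space of representations on an orbit of
arrows. -/
structure OrbitBlock (Φ : InvariantForm e) (N : Submodule ℂ M) where
  A : Type
  [fin : Fintype A]
  [dec : DecidableEq A]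
  ne : Nonempty A
  t : A → I
  h : A → I
  σ : A → A
  sg : A → ℤˣ
  σ_σ : ∀ a, σ (σ a) = a
  σ_t : ∀ a, Φ.σ (t a) = h (σ a)
  σ_h : ∀ a, Φ.σ (h a) = t (σ a)
  fixed : ∀ a, t a = Φ.σ (h a) → σ a = a
  sign : ∀ a, sg a * sg (σ a) = Φ.ε (t a) * Φ.ε (h a)
  orbit : ∀ a b, b = a ∨ b = σ a
  f : ∀ a, ((Fin (n (t a)) → ℂ) →ₗ[ℂ] (Fin (n (h a)) → ℂ)) →ₗ[ℂ] M
  bimod : ∀ a, IsBimoduleMap e (t a) (h a) (f a)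
  star_f : ∀ a T T', Φ.IsAdjoint (a' := h (σ a)) (b' := t (σ a)) ((sg a : ℤ) : ℂ) T T' →
    star (f a T) = f (σ a) T'
  inj : ∀ φ : (∀ a, (Fin (n (t a)) → ℂ) →ₗ[ℂ] (Fin (n (h a)) → ℂ)),
    ∑ a, f a (φ a) = 0 → ∀ a, φ a = 0
  mem : ∀ a T, f a T ∈ N
  surj : ∀ m ∈ N, ∃ φ : (∀ a, (Fin (n (t a)) → ℂ) →ₗ[ℂ] (Fin (n (h a)) → ℂ)),
    m = ∑ a, f a (φ a)

attribute [instance] OrbitBlock.fin OrbitBlock.dec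

variable [DecidableEq I]

variable {Φ} in
-- A copy of `Hom (V a, V (σ a))` on which `*` is plus or minus the adjoint is `*`-stable, hence
-- equal to `N` by minimality. It is a single arrow fixed by the involution.
theorem nonempty_orbitBlock_of_fixed {N : Submodule ℂ M}
    (hmin : ∀ N' : Submodule ℂ M, IsStarSubbimodule (S := S) N' → N' ≤ N → N' = ⊥ ∨ N' = N)
    {a b : I} (hb : b = Φ.σ a) {f : ((Fin (n a) → ℂ) →ₗ[ℂ] (Fin (n b) → ℂ)) →ₗ[ℂ] M}
    (hf : IsBimoduleMap e a b f) (h0 : f ≠ 0) (hfN : ∀ T, f T ∈ N) (c : ℤˣ)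
    (hc : ∀ T T', Φ.IsAdjoint (a' := b) (b' := a) 1 T T' → star (f T) = ((c : ℤ) : ℂ) • f T') :
    Nonempty (OrbitBlock Φ N) := by
  have ha : Φ.σ b = a := by rw [hb, Φ.σ_σ]
  have hstar : ∀ T T', Φ.IsAdjoint (a' := b) (b' := a) ((c : ℤ) : ℂ) T T' → star (f T) = f T' := by
    intro T T' h
    rw [hc T (((c : ℤ) : ℂ) • T'), map_smul, smul_smul, intUnits_cast_mul_self, one_smul]
    intro v w
    rw [h, one_mul, LinearMap.smul_apply, map_smul, smul_eq_mul]
  have hrange : LinearMap.range f = N := by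
    refine (hmin _ ⟨?_, ?_, ?_⟩ ?_).resolve_left ?_
    · rintro s _ ⟨T, rfl⟩; exact ⟨_, hf.left s T⟩
    · rintro s _ ⟨T, rfl⟩; exact ⟨_, hf.right s T⟩
    · rintro _ ⟨T, rfl⟩
      obtain ⟨T', hT'⟩ := Φ.exists_isAdjoint (b' := a) hb ((c : ℤ) : ℂ)
        (left_ne_zero_of_mul_eq_one (intUnits_cast_mul_self c)) T
      exact ⟨T', (hstar _ _ hT').symm⟩
    · rintro _ ⟨T, rfl⟩; exact hfN T
    · exact fun h => h0 (LinearMap.range_eq_bot.1 h)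
  exact ⟨{
    A := Unit
    ne := ⟨()⟩
    t := fun _ => a
    h := fun _ => b
    σ := id
    sg := fun _ => c
    σ_σ := fun _ => rfl
    σ_t := fun _ => hb.symm
    σ_h := fun _ => ha
    fixed := fun _ _ => rfl
    sign := fun _ => by rw [hb, Φ.sign, Int.units_mul_self]
    orbit := fun _ _ => Or.inl rfl
    f := fun _ => f
    bimod := fun _ => hf
    star_f := fun _ => hstar
    inj := fun φ h _ => hf.eq_zero h0 (by simpa using h)
    mem := fun _ => hfN
    surj := fun m hm => by
      rw [← hrange] at hm
      obtain ⟨T, rfl⟩ := hm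
      exact ⟨fun _ => T, by simp⟩ }⟩

variable {Φ} in
-- If `b ≠ σ a`, the image of `f` under `*` is a copy of another simple bimodule, given by `g`. The
-- sum of both ranges is `*`-stable, hence all of `N`, and its two summands are the two arrows of an
-- orbit.
theorem nonempty_orbitBlock_of_pair (hD : IsDualmod S M) {N : Submodule ℂ M}
    (hN : IsStarSubbimodule (S := S) N)
    (hmin : ∀ N' : Submodule ℂ M, IsStarSubbimodule (S := S) N' → N' ≤ N → N' = ⊥ ∨ N' = N)
    {a b : I} (hb : b ≠ Φ.σ a) {f : ((Fin (n a) → ℂ) →ₗ[ℂ] (Fin (n b) → ℂ)) →ₗ[ℂ] M}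
    (hf : IsBimoduleMap e a b f) (h0 : f ≠ 0) (hfN : ∀ T, f T ∈ N) :
    Nonempty (OrbitBlock Φ N) := by
  obtain ⟨g, hg, hgf⟩ := InvariantForm.exists_star_twist (Φ := Φ) (a' := Φ.σ a) hD rfl hf
  have hgex : ∀ T', ∃ T, Φ.IsAdjoint 1 T T' := fun T' => by
    obtain ⟨T, hT⟩ := Φ.exists_isAdjoint (a := Φ.σ b) (b := Φ.σ a) (a' := b) (b' := a)
      (Φ.σ_σ b).symm (((Φ.ε (Φ.σ b) * Φ.ε (Φ.σ a) : ℤˣ) : ℤ) : ℂ)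
      (left_ne_zero_of_mul_eq_one (intUnits_cast_mul_self _)) T'
    refine ⟨T, ?_⟩
    simpa using hT.swap _ 1 (by simp)
  have hfex : ∀ T, ∃ T', Φ.IsAdjoint (a := a) (b := b) (a' := Φ.σ a) (b' := Φ.σ b) 1 T T' :=
      fun T =>
    Φ.exists_isAdjoint rfl 1 one_ne_zero T
  have hgN : ∀ T, g T ∈ N := fun T' => by
    obtain ⟨T, hT⟩ := hgex T'
    rw [hgf T T' hT]
    exact hN.star_mem _ (hfN _)
  have hg0 : g ≠ 0 := by
    rintro rfl
    refine h0 (LinearMap.ext fun T => ?_)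
    obtain ⟨T', hT'⟩ := hfex T
    have := hgf T T' hT'
    rw [LinearMap.zero_apply] at this ⊢
    rwa [eq_comm, star_eq_zero] at this
  have hrange : LinearMap.range (f.coprod g) = N := by
    refine (hmin _ ⟨?_, ?_, ?_⟩ ?_).resolve_left ?_
    · rintro s _ ⟨T, rfl⟩
      exact ⟨(e s b ∘ₗ T.1, e s (Φ.σ a) ∘ₗ T.2), by simp [hf.left, hg.left]⟩
    · rintro s _ ⟨T, rfl⟩
      exact ⟨(T.1 ∘ₗ e s a, T.2 ∘ₗ e s (Φ.σ b)), by simp [hf.right, hg.right]⟩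
    · rintro _ ⟨T, rfl⟩
      obtain ⟨T₁, h₁⟩ := hfex T.1
      obtain ⟨T₂, h₂⟩ := hgex T.2
      refine ⟨(T₂, T₁), ?_⟩
      simp [hgf _ _ h₁, hgf _ _ h₂, add_comm]
    · rintro _ ⟨T, rfl⟩; simpa using N.add_mem (hfN T.1) (hgN T.2)
    · intro h
      refine h0 (LinearMap.ext fun T => ?_)
      have : f.coprod g (T, 0) ∈ (⊥ : Submodule ℂ M) := h ▸ ⟨(T, 0), rfl⟩
      simpa using this
  have hsep : ∀ T T', f T + g T' = 0 → T = 0 ∧ T' = 0 := by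
    intro T T' h
    -- The central idempotent of the factor `b` fixes `f T` and kills `g T'`, whose target is `σ a ≠
    -- b`.
    have h1 : T = 0 := by
      refine hf.eq_zero h0 ?_
      have h2 := congrArg (e.symm (Pi.single b 1) • ·) h
      simp only [smul_add, ← hf.left, ← hg.left, AlgEquiv.apply_symm_apply,
        Pi.single_eq_same, Pi.single_eq_of_ne (Ne.symm hb), smul_zero] at h2
      simpa [Module.End.one_eq_id] using h2
    refine ⟨h1, hg.eq_zero hg0 ?_⟩
    simpa [h1] using h
  have hε : ∀ i, Φ.ε (Φ.σ i) = Φ.ε i := fun i => eq_of_intUnits_mul_eq_one (Φ.sign i)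
  exact ⟨{
    A := Bool
    ne := ⟨false⟩
    t := fun | false => a | true => Φ.σ b
    h := fun | false => b | true => Φ.σ a
    σ := not
    -- Since `g` is defined through the adjoint with constant `1`, the first sign is `1`; the sign
    -- rule determines the second.
    sg := fun | false => 1 | true => Φ.ε a * Φ.ε b
    σ_σ := fun x => by simp
    σ_t := fun | false => rfl | true => Φ.σ_σ b
    σ_h := fun | false => rfl | true => Φ.σ_σ a
    fixed := fun
      | false => fun h => absurd (by rw [show a = Φ.σ b from h, Φ.σ_σ]) hb
      | true => fun h => absurd (by
          rw [← Φ.σ_σ b, show Φ.σ b = Φ.σ (Φ.σ a) from h, Φ.σ_σ]) hb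
    sign := fun
      | false => by simp
      | true => by simp [hε, mul_comm]
    orbit := fun x y => by cases x <;> cases y <;> simp
    f := fun | false => f | true => g
    bimod := fun | false => hf | true => hg
    star_f := fun
      | false => fun T T' h => (hgf T T' (by simpa using h)).symm
      | true => fun T T' h => by
        have h' : Φ.IsAdjoint (a := Φ.σ b) (b := Φ.σ a) (a' := b) (b' := a)
          (((Φ.ε a * Φ.ε b : ℤˣ) : ℤ) : ℂ) T T' := h
        have := hgf T' T (by
          simpa using h'.swap _ 1 (by simp [hε, mul_comm]))
        change star (g T) = f T'
        rw [this, star_star]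
    inj := fun φ h => by
      have h' : f (φ false) + g (φ true) = 0 := by
        rw [Fintype.sum_bool, add_comm] at h
        exact h
      rintro (_ | _)
      exacts [(hsep _ _ h').1, (hsep _ _ h').2]
    mem := fun | false => hfN | true => hgN
    surj := fun m hm => by
      rw [← hrange] at hm
      obtain ⟨T, rfl⟩ := hm
      refine ⟨fun | false => T.1 | true => T.2, ?_⟩
      rw [Fintype.sum_bool, add_comm]
      rfl }⟩

variable [Fintype I] [SMulCommClass S Sᵐᵒᵖ M] [IsScalarTower ℂ S M] [IsScalarTower ℂ Sᵐᵒᵖ M]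
  [SMulCommClass S ℂ M]

/-- A minimal nonzero sub-bimodule stable under the involution belongs to an orbit of arrows. -/
theorem nonempty_orbitBlock (hD : IsDualmod S M) {N : Submodule ℂ M}
    (hN : IsStarSubbimodule (S := S) N) (hne : N ≠ ⊥)
    (hmin : ∀ N' : Submodule ℂ M, IsStarSubbimodule (S := S) N' → N' ≤ N → N' = ⊥ ∨ N' = N) :
    Nonempty (OrbitBlock Φ N) := by
  obtain ⟨a, b, f, hf, h0, hfN⟩ := exists_isBimoduleMap_ne_zero e N hN.left hN.right hne
  by_cases hb : b = Φ.σ a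
  · have ha : a = Φ.σ b := by rw [hb, Φ.σ_σ]
    obtain ⟨g, hg, hgf⟩ := InvariantForm.exists_star_twist (Φ := Φ) (a' := b) hD ha hf
    have hsymm : ∀ {T T'}, Φ.IsAdjoint (a := a) (b := b) (a' := b) (b' := a) 1 T T' →
        Φ.IsAdjoint (a := a) (b := b) (a' := b) (b' := a) 1 T' T := fun {T T'} h => by
      simpa using InvariantForm.IsAdjoint.swap 1 1 (by rw [hb, Φ.sign, mul_one]) (by simpa using h)
    have hgN : ∀ T, g T ∈ N := fun T' => by
      obtain ⟨T, hT⟩ := Φ.exists_isAdjoint (b := b) (b' := a) hb 1 one_ne_zero T'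
      rw [hgf T T' (hsymm hT)]
      exact hN.star_mem _ (hfN _)
    -- Here `T ↦ T'` is an involution and `g` is the conjugate of `f` under it and `*`. Thus `f + g`
    -- commutes with the two involutions; if it vanishes, `f` anticommutes with them. This is the
    -- same dichotomy as for the form.
    by_cases hfg : f + g = 0
    · refine nonempty_orbitBlock_of_fixed hmin hb hf h0 hfN (-1) fun T T' h => ?_
      rw [← hgf T T' h, eq_neg_of_add_eq_zero_right (LinearMap.congr_fun hfg T')]
      simp
    · refine nonempty_orbitBlock_of_fixed hmin hb (hf.add hg) hfg
        (fun T => N.add_mem (hfN T) (hgN T)) 1 fun T T' h => ?_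
      rw [LinearMap.add_apply, star_add, ← hgf T T' h, hgf T' T (hsymm h), star_star]
      simp [add_comm]
  · exact nonempty_orbitBlock_of_pair hD hN hmin hb hf h0 hfN

end Blocks

/-! ### The supermixed quiver of a semisimple algebra and a bimodule with involutions -/

section Existence

variable {S : Type*} [Ring S] [Algebra ℂ S] [StarRing S]
variable {M : Type*} [AddCommGroup M] [Module ℂ M] [Module S M] [Module Sᵐᵒᵖ M] [StarAddMonoid M]
variable {I : Type} {n : I → ℕ}
  {e : S ≃ₐ[ℂ] (∀ i, Module.End ℂ (Fin (n i) → ℂ))} {Φ : InvariantForm e}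
variable {J : Type*} {P : J → Submodule ℂ M} {L : Type}

variable [Finite I] [Finite L] in
/-- The quiver with the arrows of all orbits. -/
def InvariantForm.quiv (Φ : InvariantForm e) (l : L ≃ J) (D : ∀ j, OrbitBlock Φ (P j)) : Quiv where
  V := I
  A := Σ i : L, (D (l i)).A
  t a := (D _).t a.2
  h a := (D _).h a.2
  σV := Φ.σ
  σA a := ⟨a.1, (D _).σ a.2⟩
  σV_σV := Φ.σ_σ
  σA_σA a := by simp only [(D _).σ_σ]
  σ_t a := (D _).σ_t a.2
  σ_h a := (D _).σ_h a.2
  fixed a h := by rw [(D _).fixed a.2 h]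
  εV := Φ.ε
  εA a := (D _).sg a.2
  sign_vertex := Φ.sign
  sign_arrow a := (D _).sign a.2

/-- The sum of the bimodule maps of all arrows. -/
noncomputable def sumOfArrows [Fintype L] (l : L ≃ J) (D : ∀ j, OrbitBlock Φ (P j)) :
    (∀ a : Σ i : L, (D (l i)).A, (Fin (n ((D (l a.1)).t a.2)) → ℂ) →ₗ[ℂ]
      (Fin (n ((D (l a.1)).h a.2)) → ℂ)) →ₗ[ℂ] M :=
  ∑ i : L, ∑ x : (D (l i)).A, (D (l i)).f x ∘ₗ LinearMap.proj (⟨i, x⟩ : Σ i : L, (D (l i)).A)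

theorem sumOfArrows_apply [Fintype L] (l : L ≃ J) (D : ∀ j, OrbitBlock Φ (P j)) (φ) :
    sumOfArrows l D φ = ∑ i : L, ∑ x : (D (l i)).A, (D (l i)).f x (φ ⟨i, x⟩) := by
  simp [sumOfArrows, LinearMap.sum_apply]

theorem sumOfArrows_single [Fintype L] [DecidableEq L] (l : L ≃ J) (D : ∀ j, OrbitBlock Φ (P j))
    (i : L) (x : (D (l i)).A) (T : (Fin (n ((D (l i)).t x)) → ℂ) →ₗ[ℂ]
      (Fin (n ((D (l i)).h x)) → ℂ)) :
    sumOfArrows l D (Pi.single (⟨i, x⟩ : Σ i : L, (D (l i)).A) T) = (D (l i)).f x T := by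
  rw [sumOfArrows_apply, Finset.sum_eq_single i, Finset.sum_eq_single x]
  · rw [Pi.single_eq_same]
  · intro y _ hy
    rw [Pi.single_eq_of_ne, map_zero]
    exact fun h => hy (eq_of_heq (Sigma.mk.inj h).2)
  · simp
  · intro i' _ hi
    refine Finset.sum_eq_zero fun y _ => ?_
    rw [Pi.single_eq_of_ne, map_zero]
    exact fun h => hi (Sigma.mk.inj h).1
  · simp

theorem sumOfArrows_bijective [Fintype L] [DecidableEq L] (l : L ≃ J)
    (D : ∀ j, OrbitBlock Φ (P j)) (hP : IsDualDecomposition S P) :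
    Function.Bijective (sumOfArrows l D) := by
  classical
  constructor
  · refine (injective_iff_map_eq_zero _).2 fun φ hφ => ?_
    rw [sumOfArrows_apply] at hφ
    have h1 : iSupIndep (P ∘ l) := hP.indep.comp l.injective
    have h2 := (iSupIndep_iff_finsetSum_eq_zero_imp_eq_zero (P ∘ l)).1 h1 Finset.univ
      (fun i => ∑ x : (D (l i)).A, (D (l i)).f x (φ ⟨i, x⟩))
      (fun i _ => (P (l i)).sum_mem fun x _ => (D (l i)).mem x _) hφ
    funext ⟨i, x⟩
    exact (D (l i)).inj (fun x => φ ⟨i, x⟩) (h2 i (Finset.mem_univ i)) x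
  · rw [← LinearMap.range_eq_top, eq_top_iff, ← hP.top, iSup_le_iff]
    intro j m hm
    obtain ⟨i, rfl⟩ := l.surjective j
    obtain ⟨φ, rfl⟩ := (D (l i)).surj m hm
    refine Submodule.sum_mem _ fun x _ => ⟨_, sumOfArrows_single l D i x _⟩

variable [Finite I] [Finite L] in
theorem nonempty_corresponds_of_orbitBlocks (l : L ≃ J)
    (D : ∀ j, OrbitBlock Φ (P j)) (hP : IsDualDecomposition S P) :
    Nonempty (Corresponds (S := S) P (Φ.quiv l D) n) := by
  classical
  cases nonempty_fintype L
  let E := LinearEquiv.ofBijective (sumOfArrows l D) (sumOfArrows_bijective l D hP)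
  have hE : ∀ φ, E φ = ∑ i : L, ∑ x : (D (l i)).A, (D (l i)).f x (φ ⟨i, x⟩) := fun φ =>
    sumOfArrows_apply l D φ
  have hEs : ∀ i x T, E.symm ((D (l i)).f x T) = Pi.single (⟨i, x⟩ : Σ i : L, (D (l i)).A) T :=
    fun i x T => by
      rw [LinearEquiv.symm_apply_eq]
      exact (sumOfArrows_single l D i x T).symm
  refine ⟨{
    C := Φ.C
    isForm := ⟨Φ.off, Φ.symm, Φ.nondeg⟩
    eS := e
    eM := E.symm
    left := ?_
    right := ?_
    star_alg := fun s i j v w => Φ.inv i j s v w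
    star_mod := ?_
    lab := fun a => l a.1
    lab_eq_iff := ?_
    lab_surj := ?_
    mem_iff := ?_ }⟩
  · intro s m a
    obtain ⟨φ, rfl⟩ := E.surjective m
    have : s • E φ = E fun a => e s _ ∘ₗ φ a := by
      simp only [hE, Finset.smul_sum, ← ((D _).bimod _).left]
    have h2 := congrArg E.symm this
    rw [LinearEquiv.symm_apply_apply] at h2
    have h3 : E.symm (E φ) a = φ a := by rw [LinearEquiv.symm_apply_apply]
    exact (congrFun h2 a).trans (congrArg (e s _ ∘ₗ ·) h3.symm)
  · intro s m a
    obtain ⟨φ, rfl⟩ := E.surjective m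
    have : MulOpposite.op s • E φ = E fun a => φ a ∘ₗ e s _ := by
      simp only [hE, Finset.smul_sum, ← ((D _).bimod _).right]
    have h2 := congrArg E.symm this
    rw [LinearEquiv.symm_apply_apply] at h2
    have h3 : E.symm (E φ) a = φ a := by rw [LinearEquiv.symm_apply_apply]
    exact (congrFun h2 a).trans (congrArg (· ∘ₗ e s _) h3.symm)
  · rintro m ⟨i, x⟩ v w
    obtain ⟨φ, rfl⟩ := E.surjective m
    have hex : ∀ i x, ∃ T', Φ.IsAdjoint (a' := (D (l i)).h ((D (l i)).σ x))
        (b' := (D (l i)).t ((D (l i)).σ x)) ((((D (l i)).sg x : ℤˣ) : ℤ) : ℂ) (φ ⟨i, x⟩) T' :=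
      fun i x => Φ.exists_isAdjoint ((D (l i)).σ_t x).symm _
        (left_ne_zero_of_mul_eq_one (intUnits_cast_mul_self _)) _
    choose ψ hψ using hex
    have hst : star (E φ) = ∑ i : L, ∑ x : (D (l i)).A, (D (l i)).f ((D (l i)).σ x) (ψ i x) := by
      rw [hE, star_sum]
      refine Finset.sum_congr rfl fun i _ => ?_
      rw [star_sum]
      exact Finset.sum_congr rfl fun x _ => (D (l i)).star_f x _ _ (hψ i x)
    -- Since `σ` is injective on arrows, only the summand of `x` has a component at `σ x`.
    have hval : E.symm (star (E φ)) ⟨i, (D (l i)).σ x⟩ = ψ i x := by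
      rw [hst, map_sum, Finset.sum_apply, Finset.sum_eq_single i, map_sum, Finset.sum_apply,
        Finset.sum_eq_single x]
      · rw [hEs, Pi.single_eq_same]
      · intro y _ hy
        rw [hEs, Pi.single_eq_of_ne]
        intro h
        refine hy ?_
        rw [← (D (l i)).σ_σ x, ← (D (l i)).σ_σ y]
        exact congrArg _ (eq_of_heq (Sigma.mk.inj h).2).symm
      · simp
      · intro i' _ hi
        rw [map_sum, Finset.sum_apply]
        refine Finset.sum_eq_zero fun y _ => ?_
        rw [hEs, Pi.single_eq_of_ne]
        exact fun h => hi (Sigma.mk.inj h).1.symm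
      · simp
    have h0 : E.symm (E φ) ⟨i, x⟩ = φ ⟨i, x⟩ := by rw [LinearEquiv.symm_apply_apply]
    have := hψ i x v w
    rw [← hval, ← h0] at this
    exact this
  · rintro ⟨i, x⟩ ⟨i', y⟩
    rw [l.apply_eq_iff_eq]
    constructor
    · rintro h
      change i = i' at h
      subst h
      rcases (D (l i)).orbit x y with h | h
      · exact Or.inl (by rw [h])
      · exact Or.inr (by rw [h]; rfl)
    · rintro (h | h)
      · exact (congrArg Sigma.fst h).symm
      · exact (congrArg Sigma.fst h).symm
  · intro j
    obtain ⟨i, rfl⟩ := l.surjective j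
    obtain ⟨x⟩ := (D (l i)).ne
    exact ⟨⟨i, x⟩, rfl⟩
  · intro m j
    obtain ⟨i, rfl⟩ := l.surjective j
    constructor
    · rintro hm ⟨i', y⟩ ha
      obtain ⟨φ, rfl⟩ := (D (l i)).surj m hm
      have : E.symm (∑ x, (D (l i)).f x (φ x)) (⟨i', y⟩ : Σ i : L, (D (l i)).A) = 0 := by
        rw [map_sum, Finset.sum_apply]
        refine Finset.sum_eq_zero fun x _ => ?_
        rw [hEs, Pi.single_eq_of_ne]
        exact fun h => ha (congrArg l (Sigma.mk.inj h).1)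
      exact this
    · intro h
      obtain ⟨φ, rfl⟩ := E.surjective m
      have h : ∀ a : Σ i : L, (D (l i)).A, l a.1 ≠ l i → φ a = 0 := fun a ha => by
        have h1 : E.symm (E φ) a = 0 := h a ha
        rwa [LinearEquiv.symm_apply_apply] at h1
      rw [hE, Finset.sum_eq_single i]
      · exact (P (l i)).sum_mem fun x _ => (D (l i)).mem x _
      · intro i' _ hi
        refine Finset.sum_eq_zero fun y _ => ?_
        rw [h ⟨i', y⟩ fun h' => hi (l.injective h'), map_zero]
      · simp

end Existence

theorem exists_corresponds {S : Type*} [Ring S] [Algebra ℂ S] [Module.Finite ℂ S]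
    [IsSemisimpleRing S] [StarRing S]
    {M : Type*} [AddCommGroup M] [Module ℂ M] [Module.Finite ℂ M] [Module S M] [Module Sᵐᵒᵖ M]
    [SMulCommClass S Sᵐᵒᵖ M] [IsScalarTower ℂ S M] [IsScalarTower ℂ Sᵐᵒᵖ M]
    [SMulCommClass S ℂ M] [StarAddMonoid M] (hD : IsDualmod S M)
    {J : Type*} (P : J → Submodule ℂ M) (hP : IsDualDecomposition S P) :
    ∃ (Q : Quiv) (n : Q.V → ℕ), Nonempty (Corresponds (S := S) P Q n) := by
  obtain ⟨k, n, hn, ⟨w⟩⟩ := IsSemisimpleRing.exists_algEquiv_pi_matrix_of_isAlgClosed ℂ S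
  let e : S ≃ₐ[ℂ] (∀ i, Module.End ℂ (Fin (n i) → ℂ)) :=
    w.trans (AlgEquiv.piCongrRight fun i => Matrix.toLinAlgEquiv')
  obtain ⟨σ, ε, C, h1, h2, h3, h4, h5, h6⟩ := exists_invariant_form e hD.star_smul_alg
  let Φ : InvariantForm e := ⟨σ, ε, C, h1, h2, h3, h4, h5, h6⟩
  -- An independent family of nonzero subspaces of `M` is finite. Replacing `J` by `Fin m` brings
  -- the arrows into `Type`, as `Quiv` requires.
  have : Finite J := WellFoundedGT.finite_of_iSupIndep hP.indep hP.ne_bot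
  obtain ⟨m, ⟨l⟩⟩ := Finite.exists_equiv_fin J
  have D : ∀ j, OrbitBlock Φ (P j) := fun j =>
    (nonempty_orbitBlock Φ hD (hP.sub j) (hP.ne_bot j) (hP.minimal j)).some
  exact ⟨Φ.quiv l.symm D, n, nonempty_corresponds_of_orbitBlocks l.symm D hP⟩

/-! ### Holomorphic maps to finite-dimensional vector spaces -/

section HolFun

variable {B : Type*} [NormedAddCommGroup B] [NormedSpace ℂ B]
variable {X : Type*} [TopologicalSpace X] [ChartedSpace B X] {x : X}
variable {W W' W'' : Type*} [AddCommGroup W] [Module ℂ W] [AddCommGroup W'] [Module ℂ W']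
  [AddCommGroup W''] [Module ℂ W'']

namespace HolFunAt

theorem congr {f g : X → W} (hf : HolFunAt B f x) (h : ∀ᶠ y in 𝓝 x, g y = f y) :
    HolFunAt B g x := fun l =>
  (hf l).congr_of_eventuallyEq (h.mono fun y hy => by simp only [hy])

theorem const (c : W) : HolFunAt B (fun _ : X => c) x := fun _ => contMDiffAt_const

theorem comp_linear {f : X → W} (hf : HolFunAt B f x) (L : W →ₗ[ℂ] W') :
    HolFunAt B (fun y => L (f y)) x := fun l => hf (l ∘ₗ L)

theorem of_comp_injective {f : X → W} (L : W →ₗ[ℂ] W') (hL : Function.Injective L)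
    (h : HolFunAt B (fun y => L (f y)) x) : HolFunAt B f x := by
  obtain ⟨L', hL'⟩ := L.exists_leftInverse_of_injective (LinearMap.ker_eq_bot.2 hL)
  refine (h.comp_linear L').congr (Filter.Eventually.of_forall fun y => ?_)
  exact (LinearMap.congr_fun hL' (f y)).symm

theorem sum {ι : Type*} (s : Finset ι) {f : ι → X → W} (hf : ∀ i ∈ s, HolFunAt B (f i) x) :
    HolFunAt B (fun y => ∑ i ∈ s, f i y) x := fun l => by
  simp only [map_sum]
  exact ContMDiffAt.sum fun i hi => hf i hi l

theorem smul {f : X → ℂ} {g : X → W} (hf : HolFunAt B f x) (hg : HolFunAt B g x) :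
    HolFunAt B (fun y => f y • g y) x := fun l => by
  simp only [map_smul]
  exact (hf LinearMap.id).smul (hg l)

theorem bilinear [FiniteDimensional ℂ W] {f : X → W} {g : X → W'} (b : W →ₗ[ℂ] W' →ₗ[ℂ] W'')
    (hf : HolFunAt B f x) (hg : HolFunAt B g x) : HolFunAt B (fun y => b (f y) (g y)) x := by
  let e := Module.finBasis ℂ W
  refine (HolFunAt.sum Finset.univ fun i _ => (hf.comp_linear (e.coord i)).smul
    (hg.comp_linear (b (e i)))).congr (Filter.Eventually.of_forall fun y => ?_)
  calc b (f y) (g y) = b (∑ i, e.repr (f y) i • e i) (g y) := by rw [e.sum_repr]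
    _ = _ := by simp only [map_sum, map_smul, LinearMap.sum_apply, LinearMap.smul_apply]; rfl

theorem pi {ι : Type*} [Finite ι] {U : ι → Type*} [∀ i, AddCommGroup (U i)] [∀ i, Module ℂ (U i)]
    {f : X → ∀ i, U i} (hf : ∀ i, HolFunAt B (fun y => f y i) x) : HolFunAt B f x := by
  classical
  cases nonempty_fintype ι
  refine (HolFunAt.sum Finset.univ fun i _ => (hf i).comp_linear (LinearMap.single ℂ U i)).congr
    (Filter.Eventually.of_forall fun y => ?_)
  exact (Finset.univ_sum_single (f y)).symm

theorem of_apply [FiniteDimensional ℂ W] {f : X → W →ₗ[ℂ] W'}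
    (hf : ∀ v, HolFunAt B (fun y => f y v) x) : HolFunAt B f x := by
  let e := Module.finBasis ℂ W
  refine of_comp_injective (LinearMap.pi fun i => LinearMap.applyₗ (e i)) ?_
    (pi fun i => hf (e i))
  intro a b hab
  exact e.ext fun i => congrFun hab i

theorem apply [FiniteDimensional ℂ W] {f : X → W →ₗ[ℂ] W'} {g : X → W}
    (hf : HolFunAt B f x) (hg : HolFunAt B g x) : HolFunAt B (fun y => f y (g y)) x :=
  hg.bilinear LinearMap.applyₗ hf

theorem contMDiffAt {F : Type*} [NormedAddCommGroup F] [NormedSpace ℂ F] [FiniteDimensional ℂ F]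
    {f : X → F} (hf : HolFunAt B f x) : ContMDiffAt 𝓘(ℂ, B) 𝓘(ℂ, F) ω f x := by
  let e := Module.finBasis ℂ F
  have : f = fun y => ∑ i, e.coord i (f y) • e i := funext fun y => (e.sum_repr (f y)).symm
  rw [this]
  exact ContMDiffAt.sum fun i _ => (hf (e.coord i)).smul contMDiffAt_const

theorem of_contMDiffAt {F : Type*} [NormedAddCommGroup F] [NormedSpace ℂ F]
    [FiniteDimensional ℂ F] {f : X → F} (hf : ContMDiffAt 𝓘(ℂ, B) 𝓘(ℂ, F) ω f x) :
    HolFunAt B f x := fun l =>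
  (LinearMap.toContinuousLinearMap l).contMDiff.contMDiffAt.comp x hf

theorem eventually [FiniteDimensional ℂ W] [IsManifold 𝓘(ℂ, B) ω X] {f : X → W}
    (hf : HolFunAt B f x) : ∀ᶠ y in 𝓝 x, HolFunAt B f y := by
  let e := Module.finBasis ℂ W
  have : ∀ᶠ y in 𝓝 x, ∀ i, ContMDiffAt 𝓘(ℂ, B) 𝓘(ℂ, ℂ) ω (fun z => e.coord i (f z)) y :=
    Filter.eventually_all.2 fun i =>
      (contMDiffAt_iff_contMDiffAt_nhds (by simp)).1 (hf (e.coord i))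
  filter_upwards [this] with y hy
  refine of_comp_injective (W' := Fin _ → ℂ) e.equivFun.toLinearMap e.equivFun.injective
    (pi fun i => of_contMDiffAt (hy i))

/-- Inversion of operators is analytic at every invertible operator. -/
theorem symm {F : Type*} [NormedAddCommGroup F] [NormedSpace ℂ F] [FiniteDimensional ℂ F]
    {A : X → F ≃ₗ[ℂ] F} (hA : HolFunAt B (fun y => (A y).toLinearMap) x) :
    HolFunAt B (fun y => (A y).symm.toLinearMap) x := by
  have : CompleteSpace F := FiniteDimensional.complete ℂ F
  have h1 : ContMDiffAt 𝓘(ℂ, B) 𝓘(ℂ, F →L[ℂ] F) ω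
      (fun y => ((A y).toContinuousLinearEquiv : F →L[ℂ] F)) x :=
    (hA.comp_linear LinearMap.toContinuousLinearMap.toLinearMap).contMDiffAt
  have h2 := of_contMDiffAt (ContDiffAt.comp_contMDiffAt (g := ContinuousLinearMap.inverse)
    (f := fun y => ((A y).toContinuousLinearEquiv : F →L[ℂ] F))
    (contDiffAt_map_inverse (n := ω) (A x).toContinuousLinearEquiv) h1)
  refine (h2.comp_linear (LinearMap.toContinuousLinearMap (𝕜 := ℂ) (E := F)
    (F' := F)).symm.toLinearMap).congr (Filter.Eventually.of_forall fun y => ?_)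
  ext v
  simp

end HolFunAt

end HolFun

/-! ### Holomorphic frames -/

section Frames

variable {B : Type*} [NormedAddCommGroup B] [NormedSpace ℂ B]
variable {X : Type*} [TopologicalSpace X] [ChartedSpace B X]
variable {F : Type*} [NormedAddCommGroup F] [NormedSpace ℂ F]

namespace HolVB

variable (N : HolVB.{w} B X F)

open scoped Classical in
/-- A frame that is holomorphic near `x`. -/
noncomputable def localFrame (x y : X) : F ≃ₗ[ℂ] N.fib y :=
  if h : y ∈ (trivializationAt F N.fib x).baseSet then
    ((trivializationAt F N.fib x).linearEquivAt ℂ y h).symm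
  else ((trivializationAt F N.fib y).linearEquivAt ℂ y
    (FiberBundle.mem_baseSet_trivializationAt' y)).symm

theorem localFrame_symm_apply {x y : X} (h : y ∈ (trivializationAt F N.fib x).baseSet)
    (v : N.fib y) : (N.localFrame x y).symm v = (trivializationAt F N.fib x ⟨y, v⟩).2 := by
  rw [localFrame, dif_pos h]
  rfl

theorem eventually_mem_baseSet (x : X) :
    ∀ᶠ y in 𝓝 x, y ∈ (trivializationAt F N.fib x).baseSet :=
  (trivializationAt F N.fib x).open_baseSet.mem_nhds
    (FiberBundle.mem_baseSet_trivializationAt' x)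

variable {N} [FiniteDimensional ℂ F]

theorem holAt_iff_localFrame_of_mem {x x' : X}
    (hx : x' ∈ (trivializationAt F N.fib x).baseSet) {f : ∀ y, N.fib y} :
    N.HolAt f x' ↔ HolFunAt B (fun y => (N.localFrame x y).symm (f y)) x' := by
  have hev : ∀ᶠ y in 𝓝 x', y ∈ (trivializationAt F N.fib x).baseSet :=
    (trivializationAt F N.fib x).open_baseSet.mem_nhds hx
  rw [HolAt, (trivializationAt F N.fib x).contMDiffAt_section_iff hx]
  constructor
  · intro h
    exact (HolFunAt.of_contMDiffAt h).congr (hev.mono fun y hy => N.localFrame_symm_apply hy _)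
  · intro h
    exact (h.congr (hev.mono fun y hy => (N.localFrame_symm_apply hy _).symm)).contMDiffAt

theorem holAt_iff_localFrame {x : X} {f : ∀ y, N.fib y} :
    N.HolAt f x ↔ HolFunAt B (fun y => (N.localFrame x y).symm (f y)) x :=
  holAt_iff_localFrame_of_mem (FiberBundle.mem_baseSet_trivializationAt' x)

theorem HolAt.congr {x : X} {f g : ∀ y, N.fib y} (hf : N.HolAt f x)
    (h : ∀ᶠ y in 𝓝 x, g y = f y) : N.HolAt g x := by
  rw [holAt_iff_localFrame] at hf ⊢
  exact HolFunAt.congr hf (h.mono fun y hy => by rw [hy])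

theorem holFrameAt_localFrame (x : X) : N.HolFrameAt (N.localFrame x) x := fun v => by
  rw [holAt_iff_localFrame]
  simpa using HolFunAt.const v

theorem HolFrameAt.holFunAt_transition {x : X} {q : ∀ y, F ≃ₗ[ℂ] N.fib y}
    (hq : N.HolFrameAt q x) :
    HolFunAt B (fun y => ((q y).trans (N.localFrame x y).symm).toLinearMap) x :=
  HolFunAt.of_apply fun v => holAt_iff_localFrame.1 (hq v)

/-- Coordinates in `q` and in the trivialization differ by a holomorphic family of invertible maps,
whose inverses are holomorphic too. Holomorphy may therefore be tested in any holomorphic frame. -/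
theorem HolFrameAt.holAt_iff {x : X} {q : ∀ y, F ≃ₗ[ℂ] N.fib y}
    (hq : N.HolFrameAt q x) {f : ∀ y, N.fib y} :
    N.HolAt f x ↔ HolFunAt B (fun y => (q y).symm (f y)) x := by
  rw [holAt_iff_localFrame]
  constructor
  · intro h
    simpa using hq.holFunAt_transition.symm.apply h
  · intro h
    simpa using hq.holFunAt_transition.apply h

theorem HolFrameAt.holAt_apply_iff {x : X} {q : ∀ y, F ≃ₗ[ℂ] N.fib y}
    (hq : N.HolFrameAt q x) {h : X → F} :
    N.HolAt (fun y => q y (h y)) x ↔ HolFunAt B h x := by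
  rw [hq.holAt_iff]
  simp

theorem HolFrameAt.eventually [IsManifold 𝓘(ℂ, B) ω X] {x : X} {q : ∀ y, F ≃ₗ[ℂ] N.fib y}
    (hq : N.HolFrameAt q x) : ∀ᶠ y in 𝓝 x, N.HolFrameAt q y := by
  filter_upwards [HolFunAt.eventually hq.holFunAt_transition,
    N.eventually_mem_baseSet x] with y hy h v
  rw [holAt_iff_localFrame_of_mem h]
  exact HolFunAt.apply hy (HolFunAt.const v)

theorem HolFrameAt.trans {x : X} {q : ∀ y, F ≃ₗ[ℂ] N.fib y} (hq : N.HolFrameAt q x)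
    {A : X → F ≃ₗ[ℂ] F} (hA : HolFunAt B (fun y => (A y).toLinearMap) x) :
    N.HolFrameAt (fun y => (A y).trans (q y)) x := fun v =>
  hq.holAt_apply_iff.2 (hA.apply (HolFunAt.const v))

/-! ### The dual bundle -/

/-- Near `x`, the coordinates of `m` in the bundle of homomorphisms to the trivial line bundle are
the composites of `m` with the local frame. -/
theorem dual_holAt_iff_localFrame {x : X} {m : ∀ y, N.fib y →L[ℂ] ℂ} :
    N.dual.HolAt m x ↔ ∀ v, HolFunAt B (fun y => m y (N.localFrame x y v)) x := by
  have h0 : N.dual.HolAt m x ↔ ContMDiffAt 𝓘(ℂ, B) 𝓘(ℂ, F →L[ℂ] ℂ) ω (fun y =>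
      ContinuousLinearMap.inCoordinates F N.fib ℂ (Bundle.Trivial X ℂ) x y x y (m y)) x := by
    have := contMDiffAt_hom_bundle (IB := 𝓘(ℂ, B)) (IM := 𝓘(ℂ, B)) (n := ω) (F₁ := F) (F₂ := ℂ)
      (E₁ := N.fib) (E₂ := Bundle.Trivial X ℂ) (x₀ := x)
      (fun y => Bundle.TotalSpace.mk' (F →L[ℂ] ℂ) y (m y))
    exact this.trans (and_iff_right contMDiffAt_id)
  have h1 : ∀ v, ∀ᶠ y in 𝓝 x,
      ContinuousLinearMap.inCoordinates F N.fib ℂ (Bundle.Trivial X ℂ) x y x y (m y) v =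
        m y (N.localFrame x y v) := fun v => by
    filter_upwards [N.eventually_mem_baseSet x] with y hy
    rw [ContinuousLinearMap.inCoordinates_eq hy (Set.mem_univ y)]
    simp [localFrame, hy]
  rw [h0]
  constructor
  · intro h v
    have h2 := (HolFunAt.of_contMDiffAt h).comp_linear
      ((LinearMap.applyₗ v).comp (ContinuousLinearMap.coeLM ℂ : (F →L[ℂ] ℂ) →ₗ[ℂ] _))
    exact h2.congr ((h1 v).mono fun y hy => hy.symm)
  · intro h
    refine HolFunAt.contMDiffAt (HolFunAt.of_comp_injective
      (ContinuousLinearMap.coeLM ℂ : (F →L[ℂ] ℂ) →ₗ[ℂ] _)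
      ContinuousLinearMap.coe_injective (HolFunAt.of_apply fun v => ?_))
    exact (h v).congr (h1 v)

theorem HolFrameAt.dual_holAt_iff {x : X} {q : ∀ y, F ≃ₗ[ℂ] N.fib y} (hq : N.HolFrameAt q x)
    {m : ∀ y, N.fib y →L[ℂ] ℂ} :
    N.dual.HolAt m x ↔ ∀ v, HolFunAt B (fun y => m y (q y v)) x := by
  rw [dual_holAt_iff_localFrame]
  constructor
  · intro h v
    have h1 : HolFunAt B (fun y => (m y).toLinearMap ∘ₗ (N.localFrame x y).toLinearMap) x :=
      HolFunAt.of_apply h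
    simpa using h1.apply (hq.holFunAt_transition.apply (HolFunAt.const v))
  · intro h v
    have h1 : HolFunAt B (fun y => (m y).toLinearMap ∘ₗ (q y).toLinearMap) x :=
      HolFunAt.of_apply h
    simpa using h1.apply (hq.holFunAt_transition.symm.apply (HolFunAt.const v))

end HolVB

end Frames

/-! ### Vector bundles from local frames -/

section OfFrames

variable {B : Type*} [NormedAddCommGroup B] [NormedSpace ℂ B]
variable {X : Type*} [TopologicalSpace X] [ChartedSpace B X]
variable {F : Type*} [NormedAddCommGroup F] [NormedSpace ℂ F]
variable {fib : X → Type w} [∀ x, AddCommGroup (fib x)] [∀ x, Module ℂ (fib x)]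

/-- The pretrivialization given by a family of frames. -/
def pretrivializationOfFrame (q : ∀ y, F ≃ₗ[ℂ] fib y) (U : Set X) (hU : IsOpen U) :
    Bundle.Pretrivialization F (Bundle.TotalSpace.proj : Bundle.TotalSpace F fib → X) where
  toFun z := (z.1, (q z.1).symm z.2)
  invFun z := ⟨z.1, q z.1 z.2⟩
  source := Bundle.TotalSpace.proj ⁻¹' U
  target := U ×ˢ Set.univ
  map_source' _ hz := ⟨hz, Set.mem_univ _⟩
  map_target' _ hz := hz.1
  left_inv' _ _ := by simp
  right_inv' _ _ := by simp
  open_target := hU.prod isOpen_univ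
  baseSet := U
  open_baseSet := hU
  source_eq := rfl
  target_eq := rfl
  proj_toFun _ _ := rfl

theorem pretrivializationOfFrame_symm (q : ∀ y, F ≃ₗ[ℂ] fib y) {U : Set X} (hU : IsOpen U) {y : X}
    (hy : y ∈ U) (v : F) : (pretrivializationOfFrame q U hU).symm y v = q y v := by
  rw [Bundle.Pretrivialization.symm_apply _ (show y ∈ (pretrivializationOfFrame q U hU).baseSet
    from hy)]
  rfl

variable (B) in
/-- Frames on open sets which cover `X`, with holomorphic transition functions. -/
structure FrameAtlas (F : Type*) [NormedAddCommGroup F] [NormedSpace ℂ F]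
    (fib : X → Type w) [∀ x, AddCommGroup (fib x)] [∀ x, Module ℂ (fib x)] where
  frame : X → ∀ y, F ≃ₗ[ℂ] fib y
  dom : X → Set X
  isOpen_dom : ∀ x, IsOpen (dom x)
  mem_dom : ∀ x, x ∈ dom x
  hol : ∀ x x' y, y ∈ dom x → y ∈ dom x' →
    HolFunAt B (fun z => ((frame x z).trans (frame x' z).symm).toLinearMap) y

variable [FiniteDimensional ℂ F] (A : FrameAtlas B F fib)

namespace FrameAtlas

/-- The topology on a fibre. -/
@[reducible]
def topFib (x : X) : TopologicalSpace (fib x) :=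
  TopologicalSpace.induced (A.frame x x).symm inferInstance

/-- The transition functions, as continuous linear maps. -/
noncomputable def transition (x x' y : X) : F →L[ℂ] F :=
  LinearMap.toContinuousLinearMap ((A.frame x y).trans (A.frame x' y).symm).toLinearMap

theorem contMDiffOn_transition (x x' : X) :
    ContMDiffOn 𝓘(ℂ, B) 𝓘(ℂ, F →L[ℂ] F) ω (A.transition x x') (A.dom x ∩ A.dom x') :=
  fun y hy => (HolFunAt.contMDiffAt ((A.hol x x' y hy.1 hy.2).comp_linear
    LinearMap.toContinuousLinearMap.toLinearMap)).contMDiffWithinAt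

theorem transition_apply (x x' : X) {y : X} (hy : y ∈ A.dom x) (v : F) :
    A.transition x x' y v = (pretrivializationOfFrame (A.frame x') (A.dom x') (A.isOpen_dom x')
      ⟨y, (pretrivializationOfFrame (A.frame x) (A.dom x) (A.isOpen_dom x)).symm y v⟩).2 := by
  rw [pretrivializationOfFrame_symm _ _ hy]
  rfl

/-- The vector prebundle given by frames. -/
@[reducible]
noncomputable def prebundle :
    letI := A.topFib
    VectorPrebundle ℂ F fib :=
  letI := A.topFib
  { pretrivializationAtlas := Set.range fun x =>
      pretrivializationOfFrame (A.frame x) (A.dom x) (A.isOpen_dom x)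
    pretrivialization_linear' := by
      rintro _ ⟨x, rfl⟩
      exact ⟨fun y _ => ⟨fun a b => map_add (A.frame x y).symm a b,
        fun c a => map_smul (A.frame x y).symm c a⟩⟩
    pretrivializationAt := fun x =>
      pretrivializationOfFrame (A.frame x) (A.dom x) (A.isOpen_dom x)
    mem_base_pretrivializationAt := A.mem_dom
    pretrivialization_mem_atlas := fun x => ⟨x, rfl⟩
    exists_coordChange := by
      rintro _ ⟨x, rfl⟩ _ ⟨x', rfl⟩
      exact ⟨A.transition x x', (A.contMDiffOn_transition x x').continuousOn,
        fun y hy v => A.transition_apply x x' hy.1 v⟩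
    totalSpaceMk_isInducing := fun x => by
      have h1 : Topology.IsInducing (A.frame x x).symm := ⟨rfl⟩
      exact Topology.isInducing_const_prod.2 h1 }

theorem isContMDiff_prebundle :
    letI := A.topFib
    A.prebundle.IsContMDiff 𝓘(ℂ, B) ω :=
  letI := A.topFib
  ⟨by
    rintro _ ⟨x, rfl⟩ _ ⟨x', rfl⟩
    exact ⟨A.transition x x', A.contMDiffOn_transition x x',
        fun y hy v => A.transition_apply x x' hy.1 v⟩⟩

/-- The holomorphic vector bundle given by frames. -/
noncomputable def toHolVB : HolVB.{w} B X F :=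
  letI := A.topFib
  letI := A.prebundle.totalSpaceTopology
  letI := A.prebundle.toFiberBundle
  letI := A.prebundle.toVectorBundle
  letI := A.isContMDiff_prebundle
  letI := A.prebundle.contMDiffVectorBundle 𝓘(ℂ, B) (n := ω)
  { fib := fib }

/-- The trivialization at `x` is the inverse of this frame by construction, so that frame vectors
have constant coordinates. -/
theorem toHolVB_holFrameAt (x : X) : A.toHolVB.HolFrameAt (A.frame x) x := fun v => by
  refine (Bundle.contMDiffAt_section (F := F) (E := A.toHolVB.fib) (IB := 𝓘(ℂ, B)) x).2 ?_
  exact (contMDiffAt_const (c := v)).congr_of_eventuallyEq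
    (Filter.Eventually.of_forall fun y => (A.frame x y).symm_apply_apply v)

end FrameAtlas

end OfFrames

/-! ### The structure group as the group of isometries -/

section IsFormLemmas

variable {Q : Quiv} {U : Q.V → Type*} [∀ i, AddCommGroup (U i)] [∀ i, Module ℂ (U i)]
  {C : ∀ i j, U i →ₗ[ℂ] U j →ₗ[ℂ] ℂ}

theorem IsForm.nondeg_left (hC : IsForm Q C) {i j : Q.V} (h : j = Q.σV i) {v : U i}
    (hv : ∀ w, C i j v w = 0) : v = 0 := by
  subst h; exact hC.nondeg i v hv

theorem IsForm.nondeg_right (hC : IsForm Q C) {i j : Q.V} (h : j = Q.σV i) {w : U j}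
    (hw : ∀ v, C i j v w = 0) : w = 0 := by
  refine hC.nondeg_left (j := i) (by rw [h, Q.σV_σV]) fun v => ?_
  rw [hC.symm, hw, mul_zero]

end IsFormLemmas

section StructureGroup

variable {S : Type*} [Ring S] [Algebra ℂ S] [StarRing S]

theorem StrGroup.coord_one : (1 : StrGroup S).coord = 1 := rfl

theorem StrGroup.coord_mul (r r' : StrGroup S) : (r * r').coord = r.coord * r'.coord := rfl

theorem StrGroup.coord_inv (r : StrGroup S) : (r⁻¹).coord = star r.coord := rfl

theorem StrGroup.star_coord_mul (r : StrGroup S) : star r.coord * r.coord = 1 :=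
  (Unitary.mem_iff.1 (r : unitary S).2).1

theorem StrGroup.coord_mul_star (r : StrGroup S) : r.coord * star r.coord = 1 :=
  (Unitary.mem_iff.1 (r : unitary S).2).2

theorem StrGroup.coord_injective : Function.Injective (StrGroup.coord S) := fun _ _ h =>
  Subtype.ext (Subtype.ext h)

/-- Elements of `H` are central in `S`, so their centralizer is all of `D(S)`. -/
theorem StrGroup.exists_coord_eq {s : S} (h1 : star s * s = 1) (h2 : s * star s = 1) :
    ∃ r : StrGroup S, r.coord = s := by
  let g : unitary S := ⟨s, Unitary.mem_iff.2 ⟨h1, h2⟩⟩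
  have hg : g ∈ Subgroup.centralizer (torus S : Set (unitary S)) := by
    rw [Subgroup.mem_centralizer_iff]
    intro h hh
    exact Subtype.ext ((Subalgebra.mem_center_iff (R := ℂ).1 hh s).symm)
  exact ⟨⟨g, hg⟩, rfl⟩

variable {M : Type*} [AddCommGroup M] [Module ℂ M] [Module S M] [Module Sᵐᵒᵖ M] [StarAddMonoid M]
variable {J : Type*} {P : J → Submodule ℂ M} {Q : Quiv} {n : Q.V → ℕ}
  (c : Corresponds (S := S) P Q n)

namespace Corresponds

theorem eS_inv_mul (r : StrGroup S) (i : Q.V) (v : Fin (n i) → ℂ) :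
    c.eS (r⁻¹).coord i (c.eS r.coord i v) = v := by
  have := congrFun (congrArg c.eS (r.star_coord_mul)) i
  rw [map_mul, map_one] at this
  exact LinearMap.congr_fun this v

theorem eS_mul_inv (r : StrGroup S) (i : Q.V) (v : Fin (n i) → ℂ) :
    c.eS r.coord i (c.eS (r⁻¹).coord i v) = v := by
  have := congrFun (congrArg c.eS (r.coord_mul_star)) i
  rw [map_mul, map_one] at this
  exact LinearMap.congr_fun this v

theorem eS_mul_apply (r r' : StrGroup S) (i : Q.V) (v : Fin (n i) → ℂ) :
    c.eS (r * r').coord i v = c.eS r.coord i (c.eS r'.coord i v) := by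
  rw [StrGroup.coord_mul, map_mul]
  rfl

/-- The action of the structure group on the representation space at a vertex. -/
noncomputable def equivOf (r : StrGroup S) (i : Q.V) : (Fin (n i) → ℂ) ≃ₗ[ℂ] (Fin (n i) → ℂ) :=
  { c.eS r.coord i with
    invFun := c.eS (r⁻¹).coord i
    left_inv := c.eS_inv_mul r i
    right_inv := c.eS_mul_inv r i }

theorem equivOf_apply (r : StrGroup S) (i : Q.V) (v : Fin (n i) → ℂ) :
    c.equivOf r i v = c.eS r.coord i v := rfl

theorem isometric (r : StrGroup S) (i j : Q.V) (v : Fin (n i) → ℂ) (w : Fin (n j) → ℂ) :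
    c.C i j (c.eS r.coord i v) (c.eS r.coord j w) = c.C i j v w := by
  rw [c.star_alg, ← StrGroup.coord_inv, eS_inv_mul]

/-- Since `*` is the adjoint and `C` is nondegenerate, an isometry is an element with `star s * s =
1`; being invertible, it is unitary. Thus the structure group is the whole isometry group. -/
theorem exists_of_isometric (A : ∀ i, (Fin (n i) → ℂ) ≃ₗ[ℂ] (Fin (n i) → ℂ))
    (hA : ∀ i j v w, c.C i j (A i v) (A j w) = c.C i j v w) :
    ∃ r : StrGroup S, ∀ i v, c.eS r.coord i v = A i v := by
  let s : S := c.eS.symm fun i => (A i).toLinearMap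
  let s' : S := c.eS.symm fun i => (A i).symm.toLinearMap
  have hs : ∀ i v, c.eS s i v = A i v := fun i v => by simp [s]
  have hs' : ∀ i v, c.eS s' i v = (A i).symm v := fun i v => by simp [s']
  have h1 : star s * s = 1 := by
    refine c.eS.injective (funext fun j => LinearMap.ext fun w => ?_)
    rw [map_mul, map_one]
    change c.eS (star s) j (c.eS s j w) = w
    rw [← sub_eq_zero]
    refine c.isForm.nondeg_right (i := Q.σV j) (Q.σV_σV j).symm fun v => ?_
    rw [map_sub, ← c.star_alg, hs, hs, hA, sub_self]
  have h2 : s * s' = 1 := by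
    refine c.eS.injective (funext fun j => LinearMap.ext fun w => ?_)
    rw [map_mul, map_one]
    change c.eS s j (c.eS s' j w) = w
    rw [hs, hs', LinearEquiv.apply_symm_apply]
  have h3 : star s = s' := left_inv_eq_right_inv h1 h2
  obtain ⟨r, hr⟩ := StrGroup.exists_coord_eq h1 (by rw [h3]; exact h2)
  exact ⟨r, fun i v => by rw [hr, hs]⟩

theorem eq_of_eS_eq {r r' : StrGroup S} (h : ∀ i v, c.eS r.coord i v = c.eS r'.coord i v) :
    r = r' :=
  StrGroup.coord_injective (c.eS.injective (funext fun i => LinearMap.ext (h i)))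

end Corresponds

end StructureGroup

/-! ### Principal bundles -/

section Principal

variable {B : Type*} [NormedAddCommGroup B] [NormedSpace ℂ B]
variable {X : Type*} [TopologicalSpace X] [ChartedSpace B X]
variable {R : Type*} [Group R] {S : Type*} [AddCommGroup S] [Module ℂ S] {coord : R → S}

namespace PrincipalBundle

variable (E : PrincipalBundle.{w} B X coord)

/-- The element of the group which takes `p` to `p'`. -/
noncomputable def div {x : X} (p p' : E.fib x) : R := (E.simply_transitive p p').choose

theorem act_div {x : X} (p p' : E.fib x) : E.act p (E.div p p') = p' :=
  (E.simply_transitive p p').choose_spec.1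

theorem eq_div {x : X} {p p' : E.fib x} {r : R} (h : E.act p r = p') : r = E.div p p' :=
  (E.simply_transitive p p').choose_spec.2 r h

theorem div_act {x : X} (p : E.fib x) (r : R) : E.div p (E.act p r) = r := (E.eq_div rfl).symm

theorem div_self {x : X} (p : E.fib x) : E.div p p = 1 := (E.eq_div (E.act_one p)).symm

theorem div_mul_div {x : X} (p p' p'' : E.fib x) : E.div p p' * E.div p' p'' = E.div p p'' :=
  E.eq_div (by rw [E.act_mul, E.act_div, E.act_div])

/-- A section which is holomorphic near `x`. -/
noncomputable def localSection (x : X) : ∀ y, E.fib y := (E.exists_holAt x).choose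

theorem holAt_localSection (x : X) : E.HolAt (E.localSection x) x := (E.exists_holAt x).choose_spec

theorem holFunAt_div {x : X} {s s' : ∀ y, E.fib y} (hs : E.HolAt s x) (hs' : E.HolAt s' x) :
    HolFunAt B (fun y => coord (E.div (s y) (s' y))) x := by
  rw [← E.holAt_act_iff s x hs]
  simpa only [act_div] using hs'

end PrincipalBundle

end Principal

/-! ### The associated bundle with form -/

section AssociatedBundle

variable {S : Type*} [Ring S] [Algebra ℂ S] [StarRing S]
variable {M : Type*} [AddCommGroup M] [Module ℂ M] [Module S M] [Module Sᵐᵒᵖ M] [StarAddMonoid M]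
variable {J : Type*} {P : J → Submodule ℂ M} {Q : Quiv} {n : Q.V → ℕ}
variable {B : Type*} [NormedAddCommGroup B] [NormedSpace ℂ B]
variable {X : Type*} [TopologicalSpace X] [ChartedSpace B X]
variable (c : Corresponds (S := S) P Q n) (E : PrincipalBundle.{w} B X (StrGroup.coord S))

/-- The fibre of the associated bundle: equivariant functions on the fibre of the principal
bundle. -/
def assocFib (i : Q.V) (x : X) : Submodule ℂ (E.fib x → (Fin (n i) → ℂ)) where
  carrier := {f | ∀ p r, c.eS r.coord i (f (E.act p r)) = f p}
  add_mem' hf hg p r := by simp [hf p r, hg p r]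
  zero_mem' p r := by simp
  smul_mem' a f hf p r := by simp [hf p r]

/-- The frame of the associated bundle which belongs to a point of the principal bundle. -/
noncomputable def assocFrame (i : Q.V) {x : X} (p : E.fib x) :
    (Fin (n i) → ℂ) ≃ₗ[ℂ] assocFib c E i x :=
  LinearEquiv.symm
    { toFun := fun f => f.1 p
      map_add' := fun _ _ => rfl
      map_smul' := fun _ _ => rfl
      invFun := fun v => ⟨fun p' => c.eS (E.div p' p).coord i v, fun p' r => by
        beta_reduce
        rw [← c.eS_mul_apply, ← E.div_mul_div p' (E.act p' r) p, E.div_act]⟩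
      left_inv := fun f => Subtype.ext (funext fun p' => by
        have := f.2 p' (E.div p' p)
        rwa [E.act_div] at this)
      right_inv := fun v => by
        simp only [E.div_self, StrGroup.coord_one, map_one]
        rfl }

theorem assocFrame_symm_apply (i : Q.V) {x : X} (p : E.fib x) (f : assocFib c E i x) :
    (assocFrame c E i p).symm f = f.1 p := rfl

theorem assocFrame_act (i : Q.V) {x : X} (p : E.fib x) (r : StrGroup S) (v : Fin (n i) → ℂ) :
    assocFrame c E i (E.act p r) v = assocFrame c E i p (c.eS r.coord i v) := by
  rw [← LinearEquiv.symm_apply_eq, assocFrame_symm_apply]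
  refine ((assocFrame c E i (E.act p r) v).2 p r).symm.trans ?_
  rw [← assocFrame_symm_apply, LinearEquiv.symm_apply_apply]

/-- The cocycle of the associated bundle is that of `E`, acting through `eS`; this makes the
transition functions holomorphic. -/
theorem assocFrame_transition (i : Q.V) {x : X} (p p' : E.fib x) :
    ((assocFrame c E i p).trans (assocFrame c E i p').symm).toLinearMap =
      c.eS (E.div p' p).coord i := by
  refine LinearMap.ext fun v => ?_
  conv_lhs => rw [← E.act_div p' p]
  simp [assocFrame_act]

theorem holFunAt_eS {r : X → StrGroup S} {x : X} (hr : HolFunAt B (fun y => (r y).coord) x)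
    (i : Q.V) : HolFunAt B (fun y => c.eS (r y).coord i) x :=
  hr.comp_linear (LinearMap.proj i ∘ₗ c.eS.toLinearMap)

/-- The frames of the associated bundle given by local sections of the principal bundle. -/
noncomputable def assocAtlas (i : Q.V) :
    FrameAtlas B (Fin (n i) → ℂ) (fun x => assocFib c E i x) where
  frame x y := assocFrame c E i (E.localSection x y)
  -- The local section is holomorphic on some neighbourhood of `x`; the interior provides an open
  -- one.
  dom x := interior {y | E.HolAt (E.localSection x) y}
  isOpen_dom x := isOpen_interior
  mem_dom x := mem_interior_iff_mem_nhds.2 (E.eventually_holAt _ x (E.holAt_localSection x))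
  hol x x' y hy hy' := by
    simp only [assocFrame_transition]
    exact holFunAt_eS c (E.holFunAt_div (interior_subset hy') (interior_subset hy)) i

theorem assocFrame_holFrameAt (i : Q.V) {s : ∀ x, E.fib x} {x : X} (hs : E.HolAt s x) :
    (assocAtlas c E i).toHolVB.HolFrameAt (fun y => assocFrame c E i (s y)) x := by
  have h := ((assocAtlas c E i).toHolVB_holFrameAt x).trans
    (A := fun y => (assocFrame c E i (s y)).trans (assocFrame c E i (E.localSection x y)).symm) (by
      simp only [assocFrame_transition]
      exact holFunAt_eS c (E.holFunAt_div (E.holAt_localSection x) hs) i)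
  intro v
  refine HolVB.HolAt.congr (h v) (Filter.Eventually.of_forall fun y => ?_)
  exact ((assocFrame c E i (E.localSection x y)).apply_symm_apply _).symm

/-- The form on the fibres of the associated bundle. -/
noncomputable def assocForm (x : X) (i j : Q.V) :
    assocFib c E i x →ₗ[ℂ] assocFib c E j x →ₗ[ℂ] ℂ :=
  (c.C i j).compl₁₂ (assocFrame c E i (E.localSection x x)).symm.toLinearMap
    (assocFrame c E j (E.localSection x x)).symm.toLinearMap

/-- The form is defined through one chosen point of the fibre; because `R` acts by isometries, every
point gives the same value. -/
theorem assocForm_apply {x : X} (p : E.fib x) (i j : Q.V) (f : assocFib c E i x)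
    (f' : assocFib c E j x) : assocForm c E x i j f f' = c.C i j (f.1 p) (f'.1 p) := by
  change c.C i j (f.1 _) (f'.1 _) = _
  rw [← f.2 p (E.div p (E.localSection x x)), ← f'.2 p (E.div p (E.localSection x x)),
    c.isometric, E.act_div]

/-- The bundle with form associated with a principal bundle. -/
noncomputable def assocBundle : FormBundle.{w} B X Q n where
  bun i := (assocAtlas c E i).toHolVB
  form x i j := assocForm c E x i j
  isForm x :=
    { off := fun i j h => by
        change assocForm c E x i j = 0
        ext f f'
        rw [assocForm_apply c E (E.localSection x x), c.isForm.off i j h]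
        rfl
      symm := fun i j => by
        have (f : assocFib c E i x) (f' : assocFib c E j x) :
            assocForm c E x i j f f' = ((Q.εV i : ℤ) : ℂ) * assocForm c E x j i f' f := by
          rw [assocForm_apply c E (E.localSection x x), assocForm_apply c E (E.localSection x x),
            c.isForm.symm]
        exact this
      nondeg := fun i f hf => by
        refine (assocFrame c E i (E.localSection x x)).symm.map_eq_zero_iff.1
          (c.isForm.nondeg i _ fun w => ?_)
        have := hf (assocFrame c E (Q.σV i) (E.localSection x x) w)
        refine Eq.trans ?_ this
        change _ = c.C i _ _ ((assocFrame c E _ _).symm (assocFrame c E _ _ w))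
        rw [LinearEquiv.symm_apply_apply]
        rfl }
  hol i j f f' x hf hf' := by
    have hs := E.holAt_localSection x
    have h1 := (assocFrame_holFrameAt c E i hs).holAt_iff.1 hf
    have h2 := (assocFrame_holFrameAt c E j hs).holAt_iff.1 hf'
    refine (h1.bilinear (c.C i j) h2).congr (Filter.Eventually.of_forall fun y => ?_)
    exact assocForm_apply c E (E.localSection x y) i j (f y) (f' y)

/-- The identification of the associated bundle. -/
noncomputable def assocBundleAssociated : Associated c E (assocBundle c E) where
  frame x p i := assocFrame c E i p
  equivariant x p r i v := assocFrame_act c E i p r v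
  isometric x p i j v v' := by
    change assocForm c E x i j (assocFrame c E i p v) (assocFrame c E j p v') = _
    rw [assocForm_apply c E p, ← assocFrame_symm_apply, ← assocFrame_symm_apply,
      LinearEquiv.symm_apply_apply, LinearEquiv.symm_apply_apply]
  hol s x hs i := assocFrame_holFrameAt c E i hs

end AssociatedBundle

/-! ### Square roots -/

section SquareRoots

/-- A reduced finite-dimensional commutative algebra is a product of copies of `ℂ`. -/
theorem exists_sq_eq_of_isReduced {K : Type*} [CommRing K] [Algebra ℂ K] [Module.Finite ℂ K]
    [IsReduced K] (t : K) : ∃ r, r ^ 2 = t := by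
  have : IsArtinianRing K := IsArtinianRing.of_finite ℂ K
  let e := IsArtinianRing.equivPi K
  have h : ∀ I : MaximalSpectrum K, ∃ y : K ⧸ I.asIdeal, y ^ 2 = e t I := fun I => by
    have := I.isMaximal
    obtain ⟨a, ha⟩ := (IsAlgClosed.algebraMap_bijective_of_isIntegral
      (k := ℂ) (K := K ⧸ I.asIdeal)).2 (e t I)
    obtain ⟨b, hb⟩ := IsAlgClosed.exists_pow_nat_eq a two_pos
    exact ⟨algebraMap ℂ _ b, by rw [← map_pow, hb, ha]⟩
  choose y hy using h
  refine ⟨e.symm y, e.injective ?_⟩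
  rw [map_pow, AlgEquiv.apply_symm_apply]
  exact funext hy

/-- A root modulo the nilradical lifts by Newton's method, since the derivative `2 x` of `X ^ 2 - t`
at a lift `x` is a unit. -/
theorem exists_sq_eq_of_isUnit {K : Type*} [CommRing K] [Algebra ℂ K] [Module.Finite ℂ K] {t : K}
    (ht : IsUnit t) : ∃ r, r ^ 2 = t := by
  have : IsReduced (K ⧸ nilradical K) :=
    (Ideal.isRadical_iff_quotient_reduced _).1 (Ideal.radical_isRadical _)
  obtain ⟨y, hy⟩ := exists_sq_eq_of_isReduced (Ideal.Quotient.mk (nilradical K) t)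
  obtain ⟨x, rfl⟩ := Ideal.Quotient.mk_surjective y
  rw [← map_pow, Ideal.Quotient.eq, mem_nilradical] at hy
  have hx : IsUnit (x ^ 2) := by
    have := hy.isUnit_add_left_of_commute ht (Commute.all _ _)
    rwa [add_sub_cancel] at this
  have hx' : IsUnit x := (isUnit_pow_iff two_ne_zero).1 hx
  have h2 : IsUnit (2 : K) := by
    have := (IsUnit.mk0 (2 : ℂ) two_ne_zero).map (algebraMap ℂ K)
    rwa [map_ofNat] at this
  obtain ⟨r, ⟨-, hr⟩, -⟩ := Polynomial.existsUnique_nilpotent_sub_and_aeval_eq_zero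
    (P := (Polynomial.X ^ 2 - Polynomial.C t : Polynomial K)) (x := x) (by simpa using hy)
    (by simpa [one_add_one_eq_two] using h2.mul hx')
  exact ⟨r, by simpa [sub_eq_zero] using hr⟩

/-- In a finite-dimensional algebra, a unit has a square root which is a polynomial in it. -/
theorem exists_aeval_mul_self_eq {A : Type*} [Ring A] [Algebra ℂ A] [Module.Finite ℂ A] {t : A}
    (ht : IsUnit t) :
    ∃ p : Polynomial ℂ, Polynomial.aeval t p * Polynomial.aeval t p = t := by
  let φ := Polynomial.aeval (R := ℂ) t
  let K := Polynomial ℂ ⧸ RingHom.ker φ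
  let ψ : K →ₐ[ℂ] A := Ideal.kerLiftAlg φ
  have hψ : Function.Injective ψ := Ideal.kerLiftAlg_injective φ
  have hfin : Module.Finite ℂ K := Module.Finite.of_injective ψ.toLinearMap hψ
  have : IsArtinianRing K := IsArtinianRing.of_finite ℂ K
  let s : K := Ideal.Quotient.mk _ Polynomial.X
  have hs : ψ s = t := by
    change φ Polynomial.X = t
    simp [φ]
  -- Invertibility passes to the subalgebra generated by `t`: there `t` is no zero divisor, and the
  -- subalgebra is Artinian.
  have hsu : IsUnit s := by
    refine IsArtinianRing.isUnit_of_mem_nonZeroDivisors ?_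
    rw [mem_nonZeroDivisors_iff_left]
    intro z hz
    refine (map_eq_zero_iff ψ hψ).1 (ht.mul_right_eq_zero.1 ?_)
    rw [← hs, ← map_mul, hz, map_zero]
  obtain ⟨r, hr⟩ := exists_sq_eq_of_isUnit hsu
  obtain ⟨p, rfl⟩ := Ideal.Quotient.mk_surjective r
  refine ⟨p, ?_⟩
  have h := congrArg ψ hr
  rw [hs, pow_two, map_mul] at h
  exact h

/-- A selfadjoint unit has a selfadjoint square root. -/
theorem exists_selfadjoint_mul_self_eq {S : Type*} [Ring S] [Algebra ℂ S] [Module.Finite ℂ S]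
    [StarRing S] (hs : ∀ (c : ℂ) (a : S), star (c • a) = c • star a) {t : S} (ht : IsUnit t)
    (hst : star t = t) : ∃ a : S, star a = a ∧ a * a = t := by
  obtain ⟨p, hp⟩ := exists_aeval_mul_self_eq ht
  refine ⟨_, ?_, hp⟩
  -- The involution is `ℂ`-linear, not conjugate-linear, so it fixes every polynomial in a
  -- selfadjoint element.
  rw [Polynomial.aeval_eq_sum_range, star_sum]
  simp [hs, hst]

/-- The holomorphic square root near the unit element of a Banach algebra. -/
theorem exists_contDiffAt_sqrt (A : Type*) [NormedRing A] [NormedAlgebra ℂ A] [CompleteSpace A] :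
    ∃ g : A → A, ContDiffAt ℂ ω g 1 ∧ g 1 = 1 ∧ (∀ᶠ y in 𝓝 1, g y * g y = y) ∧
      ∀ᶠ y in 𝓝 1, g (y * y) = y := by
  let f : A → A := fun y => y * y
  have hf : ContDiffAt ℂ ω f 1 := contDiffAt_id.mul contDiffAt_id
  -- The derivative of squaring at `1` is multiplication by `2`, which is invertible.
  let f' : A ≃L[ℂ] A := ContinuousLinearEquiv.smulLeft (Units.mk0 (2 : ℂ) two_ne_zero)
  have hf' : HasFDerivAt f (f' : A →L[ℂ] A) 1 := by
    convert! (hasFDerivAt_id (𝕜 := ℂ) (1 : A)).mul' (hasFDerivAt_id (1 : A)) using 1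
    ext y
    simp [f', two_smul, Units.smul_def]
  have hω : (ω : WithTop ℕ∞) ≠ 0 := by simp
  have h1 : f 1 = 1 := one_mul 1
  have hst := hf.hasStrictFDerivAt' hf' hω
  refine ⟨hf.localInverse hf' hω, ?_, ?_, ?_, hst.eventually_left_inverse⟩
  · have := hf.to_localInverse hf' hω
    rwa [h1] at this
  · have := hf.localInverse_apply_image hf' hω
    rwa [h1] at this
  · have := hst.eventually_right_inverse
    rwa [h1] at this

/-- A holomorphic family of selfadjoint elements of an algebra has, near a point at which it is
the unit element, a holomorphic selfadjoint square root. -/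
theorem HolFunAt.exists_sqrt {S : Type*} [Ring S] [Algebra ℂ S] [StarRing S] {A : Type*}
    [NormedRing A] [NormedAlgebra ℂ A] [FiniteDimensional ℂ A] (e : S ≃ₐ[ℂ] A)
    (hs : ∀ (c : ℂ) (a : S), star (c • a) = c • star a)
    {B : Type*} [NormedAddCommGroup B] [NormedSpace ℂ B]
    {X : Type*} [TopologicalSpace X] [ChartedSpace B X] {T : X → S} {x : X}
    (hT : HolFunAt B T x) (hst : ∀ y, star (T y) = T y) (h1 : T x = 1) :
    ∃ G : X → S, HolFunAt B G x ∧ ∀ᶠ y in 𝓝 x, star (G y) = G y ∧ G y * G y = T y := by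
  have : CompleteSpace A := FiniteDimensional.complete ℂ A
  obtain ⟨g, hg, hg1, hgr, hgl⟩ := exists_contDiffAt_sqrt A
  have hTA : ContMDiffAt 𝓘(ℂ, B) 𝓘(ℂ, A) ω (fun y => e (T y)) x :=
    HolFunAt.contMDiffAt (hT.comp_linear e.toLinearMap)
  have hGA : ContMDiffAt 𝓘(ℂ, B) 𝓘(ℂ, A) ω (fun y => g (e (T y))) x :=
    ContDiffAt.comp_contMDiffAt (g := g) (f := fun y => e (T y)) (by rwa [h1, map_one]) hTA
  refine ⟨fun y => e.symm (g (e (T y))),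
    (HolFunAt.of_contMDiffAt hGA).comp_linear e.symm.toLinearMap, ?_⟩
  let τ : A →ₗ[ℂ] A :=
    { toFun := fun a => e (star (e.symm a))
      map_add' := fun a b => by rw [map_add, star_add, map_add]
      map_smul' := fun c a => by rw [map_smul, hs, map_smul]; rfl }
  have hτ : ∀ a, τ a = e (star (e.symm a)) := fun _ => rfl
  have hlim1 : Filter.Tendsto (fun y => e (T y)) (𝓝 x) (𝓝 1) := by
    have := hTA.continuousAt.tendsto
    rwa [h1, map_one] at this
  -- The conjugate of the root is again a square root of the selfadjoint `T y`. As it also tends to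
  -- `1`, local uniqueness `g (y * y) = y` identifies it with the root.
  have hlim2 : Filter.Tendsto (fun y => τ (g (e (T y)))) (𝓝 x) (𝓝 1) := by
    have h2 := (LinearMap.continuous_of_finiteDimensional τ).continuousAt.tendsto.comp
      hGA.continuousAt.tendsto
    rwa [h1, map_one, hg1, hτ, map_one, star_one, map_one] at h2
  filter_upwards [hlim1.eventually hgr, hlim2.eventually hgl] with y hy hy'
  have hsq : e.symm (g (e (T y))) * e.symm (g (e (T y))) = T y := by
    rw [← map_mul, hy, AlgEquiv.symm_apply_apply]
  refine ⟨?_, hsq⟩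
  apply e.injective
  rw [AlgEquiv.apply_symm_apply, ← hτ, ← hy', hτ, ← map_mul, ← star_mul, hsq, hst]

end SquareRoots

/-! ### The principal bundle of isometric frames -/

section FramePrincipal

variable {S : Type*} [Ring S] [Algebra ℂ S] [StarRing S]
variable {M : Type*} [AddCommGroup M] [Module ℂ M] [Module S M] [Module Sᵐᵒᵖ M] [StarAddMonoid M]
variable {J : Type*} {P : J → Submodule ℂ M} {Q : Quiv} {n : Q.V → ℕ}
variable {B : Type*} [NormedAddCommGroup B] [NormedSpace ℂ B]
variable {X : Type*} [TopologicalSpace X] [ChartedSpace B X]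
variable (c : Corresponds (S := S) P Q n)

/-- An invertible element of the algebra acts invertibly on the representation spaces. -/
theorem Corresponds.exists_equiv_of_isUnit {s : S} (hs : IsUnit s) :
    ∃ A : ∀ i, (Fin (n i) → ℂ) ≃ₗ[ℂ] (Fin (n i) → ℂ), ∀ i v, A i v = c.eS s i v := by
  obtain ⟨u, rfl⟩ := hs
  refine ⟨fun i => LinearEquiv.ofLinearMap (c.eS u i) (c.eS (↑u⁻¹ : S) i) ?_ ?_, fun i v => rfl⟩
  · have := congrFun (congrArg c.eS u.mul_inv) i
    rwa [map_mul, map_one] at this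
  · have := congrFun (congrArg c.eS u.inv_mul) i
    rwa [map_mul, map_one] at this

/-- A form on bundles is given, in local frames, by a holomorphic family of selfadjoint elements
of the algebra. -/
theorem exists_selfadjoint_of_frames (Y : FormBundle.{w} B X Q n) {x : X}
    {f : ∀ y i, (Fin (n i) → ℂ) ≃ₗ[ℂ] (Y.bun i).fib y}
    (hf : ∀ i, (Y.bun i).HolFrameAt (fun y => f y i) x) :
    ∃ T : X → S, HolFunAt B T x ∧ (∀ y, star (T y) = T y) ∧ (∀ y, IsUnit (T y)) ∧
      ∀ y i j v w, Y.form y i j (f y i v) (f y j w) = c.C i j (c.eS (T y) i v) w := by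
  have := Q.finV
  -- With `D i v = C (v, ·)` and `β` the form of `Y` in the frame, `T = D⁻¹ ∘ β` represents the
  -- latter through `C`. It is selfadjoint because both forms are symmetric with the same signs.
  let D : ∀ i, (Fin (n i) → ℂ) ≃ₗ[ℂ] Module.Dual ℂ (Fin (n (Q.σV i)) → ℂ) := fun i =>
    pairingEquiv (c.C i (Q.σV i)).flip (fun w h => c.isForm.nondeg_right rfl h)
      (fun v h => c.isForm.nondeg_left rfl h)
  let β : ∀ (y : X) i, (Fin (n i) → ℂ) →ₗ[ℂ] Module.Dual ℂ (Fin (n (Q.σV i)) → ℂ) := fun y i =>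
    (Y.form y i (Q.σV i)).compl₁₂ (f y i).toLinearMap (f y (Q.σV i)).toLinearMap
  have hβ : ∀ i, HolFunAt B (fun y => β y i) x := fun i =>
    HolFunAt.of_apply fun v => HolFunAt.of_apply fun w => Y.hol _ _ _ _ x (hf _ v) (hf _ w)
  let T : X → S := fun y => c.eS.symm fun i => (D i).symm.toLinearMap ∘ₗ β y i
  have hT : ∀ y i j v w, Y.form y i j (f y i v) (f y j w) = c.C i j (c.eS (T y) i v) w := by
    intro y i j v w
    by_cases h : j = Q.σV i
    · subst h
      have h1 : c.C i (Q.σV i) (c.eS (T y) i v) w = D i ((D i).symm (β y i v)) w := by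
        have h2 : c.eS (T y) i v = (D i).symm (β y i v) := by simp [T]
        rw [h2]
        rfl
      rw [h1, LinearEquiv.apply_symm_apply]
      rfl
    · rw [c.isForm.off i j h, (Y.isForm y).off i j h]
      rfl
  refine ⟨T, ?_, ?_, ?_, hT⟩
  · refine HolFunAt.of_comp_injective c.eS.toLinearMap c.eS.injective (HolFunAt.pi fun i => ?_)
    refine ((hβ i).comp_linear (LinearMap.compRight ℂ (D i).symm.toLinearMap)).congr
      (Filter.Eventually.of_forall fun y => ?_)
    simp [T]
  · intro y
    refine c.eS.injective (funext fun j => LinearMap.ext fun w => ?_)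
    rw [← sub_eq_zero]
    refine c.isForm.nondeg_right (i := Q.σV j) (Q.σV_σV j).symm fun v => ?_
    rw [map_sub, ← c.star_alg, ← hT, c.isForm.symm _ _ v, ← hT, (Y.isForm y).symm, sub_self]
  · intro y
    have : IsUnit (c.eS (T y)) := Pi.isUnit_iff.2 fun i => by
      rw [LinearMap.isUnit_iff_ker_eq_bot, LinearMap.ker_eq_bot']
      intro v hv
      refine (f y i).map_eq_zero_iff.1 ((Y.isForm y).nondeg i _ fun w => ?_)
      have := hT y i (Q.σV i) v ((f y (Q.σV i)).symm w)
      rw [LinearEquiv.apply_symm_apply, hv] at this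
      simpa using this
    simpa using this.map c.eS.symm

/-- Isometric holomorphic frames exist locally. -/
theorem exists_isometric_frames [Module.Finite ℂ S]
    (hs : ∀ (c : ℂ) (a : S), star (c • a) = c • star a) (Y : FormBundle.{w} B X Q n) (x : X) :
    ∃ q : ∀ y i, (Fin (n i) → ℂ) ≃ₗ[ℂ] (Y.bun i).fib y,
      (∀ i, (Y.bun i).HolFrameAt (fun y => q y i) x) ∧
      ∀ᶠ y in 𝓝 x, ∀ i j v w, Y.form y i j (q y i v) (q y j w) = c.C i j v w := by
  have := Q.finV
  cases nonempty_fintype Q.V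
  let f : ∀ y i, (Fin (n i) → ℂ) ≃ₗ[ℂ] (Y.bun i).fib y := fun y i => (Y.bun i).localFrame x y
  have hf : ∀ i, (Y.bun i).HolFrameAt (fun y => f y i) x := fun i =>
    HolVB.holFrameAt_localFrame x
  obtain ⟨T, hT, hTst, hTu, hTf⟩ := exists_selfadjoint_of_frames c Y hf
  -- The inverse function theorem gives roots only near `1`. With `u = a` a selfadjoint root of `T
  -- x`, the family `u⁻¹ T u⁻¹` is still selfadjoint and equals `1` at `x`.
  obtain ⟨a, ha, haa⟩ := exists_selfadjoint_mul_self_eq hs (hTu x) (hTst x)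
  have hau : IsUnit a := by
    have := hTu x
    rw [← haa, ← pow_two] at this
    exact (isUnit_pow_iff two_ne_zero).1 this
  obtain ⟨u, rfl⟩ := hau
  have hu' : star (↑u⁻¹ : S) = (↑u⁻¹ : S) := by
    have h1 : star (↑u⁻¹ : S) * u = 1 := by
      have := congrArg star u.mul_inv
      rwa [star_mul, ha, star_one] at this
    exact left_inv_eq_right_inv h1 u.mul_inv
  let L : S →ₗ[ℂ] S := LinearMap.mulLeft ℂ (↑u⁻¹ : S) ∘ₗ LinearMap.mulRight ℂ (↑u⁻¹ : S)
  let e : S ≃ₐ[ℂ] (∀ i, (Fin (n i) → ℂ) →L[ℂ] (Fin (n i) → ℂ)) :=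
    c.eS.trans (AlgEquiv.piCongrRight fun i => Module.End.toContinuousLinearMap _)
  obtain ⟨G, hG, hGG⟩ := HolFunAt.exists_sqrt (T := fun y => ↑u⁻¹ * (T y * ↑u⁻¹)) e hs
    (hT.comp_linear L) (fun y => by
      rw [star_mul, star_mul, hu', hTst, mul_assoc])
    (by rw [← haa]; simp [mul_assoc])
  -- With `G` the root of `u⁻¹ T u⁻¹`, the new frame is the old one composed with the inverse of `G
  -- y * u`. Where this is not a unit, away from `x`, the identity serves as a default.
  have hex : ∀ y, ∃ A : ∀ i, (Fin (n i) → ℂ) ≃ₗ[ℂ] (Fin (n i) → ℂ),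
      IsUnit (G y * u) → ∀ i v, A i v = c.eS (G y * u) i v := fun y => by
    by_cases h : IsUnit (G y * u)
    · obtain ⟨A, hA⟩ := c.exists_equiv_of_isUnit h
      exact ⟨A, fun _ => hA⟩
    · exact ⟨fun i => LinearEquiv.refl _ _, fun h' => absurd h' h⟩
  choose A hA using hex
  have hev : ∀ᶠ y in 𝓝 x, star (G y) = G y ∧ (∀ i v, A y i v = c.eS (G y * u) i v) ∧
      T y = u * G y * (G y * u) := by
    filter_upwards [hGG] with y hy
    refine ⟨hy.1, hA y (IsUnit.mul ?_ u.isUnit), ?_⟩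
    · refine (isUnit_pow_iff two_ne_zero).1 ?_
      rw [pow_two, hy.2]
      exact u⁻¹.isUnit.mul ((hTu y).mul u⁻¹.isUnit)
    · have : u * G y * (G y * u) = u * (G y * G y) * u := by simp only [mul_assoc]
      rw [this, hy.2]
      simp [mul_assoc]
  have hAhol : ∀ i, HolFunAt B (fun y => (A y i).toLinearMap) x := fun i => by
    refine (((hG.comp_linear (LinearMap.mulRight ℂ (u : S))).comp_linear
      c.eS.toLinearMap).comp_linear (LinearMap.proj i)).congr (hev.mono fun y hy => ?_)
    exact LinearMap.ext (hy.2.1 i)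
  refine ⟨fun y i => (A y i).symm.trans (f y i), fun i => (hf i).trans (hAhol i).symm, ?_⟩
  filter_upwards [hev] with y ⟨h1, h2, h3⟩ i j v w
  rw [LinearEquiv.trans_apply, LinearEquiv.trans_apply, hTf, h3, map_mul]
  have h4 : star (u * G y) = G y * u := by rw [star_mul, h1, ha]
  -- Here `T = g^* g` with `g = G y * u`; the factor `g^*` moves to the other argument as `g`, and
  -- both factors cancel against the change of frame.
  change c.C i j (c.eS (u * G y) i (c.eS (G y * u) i _)) _ = _
  rw [← h2, LinearEquiv.apply_symm_apply, c.star_alg, h4, ← h2, LinearEquiv.apply_symm_apply]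

variable [IsManifold 𝓘(ℂ, B) ω X]

/-- The principal bundle of isometric frames of a bundle with form. -/
noncomputable def framePrincipal [Module.Finite ℂ S]
    (hs : ∀ (c : ℂ) (a : S), star (c • a) = c • star a) (Y : FormBundle.{w} B X Q n) :
    PrincipalBundle.{w} B X (StrGroup.coord S) where
  fib x := {q : ∀ i, (Fin (n i) → ℂ) ≃ₗ[ℂ] (Y.bun i).fib x //
    ∀ i j v w, Y.form x i j (q i v) (q j w) = c.C i j v w}
  act q r := ⟨fun i => (c.equivOf r i).trans (q.1 i), fun i j v w => by
    simp only [LinearEquiv.trans_apply, q.2, c.equivOf_apply, c.isometric]⟩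
  act_one q := Subtype.ext (funext fun i => LinearEquiv.ext fun v => by
    simp [c.equivOf_apply, StrGroup.coord_one])
  act_mul q r r' := Subtype.ext (funext fun i => LinearEquiv.ext fun v => by
    simp [c.equivOf_apply, c.eS_mul_apply])
  simply_transitive q q' := by
    obtain ⟨r, hr⟩ := c.exists_of_isometric (fun i => (q'.1 i).trans (q.1 i).symm)
      fun i j v w => by
        rw [← q.2]
        simp [q'.2]
    refine ⟨r, Subtype.ext (funext fun i => LinearEquiv.ext fun v => ?_), fun r' hr' => ?_⟩
    · simp [c.equivOf_apply, hr]
    · refine c.eq_of_eS_eq fun i v => ?_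
      rw [hr, ← hr']
      simp [c.equivOf_apply]
  HolAt s x := ∀ i, (Y.bun i).HolFrameAt (fun y => (s y).1 i) x
  exists_holAt x := by
    classical
    choose q hq hqi using exists_isometric_frames c hs Y
    -- The frames `q x` are isometric only near `x`; elsewhere any isometric frame will do, for
    -- instance that of `q y` at `y`.
    refine ⟨fun y => if h : _ then ⟨q x y, h⟩ else ⟨q y y, (hqi y).self_of_nhds⟩, fun i v => ?_⟩
    refine HolVB.HolAt.congr (hq x i v) ((hqi x).mono fun y hy => ?_)
    beta_reduce
    rw [dif_pos hy]
  eventually_holAt s x h := by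
    have := Q.finV
    exact Filter.eventually_all.2 fun i => (h i).eventually
  holAt_act_iff s x h g := by
    constructor
    · intro h'
      refine HolFunAt.of_comp_injective c.eS.toLinearMap c.eS.injective ?_
      have := Q.finV
      exact HolFunAt.pi fun i => HolFunAt.of_apply fun v => (h i).holAt_apply_iff.1 (h' i v)
    · exact fun h' i => (h i).trans (holFunAt_eS c h' i)

/-- A bundle with form is associated with its principal bundle of isometric frames. -/
noncomputable def framePrincipalAssociated [Module.Finite ℂ S]
    (hs : ∀ (c : ℂ) (a : S), star (c • a) = c • star a) (Y : FormBundle.{w} B X Q n) :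
    Associated c (framePrincipal c hs Y) Y where
  frame _ p i := p.1 i
  equivariant _ _ _ _ _ := rfl
  isometric _ p := p.2
  hol _ _ hs := hs

end FramePrincipal

/-! ### Contractions -/

section Contraction

variable {M : Type*} [AddCommGroup M] [Module ℂ M]
variable {F : Type*} [AddCommGroup F] [Module ℂ F]

/-- The contraction of the second factor of a tensor product with a linear functional. -/
noncomputable def contractRight (Z : Submodule ℂ M) :
    (Z ⊗[ℂ] F) →ₗ[ℂ] Module.Dual ℂ F →ₗ[ℂ] Z :=
  LinearMap.mk₂ ℂ (fun z ξ => TensorProduct.rid ℂ Z (TensorProduct.map LinearMap.id ξ z))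
    (fun z z' ξ => by simp) (fun a z ξ => by simp)
    (fun z ξ ξ' => by simp [TensorProduct.map_add_right])
    (fun a z ξ => by simp [TensorProduct.map_smul_right])

theorem contractRight_tmul (Z : Submodule ℂ M) (z : Z) (f : F) (ξ : Module.Dual ℂ F) :
    contractRight Z (z ⊗ₜ f) ξ = ξ f • z := by
  simp [contractRight]

theorem sum_contractRight {ι : Type*} [Fintype ι] (Z : Submodule ℂ M) (e : Module.Basis ι ℂ F)
    (z : Z ⊗[ℂ] F) : ∑ i, contractRight Z z (e.coord i) ⊗ₜ[ℂ] e i = z := by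
  induction z using TensorProduct.induction_on with
  | zero => simp
  | add a b ha hb =>
    conv_rhs => rw [← ha, ← hb]
    simp [TensorProduct.add_tmul, Finset.sum_add_distrib]
  | tmul z f =>
    simp only [contractRight_tmul, TensorProduct.smul_tmul, ← TensorProduct.tmul_sum]
    congr 1
    exact e.sum_repr f

variable {K : Type*} [Fintype K] (Z : K → Submodule ℂ M)

/-- The sum of the contractions of the components of a family of tensors. -/
noncomputable def contract : (∀ k, Z k ⊗[ℂ] F) →ₗ[ℂ] Module.Dual ℂ F →ₗ[ℂ] M :=
  LinearMap.mk₂ ℂ (fun z ξ => ∑ k, ((contractRight (Z k) (z k) ξ : Z k) : M))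
    (fun z z' ξ => by simp [Finset.sum_add_distrib])
    (fun a z ξ => by simp [Finset.smul_sum])
    (fun z ξ ξ' => by simp [Finset.sum_add_distrib])
    (fun a z ξ => by simp [Finset.smul_sum])

theorem contract_apply (z : ∀ k, Z k ⊗[ℂ] F) (ξ : Module.Dual ℂ F) :
    contract Z z ξ = ∑ k, ((contractRight (Z k) (z k) ξ : Z k) : M) := rfl

variable {Z}

/-- Independence separates the summands, and a tensor is recovered from its contractions with a dual
basis. -/
theorem contract_injective [FiniteDimensional ℂ F] (hZ : iSupIndep Z) :
    Function.Injective (contract (F := F) Z) := by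
  refine (injective_iff_map_eq_zero _).2 fun z hz => funext fun k => ?_
  let e := Module.finBasis ℂ F
  rw [← sum_contractRight (Z k) e (z k)]
  refine Finset.sum_eq_zero fun i _ => ?_
  have h := (iSupIndep_iff_finsetSum_eq_zero_imp_eq_zero Z).1 hZ Finset.univ
    (fun k => ((contractRight (Z k) (z k) (e.coord i) : Z k) : M)) (fun k _ => Subtype.property _)
    (LinearMap.congr_fun hz (e.coord i)) k (Finset.mem_univ k)
  rw [show contractRight (Z k) (z k) (e.coord i) = 0 from Subtype.ext h, TensorProduct.zero_tmul]

theorem exists_contract_eq [FiniteDimensional ℂ F] (ψ : Module.Dual ℂ F →ₗ[ℂ] M)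
    (hψ : ∀ ξ, ψ ξ ∈ ⨆ k, Z k) : ∃ z, contract Z z = ψ := by
  let e := Module.finBasis ℂ F
  have h : ∀ i, ∃ m : ∀ k, Z k, ∑ k, (m k : M) = ψ (e.coord i) := fun i => by
    have h1 : ψ (e.coord i) ∈ ⨆ k ∈ Finset.univ, Z k := by simpa using hψ (e.coord i)
    obtain ⟨μ, hμ⟩ := (Submodule.mem_iSup_finset_iff_exists_sum (s := Finset.univ) Z _).1 h1
    exact ⟨μ, hμ⟩
  choose m hm using h
  refine ⟨fun k => ∑ i, m i k ⊗ₜ e i, LinearMap.ext fun ξ => ?_⟩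
  have hξ : ξ = ∑ i, ξ (e i) • e.coord i := by
    refine e.ext fun i => ?_
    simp
  conv_rhs => rw [hξ, map_sum]
  simp only [map_smul, ← hm, contract_apply, map_sum, LinearMap.sum_apply, contractRight_tmul,
    Submodule.coe_sum, Submodule.coe_smul, Finset.smul_sum]
  exact Finset.sum_comm

theorem contract_mem (z : ∀ k, Z k ⊗[ℂ] F) (ξ : Module.Dual ℂ F) : contract Z z ξ ∈ ⨆ k, Z k :=
  Submodule.sum_mem _ fun k _ => Submodule.mem_iSup_of_mem k (Subtype.property _)

end Contraction

/-! ### The representation space -/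

section RepSpace

variable {S : Type*} [Ring S] [Algebra ℂ S] [StarRing S]
variable {M : Type*} [AddCommGroup M] [Module ℂ M] [Module S M] [Module Sᵐᵒᵖ M] [StarAddMonoid M]
variable {J : Type*} {P : J → Submodule ℂ M} {Q : Quiv} {n : Q.V → ℕ}

namespace Corresponds

variable (c : Corresponds (S := S) P Q n)

/-- Every arrow has the form `σ a`, and by nondegeneracy `star_mod` determines the component of
`star m` there. -/
theorem star_eq_iff (m : M) : star m = m ↔
    ∀ (a : Q.A) (v : Fin (n (Q.t a)) → ℂ) (w : Fin (n (Q.t (Q.σA a))) → ℂ),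
      c.C (Q.h a) (Q.t (Q.σA a)) (c.eM m a v) w =
        ((Q.εA a : ℤ) : ℂ) * c.C (Q.t a) (Q.h (Q.σA a)) v (c.eM m (Q.σA a) w) := by
  constructor
  · intro h a v w
    rw [c.star_mod, h]
  · intro h
    refine c.eM.injective (funext fun b => ?_)
    obtain ⟨a, rfl⟩ : ∃ a, b = Q.σA a := ⟨Q.σA b, (Q.σA_σA b).symm⟩
    refine LinearMap.ext fun w => ?_
    rw [← sub_eq_zero]
    refine c.isForm.nondeg_right (Q.σ_t a).symm fun v => ?_
    have h1 := (c.star_mod m a v w).symm.trans (h a v w)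
    have h0 : ((Q.εA a : ℤ) : ℂ) ≠ 0 := left_ne_zero_of_mul_eq_one (intUnits_cast_mul_self _)
    rw [map_sub, mul_left_cancel₀ h0 h1, sub_self]

theorem lab_σA (a : Q.A) : c.lab (Q.σA a) = c.lab a := ((c.lab_eq_iff _ _).2 (Or.inr rfl)).symm

theorem eq_of_eM_over {j : J} {m m' : M} (hm : m ∈ P j) (hm' : m' ∈ P j)
    (h : ∀ a : Over c.lab j, c.eM m a.1 = c.eM m' a.1) : m = m' := by
  refine c.eM.injective (funext fun a => ?_)
  by_cases ha : c.lab a = j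
  · exact h ⟨a, ha⟩
  · rw [(c.mem_iff m j).1 hm a ha, (c.mem_iff m' j).1 hm' a ha]

open scoped Classical in
/-- The element of the bimodule with given components on the orbit with label `j`. -/
noncomputable def extendOver (j : J) :
    (∀ a : Over c.lab j, (Fin (n (Q.t a.1)) → ℂ) →ₗ[ℂ] (Fin (n (Q.h a.1)) → ℂ)) →ₗ[ℂ] M :=
  c.eM.symm.toLinearMap ∘ₗ LinearMap.pi fun a =>
    if h : c.lab a = j then LinearMap.proj (⟨a, h⟩ : Over c.lab j) else 0

theorem eM_extendOver {j : J}
    (f : ∀ a : Over c.lab j, (Fin (n (Q.t a.1)) → ℂ) →ₗ[ℂ] (Fin (n (Q.h a.1)) → ℂ))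
    (a : Over c.lab j) : c.eM (c.extendOver j f) a.1 = f a := by
  simp [extendOver, a.2]

theorem eM_extendOver_of_ne {j : J}
    (f : ∀ a : Over c.lab j, (Fin (n (Q.t a.1)) → ℂ) →ₗ[ℂ] (Fin (n (Q.h a.1)) → ℂ))
    {a : Q.A} (ha : c.lab a ≠ j) : c.eM (c.extendOver j f) a = 0 := by
  simp [extendOver, ha]

theorem extendOver_mem {j : J}
    (f : ∀ a : Over c.lab j, (Fin (n (Q.t a.1)) → ℂ) →ₗ[ℂ] (Fin (n (Q.h a.1)) → ℂ)) :
    c.extendOver j f ∈ P j :=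
  (c.mem_iff _ j).2 fun _ ha => c.eM_extendOver_of_ne f ha

theorem star_extendOver {j : J}
    (f : ∀ a : Over c.lab j, (Fin (n (Q.t a.1)) → ℂ) →ₗ[ℂ] (Fin (n (Q.h a.1)) → ℂ))
    (hf : ∀ (a : Over c.lab j) v w, c.C (Q.h a.1) (Q.t (Q.σA a.1)) (f a v) w =
      ((Q.εA a.1 : ℤ) : ℂ) * c.C (Q.t a.1) (Q.h (Q.σA a.1)) v (f (c.flip a) w)) :
    star (c.extendOver j f) = c.extendOver j f := by
  rw [c.star_eq_iff]
  intro a v w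
  by_cases ha : c.lab a = j
  · have h1 := c.eM_extendOver f ⟨a, ha⟩
    have h2 := c.eM_extendOver f (c.flip ⟨a, ha⟩)
    have h3 := hf ⟨a, ha⟩ v w
    rw [← h1, ← h2] at h3
    exact h3
  · rw [c.eM_extendOver_of_ne f ha, c.eM_extendOver_of_ne f (by rwa [c.lab_σA])]
    simp

variable [SMulCommClass S ℂ M] [SMulCommClass Sᵐᵒᵖ ℂ M]

theorem eM_conjAct (r : StrGroup S) (m : M) (a : Q.A) (v : Fin (n (Q.t a)) → ℂ) :
    c.eM (conjAct r m) a (c.eS r.coord (Q.t a) v) = c.eS r.coord (Q.h a) (c.eM m a v) := by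
  have : c.eM (conjAct r m) a = c.eS r.coord (Q.h a) ∘ₗ (c.eM m a ∘ₗ c.eS (r⁻¹).coord (Q.t a)) := by
    rw [← c.right, ← c.left]
    rfl
  rw [this, LinearMap.comp_apply, LinearMap.comp_apply, c.eS_inv_mul]

end Corresponds

variable [SMulCommClass S ℂ M] [SMulCommClass Sᵐᵒᵖ ℂ M] {hD : IsDualmod S M}
  {K : J → Type*} {Z : ∀ j, K j → Submodule ℂ M}

namespace IsRepDecomposition

theorem indep_apply (hZ : IsRepDecomposition hD P Z) (j : J) : iSupIndep (Z j) :=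
  hZ.indep.comp (f := fun k => (⟨j, k⟩ : Sigma K)) fun _ _ h => eq_of_heq (Sigma.mk.inj h).2

/-- The `Z j k` for fixed `j` fill `D(M) ∩ P j`: the part of `m` in the `Z i k` with `i ≠ j` also
lies in `P j`, hence vanishes by independence of the `P i`. -/
theorem mem_iSup (hZ : IsRepDecomposition hD P Z) (hP : iSupIndep P) {j : J} {m : M}
    (hm : m ∈ P j) (hst : star m = m) : m ∈ ⨆ k, Z j k := by
  have h1 : m ∈ (⨆ k, Z j k) ⊔ ⨆ (i) (_ : i ≠ j), ⨆ k, Z i k := by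
    have h2 : m ∈ ⨆ p : Sigma K, Z p.1 p.2 := by rw [hZ.top]; exact hst
    refine (iSup_le fun p => ?_ : (⨆ p : Sigma K, Z p.1 p.2) ≤ _) h2
    by_cases h : p.1 = j
    · obtain ⟨i, k⟩ := p
      change i = j at h
      subst h
      exact le_sup_of_le_left (le_iSup (Z i) k)
    · exact le_sup_of_le_right (le_iSup₂_of_le p.1 h (le_iSup (Z p.1) p.2))
  obtain ⟨a, ha, b, hb, hab⟩ := Submodule.mem_sup.1 h1
  have hle : ∀ i, ⨆ k, Z i k ≤ P i := fun i => iSup_le (hZ.le i)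
  have hb' : b ∈ P j := by
    rw [← eq_sub_iff_add_eq'] at hab
    rw [hab]
    exact (P j).sub_mem hm (hle j ha)
  have hb0 : b = 0 := by
    have := (hP j).le_bot ⟨hb', (iSup₂_mono fun i _ => hle i) hb⟩
    simpa using this
  rw [hb0, add_zero] at hab
  exact hab ▸ ha

theorem star_eq (hZ : IsRepDecomposition hD P Z) {j : J} {m : M} (hm : m ∈ ⨆ k, Z j k) :
    star m = m := by
  have h : (⨆ k, Z j k) ≤ selfDual hD := by
    rw [← hZ.top]
    exact iSup_le fun k => le_iSup (fun p : Sigma K => Z p.1 p.2) ⟨j, k⟩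
  exact h hm

theorem mem_P (hZ : IsRepDecomposition hD P Z) {j : J} {m : M} (hm : m ∈ ⨆ k, Z j k) : m ∈ P j :=
  (iSup_le (hZ.le j) : ⨆ k, Z j k ≤ P j) hm

variable {F : Type*} [AddCommGroup F] [Module ℂ F]

theorem contract_map [∀ j, Fintype (K j)] (hZ : IsRepDecomposition hD P Z) {j : J} (r : StrGroup S)
    (g : F ≃ₗ[ℂ] F) (z : ∀ k, Z j k ⊗[ℂ] F) (ξ : Module.Dual ℂ F) :
    contract (Z j) (fun k => TensorProduct.map (hZ.act j k r) g.toLinearMap (z k)) ξ =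
      conjAct r (contract (Z j) z (ξ ∘ₗ g.toLinearMap)) := by
  rw [contract_apply, contract_apply, map_sum]
  refine Finset.sum_congr rfl fun k _ => ?_
  have h : contractRight (Z j k) (TensorProduct.map (hZ.act j k r) g.toLinearMap (z k)) ξ =
      hZ.act j k r (contractRight (Z j k) (z k) (ξ ∘ₗ g.toLinearMap)) := by
    induction z k using TensorProduct.induction_on with
    | zero => simp
    | add a b ha hb => simp only [map_add, LinearMap.add_apply, ha, hb]
    | tmul z f => simp [contractRight_tmul]
  rw [h]
  rfl

end IsRepDecomposition

end RepSpace

/-! ### Frames of the dual bundle -/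

section DualFrame

variable {B : Type*} [NormedAddCommGroup B] [NormedSpace ℂ B]
variable {X : Type*} [TopologicalSpace X] [ChartedSpace B X]
variable {F : Type*} [NormedAddCommGroup F] [NormedSpace ℂ F] [FiniteDimensional ℂ F]

namespace HolVB

variable (N : HolVB.{w} B X F)

/-- The trivialization at `x` is a homeomorphism of the fibre with the finite-dimensional `F`. Thus
the fibre of `dual` is the full algebraic dual. -/
theorem continuous_functional {x : X} (l : N.fib x →ₗ[ℂ] ℂ) : Continuous l := by
  let e := (trivializationAt F N.fib x).continuousLinearEquivAt ℂ x
    (FiberBundle.mem_baseSet_trivializationAt' x)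
  have h : Continuous (l ∘ₗ e.symm.toLinearEquiv.toLinearMap) :=
    LinearMap.continuous_of_finiteDimensional _
  have h2 := h.comp e.continuous
  refine h2.congr fun v => ?_
  simp

/-- The frame of the dual bundle which is dual to a frame. -/
noncomputable def dualFrame {x : X} (q : F ≃ₗ[ℂ] N.fib x) :
    Module.Dual ℂ F ≃ₗ[ℂ] N.dual.fib x where
  toFun ξ := (⟨ξ ∘ₗ q.symm.toLinearMap, N.continuous_functional _⟩ : N.fib x →L[ℂ] ℂ)
  map_add' _ _ := rfl
  map_smul' _ _ := rfl
  invFun ξ := (show N.fib x →L[ℂ] ℂ from ξ).toLinearMap ∘ₗ q.toLinearMap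
  left_inv ξ := by
    ext v
    simp
  right_inv ξ := by
    refine ContinuousLinearMap.ext (M₁ := N.fib x) (M₂ := ℂ) fun v => ?_
    simp
    rfl

theorem dualFrame_trans {x : X} (q : F ≃ₗ[ℂ] N.fib x) (g : F ≃ₗ[ℂ] F) (ξ : Module.Dual ℂ F) :
    N.dualFrame (g.trans q) (ξ ∘ₗ g.toLinearMap) = N.dualFrame q ξ := by
  rw [← LinearEquiv.eq_symm_apply]
  ext v
  change ξ (g v) = ξ (q.symm (q (g v)))
  simp

variable {N}

theorem HolFrameAt.dualFrame_holAt {x : X} {q : ∀ y, F ≃ₗ[ℂ] N.fib y} (hq : N.HolFrameAt q x)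
    (ξ : Module.Dual ℂ F) : N.dual.HolAt (fun y => N.dualFrame (q y) ξ) x := by
  refine hq.dual_holAt_iff.2 fun v => (HolFunAt.const (ξ v)).congr
    (Filter.Eventually.of_forall fun y => ?_)
  change ξ ((q y).symm (q y v)) = ξ v
  simp

theorem HolFrameAt.holFunAt_dualFrame_symm {x : X} {q : ∀ y, F ≃ₗ[ℂ] N.fib y}
    (hq : N.HolFrameAt q x) {m : ∀ y, N.dual.fib y} (hm : N.dual.HolAt m x) :
    HolFunAt B (fun y => (N.dualFrame (q y)).symm (m y)) x :=
  HolFunAt.of_apply (hq.dual_holAt_iff.1 hm)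

end HolVB

end DualFrame

/-! ### Sections and morphisms -/

section Induced

variable {S : Type*} [Ring S] [Algebra ℂ S] [StarRing S]
variable {M : Type*} [AddCommGroup M] [Module ℂ M] [Module S M]
  [Module Sᵐᵒᵖ M] [StarAddMonoid M] [SMulCommClass S ℂ M] [SMulCommClass Sᵐᵒᵖ ℂ M]
variable {hD : IsDualmod S M} {J : Type*} {P : J → Submodule ℂ M} {K : J → Type*}
  [∀ j, Fintype (K j)] {Z : ∀ j, K j → Submodule ℂ M} {hZ : IsRepDecomposition hD P Z}
  {Q : Quiv} {n : Q.V → ℕ} {c : Corresponds (S := S) P Q n}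
variable {B : Type*} [NormedAddCommGroup B] [NormedSpace ℂ B]
variable {X : Type*} [TopologicalSpace X] [ChartedSpace B X]
variable {F : J → Type*} [∀ j, NormedAddCommGroup (F j)] [∀ j, NormedSpace ℂ (F j)]
  [∀ j, FiniteDimensional ℂ (F j)] {N : ∀ j, HolVB.{v} B X (F j)}

namespace TwistedSection

variable {E : PrincipalBundle.{w} B X (StrGroup.coord S)}

/-- The contraction of the values of a section with vectors of the dual bundle. -/
noncomputable def pairing (s : TwistedSection hZ E N) {x : X} (p : E.fib x)
    (q : ∀ j, F j ≃ₗ[ℂ] (N j).fib x) (j : J) : (N j).dual.fib x →ₗ[ℂ] M :=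
  contract (Z j) (s.toFun x p q j) ∘ₗ ((N j).dualFrame (q j)).symm.toLinearMap

theorem pairing_mem (s : TwistedSection hZ E N) {x : X} (p : E.fib x)
    (q : ∀ j, F j ≃ₗ[ℂ] (N j).fib x) (j : J) (ξ : (N j).dual.fib x) :
    s.pairing p q j ξ ∈ ⨆ k, Z j k := contract_mem _ _

/-- A change of the frame `q` cancels in the contraction; only the action of `R` remains. -/
theorem pairing_act (s : TwistedSection hZ E N) {x : X} (p p' : E.fib x)
    (q q' : ∀ j, F j ≃ₗ[ℂ] (N j).fib x) (j : J) (ξ : (N j).dual.fib x) :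
    s.pairing p q j ξ = conjAct (E.div p p') (s.pairing p' q' j ξ) := by
  have hp := E.act_div p p'
  obtain ⟨g, rfl⟩ : ∃ g : ∀ j, F j ≃ₗ[ℂ] F j, q' = fun j => (g j).trans (q j) :=
    ⟨fun j => (q' j).trans (q j).symm, funext fun j => by ext v; simp⟩
  have h1 := s.equivariant x p q (E.div p p') g j
  rw [hp] at h1
  change contract (Z j) (s.toFun x p q j) (((N j).dualFrame (q j)).symm ξ) = _
  rw [← funext h1, IsRepDecomposition.contract_map]
  rfl

theorem toFun_eq_of_pairing_eq {E' : PrincipalBundle.{w} B X (StrGroup.coord S)}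
    {s : TwistedSection hZ E N} {s' : TwistedSection hZ E' N} {x : X} {p : E.fib x} {p' : E'.fib x}
    {q : ∀ j, F j ≃ₗ[ℂ] (N j).fib x} (h : ∀ j, s.pairing p q j = s'.pairing p' q j) :
    s.toFun x p q = s'.toFun x p' q := by
  refine funext fun j => contract_injective (hZ.indep_apply j) (LinearMap.ext fun ξ => ?_)
  have := LinearMap.congr_fun (h j) ((N j).dualFrame (q j) ξ)
  simpa [pairing] using this

end TwistedSection

namespace Associated

variable {E : PrincipalBundle.{w} B X (StrGroup.coord S)} {Y : FormBundle.{w} B X Q n}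
  (θ : Associated c E Y)

theorem induces_iff {s : TwistedSection hZ E N}
    {φ : SupermixedMorphisms c Y (fun j => (N j).dual)} : θ.Induces s φ ↔
    ∀ x (p : E.fib x) (q : ∀ j, F j ≃ₗ[ℂ] (N j).fib x) (j : J) (a : Over c.lab j)
      (v : Fin (n (Q.t a.1)) → ℂ) (ξ : (N j).dual.fib x),
      φ.toFun x j a (θ.frame x p (Q.t a.1) v ⊗ₜ[ℂ] ξ) =
        θ.frame x p (Q.h a.1) (c.eM (s.pairing p q j ξ) a.1 v) := Iff.rfl

/-- The morphism along an arrow which belongs to a section, in terms of a point of the principal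
bundle and frames of the twisting bundles. -/
noncomputable def morphismAt (s : TwistedSection hZ E N) {x : X} (p : E.fib x)
    (q : ∀ j, F j ≃ₗ[ℂ] (N j).fib x) {j : J} (a : Over c.lab j) :
    (Y.bun (Q.t a.1)).fib x ⊗[ℂ] (N j).dual.fib x →ₗ[ℂ] (Y.bun (Q.h a.1)).fib x :=
  TensorProduct.lift (LinearMap.mk₂ ℂ
    (fun y ξ => θ.frame x p (Q.h a.1) (c.eM (s.pairing p q j ξ) a.1
      ((θ.frame x p (Q.t a.1)).symm y)))
    (fun y y' ξ => by simp only [map_add]) (fun b y ξ => by simp only [map_smul])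
    (fun y ξ ξ' => by simp only [map_add, Pi.add_apply, LinearMap.add_apply])
    (fun b y ξ => by simp only [map_smul, Pi.smul_apply, LinearMap.smul_apply]))

/-- The conjugation in `pairing_act` is compensated by `[p r, v] = [p, r v]` at the tail and at the
head. The morphism is thus independent of `p` and `q`, and can be computed in local holomorphic
sections. -/
theorem morphismAt_frame (s : TwistedSection hZ E N) {x : X} (p p' : E.fib x)
    (q q' : ∀ j, F j ≃ₗ[ℂ] (N j).fib x) {j : J} (a : Over c.lab j)
    (v : Fin (n (Q.t a.1)) → ℂ) (ξ : (N j).dual.fib x) :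
    θ.morphismAt s p q a (θ.frame x p' (Q.t a.1) v ⊗ₜ[ℂ] ξ) =
      θ.frame x p' (Q.h a.1) (c.eM (s.pairing p' q' j ξ) a.1 v) := by
  have h : θ.morphismAt s p q a (θ.frame x p' (Q.t a.1) v ⊗ₜ[ℂ] ξ) =
      θ.frame x p (Q.h a.1) (c.eM (s.pairing p q j ξ) a.1
        ((θ.frame x p (Q.t a.1)).symm (θ.frame x p' (Q.t a.1) v))) := rfl
  have h2 : ∀ i w, θ.frame x p' i w = θ.frame x p i (c.eS (E.div p p').coord i w) := fun i w => by
    rw [← θ.equivariant, E.act_div]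
  rw [h, h2, h2, LinearEquiv.symm_apply_apply, s.pairing_act p p' q q', c.eM_conjAct]

theorem exists_induces [Module.Finite ℂ M] (s : TwistedSection hZ E N) :
    ∃ φ : SupermixedMorphisms c Y (fun j => (N j).dual), θ.Induces s φ := by
  refine ⟨⟨fun x j a => θ.morphismAt s (E.localSection x x) (fun j => (N j).localFrame x x) a,
    fun j a f m x hf hm => ?_, fun x j a y y' m => ?_⟩, θ.induces_iff.2 fun x p q j a v ξ =>
      θ.morphismAt_frame s _ p _ q a v ξ⟩
  · have hs := E.holAt_localSection x
    have hq : ∀ j, (N j).HolFrameAt (fun y => (N j).localFrame x y) x := fun j =>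
      HolVB.holFrameAt_localFrame x
    have hz : HolFunAt B (fun y => s.toFun y (E.localSection x y)
        (fun j => (N j).localFrame x y) j) x := HolFunAt.pi (s.hol _ _ x hs hq j)
    have h1 := hz.bilinear (contract (Z j)) ((hq j).holFunAt_dualFrame_symm hm)
    have h2 := (h1.comp_linear c.eM.toLinearMap).comp_linear (LinearMap.proj a.1)
    have h3 := h2.apply ((θ.hol _ x hs (Q.t a.1)).holAt_iff.1 hf)
    refine ((θ.hol _ x hs (Q.h a.1)).holAt_apply_iff.2 h3).congr
      (Filter.Eventually.of_forall fun y => ?_)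
    -- The morphism at `y` is defined by choices which vary with `y` without any regularity; they
    -- are exchanged for the ones that are holomorphic near `x`.
    have h4 := θ.morphismAt_frame s (E.localSection y y) (E.localSection x y)
      (fun j => (N j).localFrame y y) (fun j => (N j).localFrame x y) a
      ((θ.frame y (E.localSection x y) (Q.t a.1)).symm (f y)) (m y)
    rw [LinearEquiv.apply_symm_apply] at h4
    exact h4
  · obtain ⟨v, rfl⟩ := (θ.frame x (E.localSection x x) _).surjective y
    obtain ⟨w, rfl⟩ := (θ.frame x (E.localSection x x) _).surjective y'
    have h1 := θ.morphismAt_frame s (E.localSection x x) (E.localSection x x)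
      (fun j => (N j).localFrame x x) (fun j => (N j).localFrame x x) a v m
    have h2 := θ.morphismAt_frame s (E.localSection x x) (E.localSection x x)
      (fun j => (N j).localFrame x x) (fun j => (N j).localFrame x x) (c.flip a) w m
    have h3 := (c.star_eq_iff _).1 (hZ.star_eq (s.pairing_mem (E.localSection x x)
      (fun j => (N j).localFrame x x) j m)) a.1 v w
    rw [h1, θ.isometric, h3]
    refine congrArg _ (Eq.trans ?_ (congrArg (Y.form x (Q.t a.1) (Q.h (Q.σA a.1)) _) h2.symm))
    exact (θ.isometric _ _ _ _ _ _).symm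

theorem eq_of_induces_left {s : TwistedSection hZ E N}
    {φ φ' : SupermixedMorphisms c Y (fun j => (N j).dual)} (h : θ.Induces s φ)
    (h' : θ.Induces s φ') : φ = φ' := by
  refine SupermixedMorphisms.ext (funext fun x => funext fun j => funext fun a =>
    TensorProduct.ext' fun y ξ => ?_)
  obtain ⟨v, rfl⟩ := (θ.frame x (E.localSection x x) _).surjective y
  have q : ∀ j, F j ≃ₗ[ℂ] (N j).fib x := fun j => (N j).localFrame x x
  exact (θ.induces_iff.1 h x _ q j a v ξ).trans (θ.induces_iff.1 h' x _ q j a v ξ).symm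

/-- The morphisms on the orbit `j` determine the contractions of `s`, as these lie in `P j`, and the
contractions determine `s`. -/
theorem eq_of_induces_right {s s' : TwistedSection hZ E N}
    {φ : SupermixedMorphisms c Y (fun j => (N j).dual)} (h : θ.Induces s φ)
    (h' : θ.Induces s' φ) : s = s' := by
  refine TwistedSection.ext (funext fun x => funext fun p => funext fun q =>
    TwistedSection.toFun_eq_of_pairing_eq fun j => LinearMap.ext fun ξ => ?_)
  refine c.eq_of_eM_over (hZ.mem_P (s.pairing_mem p q j ξ)) (hZ.mem_P (s'.pairing_mem p q j ξ))
    fun a => LinearMap.ext fun v => (θ.frame x p (Q.h a.1)).injective ?_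
  exact (θ.induces_iff.1 h x p q j a v ξ).symm.trans (θ.induces_iff.1 h' x p q j a v ξ)

/-- The elements of the bimodule which belong to a family of morphisms, in terms of a point of the
principal bundle and frames of the twisting bundles. -/
noncomputable def elementAt (φ : SupermixedMorphisms c Y (fun j => (N j).dual)) {x : X}
    (p : E.fib x) (j : J) (q : F j ≃ₗ[ℂ] (N j).fib x) : Module.Dual ℂ (F j) →ₗ[ℂ] M :=
  c.extendOver j ∘ₗ LinearMap.pi fun a => LinearMap.mk₂ ℂ
    (fun ξ v => (θ.frame x p (Q.h a.1)).symm
      (φ.toFun x j a (θ.frame x p (Q.t a.1) v ⊗ₜ (N j).dualFrame q ξ)))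
    (fun ξ ξ' v => by simp only [map_add, TensorProduct.tmul_add])
    (fun b ξ v => by simp only [map_smul, TensorProduct.tmul_smul])
    (fun ξ v v' => by simp only [map_add, TensorProduct.add_tmul])
    (fun b ξ v => by simp only [map_smul, TensorProduct.smul_tmul, TensorProduct.tmul_smul])

theorem eM_elementAt (φ : SupermixedMorphisms c Y (fun j => (N j).dual)) {x : X}
    (p : E.fib x) (j : J) (q : F j ≃ₗ[ℂ] (N j).fib x) (ξ : Module.Dual ℂ (F j))
    (a : Over c.lab j) (v : Fin (n (Q.t a.1)) → ℂ) :
    c.eM (θ.elementAt φ p j q ξ) a.1 v = (θ.frame x p (Q.h a.1)).symm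
      (φ.toFun x j a (θ.frame x p (Q.t a.1) v ⊗ₜ (N j).dualFrame q ξ)) := by
  rw [elementAt, LinearMap.comp_apply, c.eM_extendOver]
  rfl

/-- Extension by zero lands in `P j`, and in an isometric frame the supermixed condition on `φ`
becomes selfduality. -/
theorem elementAt_mem (hZ : IsRepDecomposition hD P Z) (hP : iSupIndep P)
    (φ : SupermixedMorphisms c Y (fun j => (N j).dual)) {x : X}
    (p : E.fib x) (j : J) (q : F j ≃ₗ[ℂ] (N j).fib x) (ξ : Module.Dual ℂ (F j)) :
    θ.elementAt φ p j q ξ ∈ ⨆ k, Z j k := by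
  refine hZ.mem_iSup hP (c.extendOver_mem _) (c.star_extendOver _ fun a v w => ?_)
  have h1 := φ.supermixed x j a (θ.frame x p _ v) (θ.frame x p _ w) ((N j).dualFrame q ξ)
  change c.C _ _ ((θ.frame x p _).symm _) _ = _ * c.C _ _ _ ((θ.frame x p _).symm _)
  rw [← θ.isometric x p, ← θ.isometric x p, LinearEquiv.apply_symm_apply]
  refine h1.trans (congrArg _ (congrArg _ ?_))
  exact ((θ.frame x p _).apply_symm_apply _).symm

theorem eM_conjAct_elementAt {φ : SupermixedMorphisms c Y (fun j => (N j).dual)} {x : X}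
    (p : E.fib x) (j : J) (q : F j ≃ₗ[ℂ] (N j).fib x) (r : StrGroup S) (g : F j ≃ₗ[ℂ] F j)
    (ξ : Module.Dual ℂ (F j)) (a : Over c.lab j) :
    c.eM (conjAct r (θ.elementAt φ (E.act p r) j (g.trans q) (ξ ∘ₗ g.toLinearMap))) a.1 =
      c.eM (θ.elementAt φ p j q ξ) a.1 := by
  refine LinearMap.ext fun v => ?_
  obtain ⟨v, rfl⟩ := (c.equivOf r _).surjective v
  rw [c.equivOf_apply, c.eM_conjAct, eM_elementAt, eM_elementAt, (N j).dualFrame_trans,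
    θ.equivariant, LinearEquiv.eq_symm_apply, ← θ.equivariant, LinearEquiv.apply_symm_apply]

theorem holFunAt_elementAt (φ : SupermixedMorphisms c Y (fun j => (N j).dual)) {x : X}
    {s : ∀ y, E.fib y} (hs : E.HolAt s x) (j : J) {q : ∀ y, F j ≃ₗ[ℂ] (N j).fib y}
    (hq : (N j).HolFrameAt q x) : HolFunAt B (fun y => θ.elementAt φ (s y) j (q y)) x := by
  have := Q.finA
  refine HolFunAt.of_apply fun ξ => HolFunAt.comp_linear (HolFunAt.pi fun a =>
    HolFunAt.of_apply fun v => ?_) (c.extendOver j)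
  exact (θ.hol s x hs (Q.h a.1)).holAt_iff.1
    (φ.hol j a _ _ x (θ.hol s x hs (Q.t a.1) v) (hq.dualFrame_holAt ξ))

theorem exists_induced [Module.Finite ℂ M] (hP : iSupIndep P)
    (φ : SupermixedMorphisms c Y (fun j => (N j).dual)) :
    ∃ s : TwistedSection hZ E N, θ.Induces s φ := by
  -- A fixed linear left inverse of the contraction preserves holomorphy; on the values of
  -- `elementAt`, which lie in the range, it is a two-sided inverse.
  have hL : ∀ j, ∃ L : (Module.Dual ℂ (F j) →ₗ[ℂ] M) →ₗ[ℂ] (∀ k, Z j k ⊗[ℂ] F j),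
      L ∘ₗ contract (Z j) = LinearMap.id := fun j =>
    LinearMap.exists_leftInverse_of_injective _
      (LinearMap.ker_eq_bot.2 (contract_injective (hZ.indep_apply j)))
  choose L hL using hL
  have hc : ∀ {x} (p : E.fib x) (j : J) (q : F j ≃ₗ[ℂ] (N j).fib x),
      contract (Z j) (L j (θ.elementAt φ p j q)) = θ.elementAt φ p j q := fun p j q => by
    obtain ⟨z, hz⟩ := exists_contract_eq _ (θ.elementAt_mem hZ hP φ p j q)
    rw [← hz]
    exact congrArg _ (LinearMap.congr_fun (hL j) z)
  refine ⟨⟨fun x p q j => L j (θ.elementAt φ p j (q j)), fun x p q r g j => ?_,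
    fun s q x hs hq j k => ?_⟩, θ.induces_iff.2 fun x p q j a v ξ => ?_⟩
  · refine congrFun (contract_injective (hZ.indep_apply j) (LinearMap.ext fun ξ => ?_))
    have h1 := hZ.contract_map r (g j)
      (L j (θ.elementAt φ (E.act p r) j ((g j).trans (q j)))) ξ
    refine c.eq_of_eM_over (hZ.mem_P (contract_mem _ _)) (hZ.mem_P (contract_mem _ _)) fun a => ?_
    rw [h1, hc, hc, eM_conjAct_elementAt]
  · exact ((θ.holFunAt_elementAt φ hs j (hq j)).comp_linear (L j)).comp_linear (LinearMap.proj k)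
  · have h1 : contract (Z j) (L j (θ.elementAt φ p j (q j))) (((N j).dualFrame (q j)).symm ξ) =
        θ.elementAt φ p j (q j) (((N j).dualFrame (q j)).symm ξ) := by rw [hc]
    refine Eq.trans ?_ (congrArg (fun m => θ.frame x p (Q.h a.1) (c.eM m a.1 v)) h1.symm)
    rw [eM_elementAt, LinearEquiv.apply_symm_apply, LinearEquiv.apply_symm_apply]

/-- The bijection between sections and families of morphisms. -/
noncomputable def sectionEquiv [Module.Finite ℂ M] (hP : iSupIndep P) :
    TwistedSection hZ E N ≃ SupermixedMorphisms c Y (fun j => (N j).dual) where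
  toFun s := (θ.exists_induces s).choose
  invFun φ := (θ.exists_induced hP φ).choose
  left_inv s := θ.eq_of_induces_right (θ.exists_induced hP _).choose_spec
    (θ.exists_induces s).choose_spec
  right_inv φ := θ.eq_of_induces_left (θ.exists_induces _).choose_spec
    (θ.exists_induced hP φ).choose_spec

theorem induces_sectionEquiv [Module.Finite ℂ M] (hP : iSupIndep P) (s : TwistedSection hZ E N) :
    θ.Induces s (θ.sectionEquiv hP s) := (θ.exists_induces s).choose_spec

end Associated

end Induced

/-! ### Isomorphisms -/

section Isomorphisms

variable {S : Type*} [Ring S] [Algebra ℂ S] [StarRing S]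
variable {M : Type*} [AddCommGroup M] [Module ℂ M] [Module S M]
  [Module Sᵐᵒᵖ M] [StarAddMonoid M]
variable {J : Type*} {P : J → Submodule ℂ M} {Q : Quiv} {n : Q.V → ℕ}
  {c : Corresponds (S := S) P Q n}
variable {B : Type*} [NormedAddCommGroup B] [NormedSpace ℂ B]
variable {X : Type*} [TopologicalSpace X] [ChartedSpace B X]

section Single

variable {E : PrincipalBundle.{w} B X (StrGroup.coord S)} {Y : FormBundle.{w} B X Q n}
  (θ : Associated c E Y)

namespace Associated

theorem frame_injective {x : X} {p p' : E.fib x}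
    (h : ∀ i v, θ.frame x p i v = θ.frame x p' i v) : p = p' := by
  have h1 : E.div p p' = 1 := c.eq_of_eS_eq fun i v => (θ.frame x p i).injective (by
    rw [← θ.equivariant, E.act_div, ← θ.equivariant, E.act_one, h])
  rw [← E.act_div p p', h1, E.act_one]

theorem exists_frame_eq {x : X} (q : ∀ i, (Fin (n i) → ℂ) ≃ₗ[ℂ] (Y.bun i).fib x)
    (hq : ∀ i j v w, Y.form x i j (q i v) (q j w) = c.C i j v w) :
    ∃ p, ∀ i v, θ.frame x p i v = q i v := by
  obtain ⟨p⟩ : Nonempty (E.fib x) := ⟨E.localSection x x⟩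
  obtain ⟨r, hr⟩ := c.exists_of_isometric (fun i => (q i).trans (θ.frame x p i).symm)
    fun i j v w => by
      rw [← θ.isometric x p]
      simp [hq]
  exact ⟨E.act p r, fun i v => by simp [θ.equivariant, hr]⟩

/-- With `frame_injective` and `exists_frame_eq`, this identifies `E` with the isometric frames of
`Y`, holomorphic structure included: relative to a local section, `s` is a map to `R`, and `eS` is
injective on coordinates. -/
theorem holAt_iff {s : ∀ x, E.fib x} {x : X} :
    E.HolAt s x ↔ ∀ i, (Y.bun i).HolFrameAt (fun y => θ.frame y (s y) i) x := by
  refine ⟨θ.hol s x, fun h => ?_⟩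
  have h0 := E.holAt_localSection x
  have h1 : E.HolAt (fun y => E.act (E.localSection x y) (E.div (E.localSection x y) (s y))) x := by
    refine (E.holAt_act_iff _ x h0 _).2
      (HolFunAt.of_comp_injective c.eS.toLinearMap c.eS.injective ?_)
    have := Q.finV
    refine HolFunAt.pi fun i => HolFunAt.of_apply fun v =>
      (θ.hol _ x h0 i).holAt_apply_iff.1 ((h i v).congr (Filter.Eventually.of_forall fun y => ?_))
    refine (θ.equivariant _ _ _ _ _).symm.trans ?_
    rw [E.act_div]
  simpa only [E.act_div] using h1

end Associated

end Single

variable {E E' : PrincipalBundle.{w} B X (StrGroup.coord S)} {Y Y' : FormBundle.{w} B X Q n}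

namespace Associated

variable (θ : Associated c E Y) (θ' : Associated c E' Y')

/-- The isomorphism of bundles with form which is induced by an isomorphism of principal
bundles. -/
noncomputable def formIso (u : PrincipalIso E E') : FormIso Y Y' where
  toFun x i := (θ.frame x (E.localSection x x) i).symm.trans
    (θ'.frame x (u.toFun x (E.localSection x x)) i)
  isometric x i j v v' := by
    simp only [LinearEquiv.trans_apply, θ'.isometric]
    rw [← θ.isometric x (E.localSection x x)]
    simp
  hol i f x hf := by
    have hs := E.holAt_localSection x
    refine ((θ'.hol _ x (u.hol _ x hs) i).holAt_apply_iff.2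
      ((θ.hol _ x hs i).holAt_iff.1 hf)).congr (Filter.Eventually.of_forall fun y => ?_)
    -- By equivariance the base point at `y` may be replaced by the value of the section that is
    -- holomorphic near `x`.
    have h1 := u.equivariant y (E.localSection x y) (E.div (E.localSection x y)
      (E.localSection y y))
    rw [E.act_div] at h1
    simp only [LinearEquiv.trans_apply]
    rw [h1, θ'.equivariant]
    refine congrArg _ ((θ.frame y (E.localSection x y) i).injective ?_)
    rw [← θ.equivariant, E.act_div, LinearEquiv.apply_symm_apply, LinearEquiv.apply_symm_apply]

theorem formIso_frame (u : PrincipalIso E E') (x : X) (p : E.fib x) (i : Q.V)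
    (v : Fin (n i) → ℂ) :
    (θ.formIso θ' u).toFun x i (θ.frame x p i v) = θ'.frame x (u.toFun x p) i v := by
  obtain ⟨r, rfl⟩ : ∃ r, p = E.act (E.localSection x x) r := ⟨_, (E.act_div _ p).symm⟩
  rw [u.equivariant, θ.equivariant, θ'.equivariant]
  simp [formIso]

/-- An isometry takes isometric frames to isometric frames, and these are the points of `E` and
`E'`. -/
theorem exists_principalIso (f : FormIso Y Y') :
    ∃ u : PrincipalIso E E', θ.formIso θ' u = f := by
  have h : ∀ x (p : E.fib x), ∃ p' : E'.fib x, ∀ i v, θ'.frame x p' i v =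
      f.toFun x i (θ.frame x p i v) := fun x p =>
    θ'.exists_frame_eq (fun i => (θ.frame x p i).trans (f.toFun x i)) fun i j v w => by
      simp [f.isometric, θ.isometric]
  choose u hu using h
  refine ⟨⟨u, fun x p r => θ'.frame_injective fun i v => ?_, fun s x hs => ?_⟩, ?_⟩
  · rw [hu, θ.equivariant, θ'.equivariant, hu]
  · refine θ'.holAt_iff.2 fun i v => ?_
    simp only [hu]
    exact f.hol i _ x (θ.hol s x hs i v)
  · refine FormIso.ext (funext fun x => funext fun i => LinearEquiv.ext fun y => ?_)
    obtain ⟨v, rfl⟩ := (θ.frame x (E.localSection x x) i).surjective y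
    rw [formIso_frame, hu]

theorem formIso_injective : Function.Injective (θ.formIso θ') := fun u u' h => by
  refine PrincipalIso.ext (funext fun x => funext fun p => θ'.frame_injective fun i v => ?_)
  rw [← formIso_frame θ, ← formIso_frame θ, h]

/-- The bijection between isomorphisms of principal bundles and isomorphisms of bundles with
form. -/
noncomputable def isoEquiv : PrincipalIso E E' ≃ FormIso Y Y' :=
  Equiv.ofBijective (θ.formIso θ') ⟨θ.formIso_injective θ', θ.exists_principalIso θ'⟩

variable [SMulCommClass S ℂ M] [SMulCommClass Sᵐᵒᵖ ℂ M]
variable {hD : IsDualmod S M} {K : J → Type*}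
  [∀ j, Fintype (K j)] {Z : ∀ j, K j → Submodule ℂ M} {hZ : IsRepDecomposition hD P Z}
variable {F : J → Type*} [∀ j, NormedAddCommGroup (F j)] [∀ j, NormedSpace ℂ (F j)]
  [∀ j, FiniteDimensional ℂ (F j)] {N : ∀ j, HolVB.{v} B X (F j)}
  {θ θ'}

theorem carries_iff (u : PrincipalIso E E') {s : TwistedSection hZ E N}
    {s' : TwistedSection hZ E' N} {φ : SupermixedMorphisms c Y (fun j => (N j).dual)}
    {φ' : SupermixedMorphisms c Y' (fun j => (N j).dual)} (h : θ.Induces s φ)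
    (h' : θ'.Induces s' φ') : u.Carries s s' ↔ (θ.formIso θ' u).Carries φ φ' := by
  have key : ∀ x (p : E.fib x) (q : ∀ j, F j ≃ₗ[ℂ] (N j).fib x) (j : J) (a : Over c.lab j)
      (v : Fin (n (Q.t a.1)) → ℂ) (ξ : (N j).dual.fib x),
      φ'.toFun x j a ((θ.formIso θ' u).toFun x _ (θ.frame x p _ v) ⊗ₜ ξ) =
        (θ.formIso θ' u).toFun x _ (φ.toFun x j a (θ.frame x p _ v ⊗ₜ ξ)) ↔
      c.eM (s'.pairing (u.toFun x p) q j ξ) a.1 v = c.eM (s.pairing p q j ξ) a.1 v := by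
    intro x p q j a v ξ
    rw [formIso_frame, θ.induces_iff.1 h x p q, formIso_frame, θ'.induces_iff.1 h' x _ q]
    exact (θ'.frame x (u.toFun x p) (Q.h a.1)).injective.eq_iff
  constructor
  · intro hu x j a y ξ
    obtain ⟨v, rfl⟩ := (θ.frame x (E.localSection x x) _).surjective y
    refine (key x _ (fun j => (N j).localFrame x x) j a v ξ).2 ?_
    rw [TwistedSection.pairing, hu, TwistedSection.pairing]
  · intro hf x p q
    refine TwistedSection.toFun_eq_of_pairing_eq fun j => LinearMap.ext fun ξ =>
      c.eq_of_eM_over (hZ.mem_P (s'.pairing_mem _ q j ξ)) (hZ.mem_P (s.pairing_mem p q j ξ))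
        fun a => LinearMap.ext fun v => (key x p q j a v ξ).1 (hf x j a _ ξ)

end Associated

/-- The identity of a principal bundle. -/
def PrincipalIso.refl (E : PrincipalBundle.{w} B X (StrGroup.coord S)) : PrincipalIso E E where
  toFun _ p := p
  equivariant _ _ _ := rfl
  hol _ _ h := h

/-- The identity of a bundle with form. -/
def FormIso.refl (Y : FormBundle.{w} B X Q n) : FormIso Y Y where
  toFun _ _ := LinearEquiv.refl _ _
  isometric _ _ _ _ _ := rfl
  hol _ _ _ h := h

/-! ### Isomorphism classes -/

section Classes

variable [SMulCommClass S ℂ M] [SMulCommClass Sᵐᵒᵖ ℂ M] [Module.Finite ℂ M]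
variable {hD : IsDualmod S M} {K : J → Type*}
  [∀ j, Fintype (K j)] {Z : ∀ j, K j → Submodule ℂ M} {hZ : IsRepDecomposition hD P Z}
variable {F : J → Type*} [∀ j, NormedAddCommGroup (F j)] [∀ j, NormedSpace ℂ (F j)]
  [∀ j, FiniteDimensional ℂ (F j)] {N : ∀ j, HolVB.{v} B X (F j)}
  (hP : iSupIndep P)

/-- The class depends neither on the representative nor on `Y` and the identification; with the
identity of `E` this also yields the inverse laws and the formula for `classEquiv`. -/
theorem mk_sectionEquiv_eq {θ : Associated c E Y} {θ' : Associated c E' Y'}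
    {s : TwistedSection hZ E N} {s' : TwistedSection hZ E' N}
    (h : ∃ u : PrincipalIso E E', u.Carries s s') :
    (Quot.mk _ ⟨Y, θ.sectionEquiv hP s⟩ : RepClasses.{v, w} c (fun j => (N j).dual)) =
      Quot.mk _ ⟨Y', θ'.sectionEquiv hP s'⟩ := by
  obtain ⟨u, hu⟩ := h
  exact Quot.sound ⟨_, (Associated.carries_iff u (θ.induces_sectionEquiv hP _)
    (θ'.induces_sectionEquiv hP _)).1 hu⟩

theorem mk_sectionEquiv_symm_eq {θ : Associated c E Y} {θ' : Associated c E' Y'}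
    {φ : SupermixedMorphisms c Y (fun j => (N j).dual)}
    {φ' : SupermixedMorphisms c Y' (fun j => (N j).dual)} (h : ∃ f : FormIso Y Y', f.Carries φ φ') :
    (Quot.mk _ ⟨E, (θ.sectionEquiv hP).symm φ⟩ : GenClasses.{v, w} hZ N) =
      Quot.mk _ ⟨E', (θ'.sectionEquiv hP).symm φ'⟩ := by
  obtain ⟨f, hf⟩ := h
  obtain ⟨u, rfl⟩ := θ.exists_principalIso θ' f
  have h1 := θ.induces_sectionEquiv hP ((θ.sectionEquiv (hZ := hZ) (N := N) hP).symm φ)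
  have h2 := θ'.induces_sectionEquiv hP ((θ'.sectionEquiv (hZ := hZ) (N := N) hP).symm φ')
  rw [Equiv.apply_symm_apply] at h1 h2
  exact Quot.sound ⟨u, (Associated.carries_iff u h1 h2).2 hf⟩

variable [Module.Finite ℂ S] [IsManifold 𝓘(ℂ, B) ω X]

/-- The bijection of isomorphism classes induced by the formation of associated bundles and of
bundles of isometric frames. -/
noncomputable def classEquiv (hs : ∀ (c : ℂ) (a : S), star (c • a) = c • star a)
    (c : Corresponds (S := S) P Q n) :
    GenClasses.{v, w} hZ N ≃ RepClasses.{v, w} c (fun j => (N j).dual) where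
  toFun := Quot.lift
    (fun a => Quot.mk _ ⟨assocBundle c a.1, (assocBundleAssociated c a.1).sectionEquiv hP a.2⟩)
    fun _ _ h => mk_sectionEquiv_eq hP h
  invFun := Quot.lift
    (fun b => Quot.mk _ ⟨framePrincipal c hs b.1,
      ((framePrincipalAssociated c hs b.1).sectionEquiv hP).symm b.2⟩)
    fun _ _ h => mk_sectionEquiv_symm_eq hP h
  left_inv := by
    rintro ⟨E, s⟩
    -- The associated bundle is identified both with that of its frame bundle and with that of `E`;
    -- its identity map compares the two.
    refine (mk_sectionEquiv_symm_eq (θ' := assocBundleAssociated c E) hP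
      ⟨FormIso.refl _, fun _ _ _ _ _ => rfl⟩).trans ?_
    rw [Equiv.symm_apply_apply]
  right_inv := by
    rintro ⟨Y, φ⟩
    refine (mk_sectionEquiv_eq (θ' := framePrincipalAssociated c hs Y) hP
      ⟨PrincipalIso.refl _, fun _ _ _ => rfl⟩).trans ?_
    rw [Equiv.apply_symm_apply]

theorem classEquiv_mk (hs : ∀ (c : ℂ) (a : S), star (c • a) = c • star a)
    (θ : Associated c E Y) (s : TwistedSection hZ E N) :
    classEquiv hP hs c (Quot.mk _ ⟨E, s⟩) = Quot.mk _ ⟨Y, θ.sectionEquiv hP s⟩ :=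
  mk_sectionEquiv_eq hP ⟨PrincipalIso.refl E, fun _ _ _ => rfl⟩

end Classes

end Isomorphisms

end Supermixed

open Supermixed in
theorem mainTheorem9
    {S : Type*} [Ring S] [Algebra ℂ S] [Module.Finite ℂ S] [IsSemisimpleRing S] [StarRing S]
    {M : Type*} [AddCommGroup M] [Module ℂ M] [Module.Finite ℂ M] [Module S M] [Module Sᵐᵒᵖ M]
    [SMulCommClass S Sᵐᵒᵖ M] [IsScalarTower ℂ S M] [IsScalarTower ℂ Sᵐᵒᵖ M]
    [SMulCommClass S ℂ M] [SMulCommClass Sᵐᵒᵖ ℂ M] [StarAddMonoid M]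
    (hD : IsDualmod S M)
    {J : Type*} (P : J → Submodule ℂ M) (hP : IsDualDecomposition S P) :
    (∃ (Q : Quiv) (n : Q.V → ℕ), Nonempty (Corresponds (S := S) P Q n)) ∧
    ∀ (Q : Quiv) (n : Q.V → ℕ) (c : Corresponds (S := S) P Q n)
      {K : J → Type*} [∀ j, Fintype (K j)] (Z : ∀ j, K j → Submodule ℂ M)
      (hZ : IsRepDecomposition hD P Z)
      {B : Type*} [NormedAddCommGroup B] [NormedSpace ℂ B] [FiniteDimensional ℂ B]
      {X : Type*} [TopologicalSpace X] [ChartedSpace B X] [IsManifold 𝓘(ℂ, B) ω X]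
      {F : J → Type*} [∀ j, NormedAddCommGroup (F j)] [∀ j, NormedSpace ℂ (F j)]
      [∀ j, FiniteDimensional ℂ (F j)] (N : ∀ j, HolVB.{v} B X (F j)),
      (∀ E : PrincipalBundle.{w} B X (StrGroup.coord S),
        ∃ Y : FormBundle.{w} B X Q n, Nonempty (Associated c E Y)) ∧
      (∀ Y : FormBundle.{w} B X Q n,
        ∃ E : PrincipalBundle.{w} B X (StrGroup.coord S), Nonempty (Associated c E Y)) ∧
      ∃ Φ : ∀ {E : PrincipalBundle.{w} B X (StrGroup.coord S)} {Y : FormBundle.{w} B X Q n},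
          Associated c E Y →
            (TwistedSection hZ E N ≃ SupermixedMorphisms c Y (fun j => (N j).dual)),
        (∀ {E : PrincipalBundle.{w} B X (StrGroup.coord S)} {Y : FormBundle.{w} B X Q n}
          (θ : Associated c E Y) (s : TwistedSection hZ E N), θ.Induces s (Φ θ s)) ∧
        (∀ {E E' : PrincipalBundle.{w} B X (StrGroup.coord S)} {Y Y' : FormBundle.{w} B X Q n}
          (θ : Associated c E Y) (θ' : Associated c E' Y'),
          ∃ Γ : PrincipalIso E E' ≃ FormIso Y Y',
            (∀ (u : PrincipalIso E E') x (p : E.fib x) i v,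
              (Γ u).toFun x i (θ.frame x p i v) = θ'.frame x (u.toFun x p) i v) ∧
            ∀ (u : PrincipalIso E E') (s : TwistedSection hZ E N) (s' : TwistedSection hZ E' N),
              u.Carries s s' ↔ (Γ u).Carries (Φ θ s) (Φ θ' s')) ∧
        ∃ Ψ : GenClasses.{v, w} hZ N ≃ RepClasses.{v, w} c (fun j => (N j).dual),
          ∀ {E : PrincipalBundle.{w} B X (StrGroup.coord S)} {Y : FormBundle.{w} B X Q n}
            (θ : Associated c E Y) (s : TwistedSection hZ E N),
            Ψ (Quot.mk _ ⟨E, s⟩) = Quot.mk _ ⟨Y, Φ θ s⟩ := by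
  refine ⟨exists_corresponds hD P hP, fun Q n c K _ Z hZ B _ _ _ X _ _ _ F _ _ _ N =>
    ⟨fun E => ⟨assocBundle c E, ⟨assocBundleAssociated c E⟩⟩,
      fun Y => ⟨framePrincipal c hD.star_smul_alg Y,
        ⟨framePrincipalAssociated c hD.star_smul_alg Y⟩⟩,
      fun θ => θ.sectionEquiv hP.indep, fun θ s => θ.induces_sectionEquiv hP.indep s,
      fun θ θ' => ⟨θ.isoEquiv θ', fun u x p i v => θ.formIso_frame θ' u x p i v,
        fun u s s' => Associated.carries_iff u (θ.induces_sectionEquiv hP.indep s)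
          (θ'.induces_sectionEquiv hP.indep s')⟩,
      classEquiv hP.indep hD.star_smul_alg c,
      fun θ s => classEquiv_mk hP.indep hD.star_smul_alg θ s⟩⟩
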